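/- **Theorem 4.2 (stability on the fine grid).** *Data.* Let $T>0$, $\bar\alpha\in(0,1)$, $\Omega=(l_x,r_x)\times(l_y,r_y)$, and let $\alpha:[0,T]\to(1,2)$ be three times differentiable with $\alpha(0)=1+\bar\alpha$, $\alpha'(0)=0$ and $|\alpha'|+|\alpha''|+|\alpha'''|\le Q_\alpha$ on $[0,T]$ for some constant $Q_\alpha$. Let $f\in C^2(\mathbb R)$ with $|f'|\le Q_f$, and let $u_0,\bar u_0$ be real functions on $\bar\Omega$ with $\bar u_0=0$ on $\partial\Omega$. Put $\beta_{\bar\alpha}(t)=t^{\bar\alpha-1}/\Gamma(\bar\alpha)$, $g(0)=1$ and $$g(t)=\int_0^t\beta_{\bar\alpha}(t-s)\,\frac{s^{1-\alpha(s)}}{\Gamma(2-\alpha(s))}\,ds,\qquad 0<t\le T.$$ Let $Q_g>0$ denote a constant with $|g|\le Q_g$, $|g'|\le Q_g$ on $[0,T]$ and $|g''(t)|\le Q_g(|\ln t|+1)$ on $(0,T]$ (derivatives at end points are one-sided). *Time discretization.* For $N\ge1$ let $\tau=T/N$, $t_n=n\tau$, $\delta_tv^n=(v^n-v^{n-1})/\tau$,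 and $$\lambda_{n,j}=\frac1\tau\int_{t_{n-1}}^{t_n}\int_{t_{j-1}}^{\min\{t,t_j\}}\beta_{\bar\alpha}(t-s)\,ds\,dt,\qquad \mathfrak I^n\phi=\lambda_{n,1}\phi^1+\sum_{j=2}^n\lambda_{n,j}\frac{\phi^j+\phi^{j-1}}2,$$ $w_k=g(t_{k+1})-g(t_k)$, $\tilde w_k=\frac12(w_k+w_{k-1})$ for $k\ge1$, $c_0=1+\frac{w_0}2$, $\tilde\lambda_{n,1}=\lambda_{n,1}+\frac12\lambda_{n,2}$, $\tilde\lambda_{n,k}=\frac12(\lambda_{n,k+1}+\lambda_{n,k})$ for $2\le k\le n-1$. *Grids.* Let $M_{H,x},M_{H,y}\ge1$, $J\ge2$, $M_{h,x}=JM_{H,x}$, $M_{h,y}=JM_{H,y}$. For $\kappa\in\{H,h\}$ let $\kappa_x=(r_x-l_x)/M_{\kappa,x}$, $\kappa_y=(r_y-l_y)/M_{\kappa,y}$, with grid points $(x_i,y_j)=(l_x+i\kappa_x,\,l_y+j\kappa_y)$, $0\le i\le M_{\kappa,x}$, $0\le j\le M_{\kappa,y}$; $\omega_\kappa$ is the set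 of indices with $1\le i\le M_{\kappa,x}-1$, $1\le j\le M_{\kappa,y}-1$, and $\partial\omega_\kappa$ the set of the remaining ones. Let $\mathcal A_{\kappa,x}v_{i,j}=\frac1{12}(v_{i-1,j}+10v_{i,j}+v_{i+1,j})$ for $1\le i\le M_{\kappa,x}-1$ and $\mathcal A_{\kappa,x}v_{i,j}=v_{i,j}$ for $i\in\{0,M_{\kappa,x}\}$; $\delta_{\kappa,x}^2v_{i,j}=\kappa_x^{-2}(v_{i+1,j}-2v_{i,j}+v_{i-1,j})$; $\mathcal A_{\kappa,y},\delta^2_{\kappa,y}$ likewise in $j$; $\mathcal A_\kappa=\mathcal A_{\kappa,x}\mathcal A_{\kappa,y}$, $\Lambda_\kappa=\mathcal A_{\kappa,y}\delta_{\kappa,x}^2+\mathcal A_{\kappa,x}\delta_{\kappa,y}^2$ and $\|v\|_\kappa^2=\kappa_x\kappa_y\sum_{(i,j)\in\omega_\kappa}v_{i,j}^2$ (functions on $\bar\Omega$ being evaluated at the grid points). Let $b^n_{i,j}=\frac1\tau\int_{t_{n-1}}^{t_n}g(t)\,\bar u_0(x_i,y_j)\,dt$. Let $\Pi_H=\Pi_{H,y}\Pi_{H,x}$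 be bicubic spline interpolation of coarse grid functions, where the cubic spline interpolants in $x$ and in $y$ are those whose second derivatives vanish at both end points. *Schemes.* Let $U_H^0,\dots,U_H^N$ be grid functions on the coarse grid satisfying, on $\omega_H$, $$c_0\mathcal A_H\delta_tU_H^1-\lambda_{1,1}\Lambda_HU_H^1=\lambda_{1,1}\mathcal A_Hf(U_H^1)+\mathcal A_Hb^1,$$ $$c_0\mathcal A_H\delta_tU_H^n+\sum_{k=1}^{n-1}\tilde w_{n-k}\mathcal A_H\delta_tU_H^k-\mathfrak I^n\Lambda_HU_H=\frac{\lambda_{n,n}}2\mathcal A_Hf(U_H^n)+\sum_{k=1}^{n-1}\tilde\lambda_{n,k}\mathcal A_Hf(U_H^k)+\mathcal A_Hb^n,\quad 2\le n\le N,$$ with $U_H^0=u_0$ on $\omega_H$ and $U_H^n=0$ on $\partial\omega_H$ for $0\le n\le N$. Let $U_h^0,\dots,U_h^N$ be grid functions on the fine grid satisfying, on $\omega_h$, $$c_0\mathcal A_h\delta_tU_h^1-\lambda_{1,1}\Lambda_hU_h^1=\lambda_{1,1}\mathcal A_hF^1+\mathcal A_hb^1,$$ $$c_0\mathcal A_h\delta_tU_h^n+\sum_{k=1}^{n-1}\tilde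 w_{n-k}\mathcal A_h\delta_tU_h^k-\mathfrak I^n\Lambda_hU_h=\frac{\lambda_{n,n}}2\mathcal A_hF^n+\sum_{k=1}^{n-1}\tilde\lambda_{n,k}\mathcal A_hf(U_h^k)+\mathcal A_hb^n,\quad 2\le n\le N,$$ with $U_h^0=u_0$ on $\omega_h$ and $U_h^n=0$ on $\partial\omega_h$ for $0\le n\le N$, where $F^n=f(\Pi_HU_H^n)+f'(\Pi_HU_H^n)(U_h^n-\Pi_HU_H^n)$. *Claim.* For every such $\alpha$ a constant $Q_g$ as above exists. Moreover, there are constants $Q>0$ and $\tau_0>0$ that depend only on $T,\bar\alpha,Q_g,Q_f$ such that, whenever $\tau\le\tau_0$, $$\|U_h^n\|_h\le Q\big(\|u_0\|_h+\|f(u_0)\|_h+\|\bar u_0\|_h+\|u_0\|_H+\|f(u_0)\|_H+\|\bar u_0\|_H\big),\qquad 1\le n\le N.$$ -/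

import Mathlib

open Set

noncomputable section

namespace STG

/-! ## Time kernels and quadrature weights -/

/-- The Abel kernel `β_a(t) = t^(a-1) / Γ(a)`. -/
def abel (a t : ℝ) : ℝ := t ^ (a - 1) / Real.Gamma a

/-- The variable-exponent kernel `k(t) = t^(1-α(t)) / Γ(2-α(t))`. -/
def varKernel (α : ℝ → ℝ) (t : ℝ) : ℝ := t ^ (1 - α t) / Real.Gamma (2 - α t)

/-- The constant exponent `ᾱ = α(0) - 1`. -/
def abar (α : ℝ → ℝ) : ℝ := α 0 - 1

/-- The generalized identity function `g = β_{α(0)-1} * k`, with its limit value `g(0) = 1` at the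
origin (where the integral over the empty interval says nothing). -/
def genId (α : ℝ → ℝ) (t : ℝ) : ℝ :=
  if t = 0 then 1 else ∫ s in (0 : ℝ)..t, abel (abar α) (t - s) * varKernel α s

/-- The conditions on the exponent on `[0,T]`: values in `(1,2)`, three times differentiable with
`|α'| + |α''| + |α'''| ≤ Qα`, and `α'(0) = 0`. -/
structure IsAdmissible (α : ℝ → ℝ) (T Qα : ℝ) : Prop where
  mem_Ioo : ∀ t ∈ Icc 0 T, α t ∈ Ioo (1 : ℝ) 2
  diff : ∀ k < 3, DifferentiableOn ℝ (iteratedDerivWithin k α (Icc 0 T)) (Icc 0 T)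
  bound : ∀ t ∈ Icc 0 T, |iteratedDerivWithin 1 α (Icc 0 T) t|
    + |iteratedDerivWithin 2 α (Icc 0 T) t| + |iteratedDerivWithin 3 α (Icc 0 T) t| ≤ Qα
  deriv_zero : derivWithin α (Icc 0 T) 0 = 0

/-- `Qg` is a bound for the generalized identity function: `|g|, |g'| ≤ Qg` on `[0,T]` and
`|g''(t)| ≤ Qg (|ln t| + 1)` on `(0,T]` (one-sided derivatives at the end points). -/
structure IsGenIdBound (α : ℝ → ℝ) (T Qg : ℝ) : Prop where
  bound : ∀ t ∈ Icc 0 T, |genId α t| ≤ Qg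
  diff : DifferentiableOn ℝ (genId α) (Icc 0 T)
  bound_deriv : ∀ t ∈ Icc 0 T, |derivWithin (genId α) (Icc 0 T) t| ≤ Qg
  diff_deriv : ∀ t ∈ Ioc 0 T,
    DifferentiableWithinAt ℝ (derivWithin (genId α) (Icc 0 T)) (Icc 0 T) t
  bound_deriv_two : ∀ t ∈ Ioc 0 T,
    |derivWithin (derivWithin (genId α) (Icc 0 T)) (Icc 0 T) t| ≤ Qg * (|Real.log t| + 1)

/-- The weights `λ_{n,j} = τ⁻¹ ∫_{t_{n-1}}^{t_n} ∫_{t_{j-1}}^{min(t,t_j)} β_a(t-s) ds dt` of the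
averaged product integration rule, where `t_m = m τ` (used for `1 ≤ j ≤ n`). -/
def lam (a τ : ℝ) (n j : ℕ) : ℝ :=
  (1 / τ) * ∫ t in (((n : ℝ) - 1) * τ)..((n : ℝ) * τ),
    ∫ s in (((j : ℝ) - 1) * τ)..(min t ((j : ℝ) * τ)), abel a (t - s)

/-- The combined weights `λ̃_{n,k}`, `1 ≤ k ≤ n - 1`. -/
def lamTilde (a τ : ℝ) (n k : ℕ) : ℝ :=
  if k = 1 then lam a τ n 1 + lam a τ n 2 / 2 else (lam a τ n (k + 1) + lam a τ n k) / 2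

/-- The averaged product integration rule
`𝓘ⁿ φ = λ_{n,1} φ¹ + ∑_{j=2}^n λ_{n,j} (φ^j + φ^{j-1}) / 2`. -/
def prodInt (a τ : ℝ) (n : ℕ) (φ : ℕ → ℝ) : ℝ :=
  lam a τ n 1 * φ 1 + ∑ j ∈ Finset.Icc 2 n, lam a τ n j * ((φ j + φ (j - 1)) / 2)

/-- `w_k = g(t_{k+1}) - g(t_k)`. -/
def w (α : ℝ → ℝ) (τ : ℝ) (k : ℕ) : ℝ :=
  genId α (((k : ℝ) + 1) * τ) - genId α ((k : ℝ) * τ)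

/-- `w̃_0 = w_0 / 2` and `w̃_k = (w_k + w_{k-1}) / 2` for `k ≥ 1`. -/
def wTilde (α : ℝ → ℝ) (τ : ℝ) (k : ℕ) : ℝ :=
  if k = 0 then w α τ 0 / 2 else (w α τ k + w α τ (k - 1)) / 2

/-- `c_0 = 1 + w_0 / 2`. -/
def c0 (α : ℝ → ℝ) (τ : ℝ) : ℝ := 1 + w α τ 0 / 2

/-! ## Spatial grids and compact difference operators -/

/-- A uniform grid on `[lx,rx] × [ly,ry]` with `Mx × My` cells. -/
structure Grid where
  lx : ℝ
  rx : ℝ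
  ly : ℝ
  ry : ℝ
  Mx : ℕ
  My : ℕ

/-- Grid functions. Only the values at the indices `0 ≤ i ≤ Mx`, `0 ≤ j ≤ My` matter. -/
abbrev GridFn := ℕ → ℕ → ℝ

namespace Grid

variable (G : Grid)

/-- The open rectangle `Ω = (lx,rx) × (ly,ry)`. -/
def domain : Set (ℝ × ℝ) := Ioo G.lx G.rx ×ˢ Ioo G.ly G.ry

def dx : ℝ := (G.rx - G.lx) / G.Mx

def dy : ℝ := (G.ry - G.ly) / G.My

/-- The grid point `(x_i, y_j)`. -/
def pt (i j : ℕ) : ℝ × ℝ := (G.lx + i * G.dx, G.ly + j * G.dy)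

/-- The refinement of a grid in which every cell is cut into `J × J` cells. -/
def refine (J : ℕ) : Grid := { G with Mx := J * G.Mx, My := J * G.My }

/-- `(i,j) ∈ ω`. -/
def Interior (i j : ℕ) : Prop := (1 ≤ i ∧ i + 1 ≤ G.Mx) ∧ (1 ≤ j ∧ j + 1 ≤ G.My)

/-- `(i,j) ∈ ∂ω`. -/
def Boundary (i j : ℕ) : Prop := (i ≤ G.Mx ∧ j ≤ G.My) ∧ ¬ G.Interior i j

/-- The averaging operator `𝓐_x`. -/
def avgX (u : GridFn) : GridFn := fun i j =>
  if 1 ≤ i ∧ i + 1 ≤ G.Mx then (u (i - 1) j + 10 * u i j + u (i + 1) j) / 12 else u i j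

/-- The averaging operator `𝓐_y`. -/
def avgY (u : GridFn) : GridFn := fun i j =>
  if 1 ≤ j ∧ j + 1 ≤ G.My then (u i (j - 1) + 10 * u i j + u i (j + 1)) / 12 else u i j

/-- The second difference `δ_x²` (used for `1 ≤ i ≤ Mx - 1`). -/
def diffX (u : GridFn) : GridFn := fun i j =>
  (u (i + 1) j - 2 * u i j + u (i - 1) j) / G.dx ^ 2

/-- The second difference `δ_y²` (used for `1 ≤ j ≤ My - 1`). -/
def diffY (u : GridFn) : GridFn := fun i j =>
  (u i (j + 1) - 2 * u i j + u i (j - 1)) / G.dy ^ 2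

/-- `𝓐 = 𝓐_x 𝓐_y`. -/
def avg (u : GridFn) : GridFn := G.avgX (G.avgY u)

/-- `Λ = 𝓐_y δ_x² + 𝓐_x δ_y²`. -/
def lap (u : GridFn) : GridFn := fun i j => G.avgY (G.diffX u) i j + G.avgX (G.diffY u) i j

/-- The discrete inner product (a sum over interior points). -/
def inner (u v : GridFn) : ℝ :=
  G.dx * G.dy * ∑ i ∈ Finset.Icc 1 (G.Mx - 1), ∑ j ∈ Finset.Icc 1 (G.My - 1), u i j * v i j

/-- The discrete `L²` norm. -/
def norm (u : GridFn) : ℝ := Real.sqrt (G.inner u u)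

/-- The restriction of a function to the grid. -/
def sample (v : ℝ × ℝ → ℝ) : GridFn := fun i j => v (G.pt i j)

end Grid

/-! ## Cubic spline interpolation with vanishing boundary coefficients -/

/-- The matrix `½ tridiag(1,4,1)`. -/
def splineMatrix (m : ℕ) : Matrix (Fin m) (Fin m) ℝ := Matrix.of fun i j =>
  (1 / 2) * (if i = j then 4 else if i.val + 1 = j.val ∨ j.val + 1 = i.val then 1 else 0)

/-- The coefficients `𝓜_0, …, 𝓜_M` of the cubic spline with mesh size `H` through the nodal values
`v_0, …, v_M`: `𝓜_0 = 𝓜_M = 0` and `½ (𝓜_{i-1} + 4 𝓜_i + 𝓜_{i+1}) = 3 [δ² v]_i` for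
`1 ≤ i ≤ M - 1`. -/
def splineCoeff (M : ℕ) (H : ℝ) (v : ℕ → ℝ) (i : ℕ) : ℝ :=
  if h : 1 ≤ i ∧ i ≤ M - 1 then
    ((splineMatrix (M - 1))⁻¹.mulVec fun k : Fin (M - 1) =>
      3 * ((v (k + 2) - 2 * v (k + 1) + v k) / H ^ 2)) ⟨i - 1, by omega⟩
  else 0

/-- The polynomial piece of the spline on the cell `[x_{i-1}, x_i]`, where `x_i = l + i H`. -/
def splinePiece (M : ℕ) (H l : ℝ) (v : ℕ → ℝ) (i : ℕ) (x : ℝ) : ℝ :=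
  splineCoeff M H v (i - 1) * ((l + i * H) - x) ^ 3 / (6 * H)
    + splineCoeff M H v i * (x - (l + ((i : ℝ) - 1) * H)) ^ 3 / (6 * H)
    + (v (i - 1) - splineCoeff M H v (i - 1) * H ^ 2 / 6) * (((l + i * H) - x) / H)
    + (v i - splineCoeff M H v i * H ^ 2 / 6) * ((x - (l + ((i : ℝ) - 1) * H)) / H)

/-- The cubic spline interpolant of the nodal values `v`; `max 1 ⌈(x - l) / H⌉` is the number of a
cell containing `x`. -/
def spline (M : ℕ) (H l : ℝ) (v : ℕ → ℝ) (x : ℝ) : ℝ :=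
  splinePiece M H l v (max 1 ⌈(x - l) / H⌉₊) x

/-- The bicubic spline interpolant `Π u = Π_y Π_x u` of a grid function `u` on `G`. -/
def Grid.bicubic (G : Grid) (u : GridFn) (p : ℝ × ℝ) : ℝ :=
  spline G.My G.dy G.ly (fun j => spline G.Mx G.dx G.lx (fun i => u i j) p.1) p.2

/-! ## The two schemes -/

/-- `δ_t Uⁿ = (Uⁿ - Uⁿ⁻¹) / τ`, `n ≥ 1`. -/
def dt (τ : ℝ) (U : ℕ → GridFn) (n : ℕ) : GridFn := fun i j => (U n i j - U (n - 1) i j) / τ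

/-- `b_{i,j}ⁿ = τ⁻¹ ∫_{t_{n-1}}^{t_n} g(t) ū₀(x_i,y_j) dt`. -/
def bTerm (G : Grid) (α : ℝ → ℝ) (τ : ℝ) (v0 : ℝ × ℝ → ℝ) (n : ℕ) : GridFn := fun i j =>
  (1 / τ) * ∫ t in (((n : ℝ) - 1) * τ)..((n : ℝ) * τ), genId α t * v0 (G.pt i j)

/-- `U⁰, …, U^N` solve the nonlinear compact difference scheme on the grid `G`, for the source `f`
and the initial data `u0`, `v0` (initial value and initial velocity). -/
structure IsNonlinearSolution (G : Grid) (α f : ℝ → ℝ) (u0 v0 : ℝ × ℝ → ℝ) (τ : ℝ) (N : ℕ)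
    (U : ℕ → GridFn) : Prop where
  first : ∀ i j, G.Interior i j →
    c0 α τ * G.avg (dt τ U 1) i j - lam (abar α) τ 1 1 * G.lap (U 1) i j
      = lam (abar α) τ 1 1 * G.avg (fun p q => f (U 1 p q)) i j + G.avg (bTerm G α τ v0 1) i j
  step : ∀ n, 2 ≤ n → n ≤ N → ∀ i j, G.Interior i j →
    c0 α τ * G.avg (dt τ U n) i j
        + ∑ k ∈ Finset.Icc 1 (n - 1), wTilde α τ (n - k) * G.avg (dt τ U k) i j
        - prodInt (abar α) τ n (fun m => G.lap (U m) i j)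
      = lam (abar α) τ n n / 2 * G.avg (fun p q => f (U n p q)) i j
        + ∑ k ∈ Finset.Icc 1 (n - 1),
            lamTilde (abar α) τ n k * G.avg (fun p q => f (U k p q)) i j
        + G.avg (bTerm G α τ v0 n) i j
  init : ∀ i j, G.Interior i j → U 0 i j = u0 (G.pt i j)
  bdry : ∀ n ≤ N, ∀ i j, G.Boundary i j → U n i j = 0

/-- The Newton linearization `F = f(P) + f'(P) (U - P)` of `f(U)` around `P`. -/
def newton (f : ℝ → ℝ) (P U : GridFn) : GridFn := fun i j =>
  f (P i j) + deriv f (P i j) * (U i j - P i j)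

/-- `U⁰, …, U^N` solve the linearized compact difference scheme on the grid `G`, in which the source
at the current time level is linearized around the given grid functions `P¹, …, P^N`. -/
structure IsLinearizedSolution (G : Grid) (α f : ℝ → ℝ) (u0 v0 : ℝ × ℝ → ℝ) (τ : ℝ) (N : ℕ)
    (P U : ℕ → GridFn) : Prop where
  first : ∀ i j, G.Interior i j →
    c0 α τ * G.avg (dt τ U 1) i j - lam (abar α) τ 1 1 * G.lap (U 1) i j
      = lam (abar α) τ 1 1 * G.avg (newton f (P 1) (U 1)) i j + G.avg (bTerm G α τ v0 1) i j
  step : ∀ n, 2 ≤ n → n ≤ N → ∀ i j, G.Interior i j →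
    c0 α τ * G.avg (dt τ U n) i j
        + ∑ k ∈ Finset.Icc 1 (n - 1), wTilde α τ (n - k) * G.avg (dt τ U k) i j
        - prodInt (abar α) τ n (fun m => G.lap (U m) i j)
      = lam (abar α) τ n n / 2 * G.avg (newton f (P n) (U n)) i j
        + ∑ k ∈ Finset.Icc 1 (n - 1),
            lamTilde (abar α) τ n k * G.avg (fun p q => f (U k p q)) i j
        + G.avg (bTerm G α τ v0 n) i j
  init : ∀ i j, G.Interior i j → U 0 i j = u0 (G.pt i j)
  bdry : ∀ n ≤ N, ∀ i j, G.Boundary i j → U n i j = 0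

end STG

end

/-! Both schemes are one discrete Volterra scheme that differs only in the source at the current
time level (`IsSchemeSolution`). Stability on a single grid is an energy argument: the equation at
level n is tested with the quantity that the quadrature rule itself uses, ψ₁ = U¹ and ψₙ = (Uⁿ +
Uⁿ⁻¹)/2 (`halfStep`). Four facts make this work.

The time difference yields at least half the increment of the energy ⟨𝓐U, U⟩, which lies between 4/9
‖U‖² and ‖U‖² (`energy_step`, `Grid.le_massForm`, `Grid.massForm_le`).

The diffusion term, summed over n, is a quadratic form with the weights λ. These are Toeplitz, and
their entries are second differences of x^(1+a) with half of the value 2 on the diagonal. This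
sequence is nonnegative, nonincreasing and convex, so the form is a nonnegative combination of Fejér
kernels and can be dropped (`toeplitz_half_nonneg`, `lam_form_nonneg`).

In the memory term, summation by parts in time moves the difference from U to the weights w̃. Their
variation is O(τ), because the logarithmic bound for g'' has a primitive that is finite at 0
(`IsGenIdBound.variation_wTilde_le`, `abs_memory_le`).

The sources grow at most linearly and their weights have bounded row sums
(`Grid.inner_avg_source_le`, `sum_srcWeight_le`). A discrete Gronwall inequality for the running
maximum of the energy concludes (`energy_estimate`, `IsSchemeSolution.stability`). On the boundary
f(U) equals f(0), which need not vanish; this constant is absorbed by f(u₀) and u₀ at the interior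
nodes, so the size of Ω does not enter.

On the fine grid the Newton source is at most |f(0)| + Qf |U_h| + 2 Qf |Π U_H|. Spline interpolation
is bounded in the discrete L² norms uniformly in the refinement factor (`Grid.closedSq_bicubic_le`),
so the coarse estimate bounds the extra term.

For the existence of Q_g, the substitution s = tz writes g(t) as the average of K(tz) against the
Beta(1-a, a) law, where K(s) = s^(1+a-α(s)) Γ(1-a)/Γ(2-α(s)). Since α'(0) = 0, the exponent is
O(s²); hence K is differentiable up to 0 with bounded derivative and K'' grows at most like |ln s|.
Averaging preserves this (`genId_eq_integral`, `exists_regKernel_deriv`,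
`hasDerivWithinAt_average`). -/

namespace STG

/-! ### Positivity of convex Toeplitz kernels -/

section Toeplitz

variable {V : Type*} [AddCommGroup V] [Module ℝ V]

/-- The number of windows of length `k` that contain both `n` and `j`. -/
lemma sum_window_indicator (k m n j : ℕ) (hn : n < m) :
    ∑ l ∈ Finset.range (m + k),
      (if l ∈ Finset.Ico n (n + k) then (1 : ℝ) else 0) *
        (if l ∈ Finset.Ico j (j + k) then (1 : ℝ) else 0)
      = ((k - ((n - j) + (j - n)) : ℕ) : ℝ) := by
  have h1 : ∀ l, (if l ∈ Finset.Ico n (n + k) then (1 : ℝ) else 0) *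
        (if l ∈ Finset.Ico j (j + k) then (1 : ℝ) else 0)
      = if l ∈ Finset.Ico (max n j) (min (n + k) (j + k)) then (1 : ℝ) else 0 := by
    intro l
    simp only [← Finset.Ico_inter_Ico, Finset.mem_inter]
    by_cases h : l ∈ Finset.Ico n (n + k) <;> by_cases h' : l ∈ Finset.Ico j (j + k) <;>
      simp only [h, h', if_true, if_false, and_true, and_false] <;> norm_num
  simp_rw [h1]
  rw [Finset.sum_ite_mem, Finset.inter_eq_right.2]
  · rw [Finset.sum_const, Nat.card_Ico, nsmul_eq_mul, mul_one]
    congr 1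
    omega
  · intro l hl
    rw [Finset.mem_Ico] at hl
    rw [Finset.mem_range]
    omega

/-- The tent counts the windows of length k that contain both indices. The form is therefore a sum
over windows of B on the diagonal, evaluated at the partial sum of x over the window. -/
lemma fejer_nonneg (B : V →ₗ[ℝ] V →ₗ[ℝ] ℝ) (hp : ∀ x, 0 ≤ B x x) (x : ℕ → V) (k m : ℕ) :
    0 ≤ ∑ n ∈ Finset.range m, ∑ j ∈ Finset.range m,
      ((k - ((n - j) + (j - n)) : ℕ) : ℝ) * B (x j) (x n) := by
  have key : ∑ n ∈ Finset.range m, ∑ j ∈ Finset.range m,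
      ((k - ((n - j) + (j - n)) : ℕ) : ℝ) * B (x j) (x n)
      = ∑ l ∈ Finset.range (m + k),
        B (∑ j ∈ Finset.range m, (if l ∈ Finset.Ico j (j + k) then (1 : ℝ) else 0) • x j)
          (∑ n ∈ Finset.range m, (if l ∈ Finset.Ico n (n + k) then (1 : ℝ) else 0) • x n) := by
    simp only [map_sum, LinearMap.sum_apply, map_smul, LinearMap.smul_apply, smul_eq_mul,
      Finset.mul_sum]
    symm
    rw [Finset.sum_comm]
    refine Finset.sum_congr rfl fun n hn => ?_
    rw [Finset.sum_comm]
    refine Finset.sum_congr rfl fun j hj => ?_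
    rw [← sum_window_indicator k m n j (Finset.mem_range.1 hn), Finset.sum_mul]
    refine Finset.sum_congr rfl fun l hl => ?_
    ring
  rw [key]
  exact Finset.sum_nonneg fun l _ => hp _

/-- Expansion of a sequence in the tent functions `(k - d)₊`. -/
lemma tent_expansion (a : ℕ → ℝ) (d K : ℕ) (h : d ≤ K) :
    a d = a K + ((K - d : ℕ) : ℝ) * (a K - a (K + 1))
      + ∑ k ∈ Finset.range K, ((k + 1 - d : ℕ) : ℝ) * (a k - 2 * a (k + 1) + a (k + 2)) := by
  induction K, h using Nat.le_induction with
  | base =>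
    rw [Finset.sum_eq_zero]
    · simp
    · intro k hk
      rw [Finset.mem_range] at hk
      rw [Nat.sub_eq_zero_of_le (by omega)]
      simp
  | succ K hK ih =>
    rw [Finset.sum_range_succ]
    conv_lhs => rw [ih]
    rw [Nat.cast_sub hK, Nat.cast_sub (by omega : d ≤ K + 1)]
    push_cast
    ring

/-- Such a sequence is a nonnegative combination of a constant and of tents: the constant
contributes B at the total sum of x, and the tents are handled by `fejer_nonneg`. -/
lemma toeplitz_nonneg (B : V →ₗ[ℝ] V →ₗ[ℝ] ℝ) (hp : ∀ x, 0 ≤ B x x) (a : ℕ → ℝ)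
    (h0 : ∀ k, 0 ≤ a k) (h1 : ∀ k, 1 ≤ k → a (k + 1) ≤ a k)
    (h2 : ∀ k, 0 ≤ a k - 2 * a (k + 1) + a (k + 2)) (x : ℕ → V) (m : ℕ) :
    0 ≤ ∑ n ∈ Finset.range m, ∑ j ∈ Finset.range m, a ((n - j) + (j - n)) * B (x j) (x n) := by
  -- The tent expansion is cut at m + 1, beyond every distance that occurs, so one set of
  -- coefficients serves all entries.
  have key : ∑ n ∈ Finset.range m, ∑ j ∈ Finset.range m, a ((n - j) + (j - n)) * B (x j) (x n)
      = a (m + 1) * B (∑ j ∈ Finset.range m, x j) (∑ j ∈ Finset.range m, x j)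
        + (a (m + 1) - a (m + 2)) * ∑ n ∈ Finset.range m, ∑ j ∈ Finset.range m,
          ((m + 1 - ((n - j) + (j - n)) : ℕ) : ℝ) * B (x j) (x n)
        + ∑ k ∈ Finset.range (m + 1), (a k - 2 * a (k + 1) + a (k + 2)) *
          ∑ n ∈ Finset.range m, ∑ j ∈ Finset.range m,
            ((k + 1 - ((n - j) + (j - n)) : ℕ) : ℝ) * B (x j) (x n) := by
    simp only [map_sum, LinearMap.sum_apply, Finset.mul_sum]
    rw [Finset.sum_comm (s := Finset.range (m + 1)),
      Finset.sum_comm (f := fun i j => a (m + 1) * B (x j) (x i)),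
      Finset.sum_comm (f := fun i j => a (m + 1) * B (x i) (x j))]
    rw [← Finset.sum_add_distrib, ← Finset.sum_add_distrib]
    refine Finset.sum_congr rfl fun n hn => ?_
    rw [Finset.sum_comm (s := Finset.range (m + 1)), ← Finset.sum_add_distrib,
      ← Finset.sum_add_distrib]
    refine Finset.sum_congr rfl fun j hj => ?_
    rw [Finset.mem_range] at hn hj
    rw [tent_expansion a ((n - j) + (j - n)) (m + 1) (by omega), add_mul, add_mul, Finset.sum_mul]
    congr 1
    · ring
    · refine Finset.sum_congr rfl fun k _ => ?_
      ring
  rw [key]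
  refine add_nonneg (add_nonneg (mul_nonneg (h0 _) (hp _)) (mul_nonneg ?_ ?_)) ?_
  · linarith [h1 (m + 1) (by omega)]
  · exact fejer_nonneg B hp x _ _
  · exact Finset.sum_nonneg fun k _ => mul_nonneg (h2 k) (fejer_nonneg B hp x _ _)

/-- The lower triangular part of a convex Toeplitz kernel, with half of its diagonal, is
nonnegative. -/
lemma toeplitz_half_nonneg (B : V →ₗ[ℝ] V →ₗ[ℝ] ℝ) (hs : ∀ x y, B x y = B y x)
    (hp : ∀ x, 0 ≤ B x x) (a : ℕ → ℝ)
    (h0 : ∀ k, 0 ≤ a k) (h1 : ∀ k, 1 ≤ k → a (k + 1) ≤ a k)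
    (h2 : ∀ k, 0 ≤ a k - 2 * a (k + 1) + a (k + 2)) (x : ℕ → V) (m : ℕ) :
    0 ≤ ∑ n ∈ Finset.range m, ∑ j ∈ Finset.range (n + 1),
      (if j = n then a 0 / 2 else a (n - j)) * B (x j) (x n) := by
  -- The full symmetric form is twice the halved triangle: passing from m to m + 1 adds a row and a
  -- column that agree by symmetry of B.
  have key : ∀ m, ∑ n ∈ Finset.range m, ∑ j ∈ Finset.range m,
        a ((n - j) + (j - n)) * B (x j) (x n)
      = 2 * ∑ n ∈ Finset.range m, ∑ j ∈ Finset.range (n + 1),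
        (if j = n then a 0 / 2 else a (n - j)) * B (x j) (x n) := by
    intro m
    induction m with
    | zero => simp
    | succ m ih =>
      simp only [Finset.sum_range_succ _ m, Finset.sum_add_distrib]
      rw [ih, mul_add, Finset.sum_congr rfl (fun j hj => ?_ : ∀ j ∈ Finset.range m,
        a ((j - m) + (m - j)) * B (x m) (x j) = a (m - j) * B (x j) (x m)),
        Finset.sum_congr rfl (fun j hj => ?_ : ∀ j ∈ Finset.range m,
        a ((m - j) + (j - m)) * B (x j) (x m) = a (m - j) * B (x j) (x m)),
        Finset.sum_congr rfl (fun j hj => ?_ : ∀ j ∈ Finset.range m,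
        (if j = m then a 0 / 2 else a (m - j)) * B (x j) (x m) = a (m - j) * B (x j) (x m))]
      · simp only [if_true, Nat.sub_self, Nat.add_zero]
        ring
      · rw [Finset.mem_range] at hj
        rw [if_neg (by omega)]
      · rw [Finset.mem_range] at hj
        rw [Nat.sub_eq_zero_of_le (by omega : j ≤ m), Nat.add_zero]
      · rw [Finset.mem_range] at hj
        rw [Nat.sub_eq_zero_of_le (by omega : j ≤ m), Nat.zero_add, hs]
  have := toeplitz_nonneg B hp a h0 h1 h2 x m
  rw [key] at this
  linarith

end Toeplitz

/-! ### Second differences of powers -/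

lemma midpoint_of_convexOn {f : ℝ → ℝ} {s : Set ℝ} (hf : ConvexOn ℝ s f) {x : ℝ}
    (h1 : x - 1 ∈ s) (h2 : x + 1 ∈ s) : 0 ≤ f (x + 1) - 2 * f x + f (x - 1) := by
  have := hf.2 h1 h2 (by norm_num : (0 : ℝ) ≤ 1 / 2) (by norm_num : (0 : ℝ) ≤ 1 / 2) (by norm_num)
  simp only [smul_eq_mul] at this
  rw [show 1 / 2 * (x - 1) + 1 / 2 * (x + 1) = x by ring] at this
  linarith

lemma convexOn_rpow_of_nonpos {r : ℝ} (hr : r ≤ 0) :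
    ConvexOn ℝ (Ioi 0) fun x : ℝ => x ^ r := by
  refine convexOn_of_hasDerivWithinAt2_nonneg (convex_Ioi 0) (f' := fun x => r * x ^ (r - 1))
    (f'' := fun x => r * ((r - 1) * x ^ (r - 1 - 1))) ?_ ?_ ?_ ?_
  · exact fun x hx => (Real.continuousAt_rpow_const _ _ (Or.inl (ne_of_gt hx))).continuousWithinAt
  · intro x hx
    rw [interior_Ioi] at hx
    exact (Real.hasDerivAt_rpow_const (Or.inl (ne_of_gt hx))).hasDerivWithinAt
  · intro x hx
    rw [interior_Ioi] at hx
    exact ((Real.hasDerivAt_rpow_const (Or.inl (ne_of_gt hx))).const_mul r).hasDerivWithinAt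
  · intro x hx
    rw [interior_Ioi] at hx
    have : 0 ≤ x ^ (r - 1 - 1) := Real.rpow_nonneg hx.le _
    have h2 : 0 ≤ r * (r - 1) := mul_nonneg_of_nonpos_of_nonpos hr (by linarith)
    calc 0 ≤ r * (r - 1) * x ^ (r - 1 - 1) := mul_nonneg h2 this
      _ = _ := by ring

/-- The second difference `(x+1)^p - 2x^p + (x-1)^p`. -/
noncomputable def powDiff (p x : ℝ) : ℝ := (x + 1) ^ p - 2 * x ^ p + (x - 1) ^ p

lemma hasDerivAt_powDiff {p x : ℝ} (hx : 1 < x) :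
    HasDerivAt (powDiff p) (p * powDiff (p - 1) x) x := by
  have h1 := (Real.hasDerivAt_rpow_const (p := p) (Or.inl (by linarith : x + 1 ≠ 0))).comp_add_const
    x 1
  have h2 := Real.hasDerivAt_rpow_const (p := p) (Or.inl (by linarith : x ≠ 0))
  have h3 := (Real.hasDerivAt_rpow_const (p := p) (Or.inl (by linarith : x - 1 ≠ 0))).comp_sub_const
    x 1
  refine ((h1.sub (h2.const_mul 2)).add h3).congr_deriv ?_
  unfold powDiff
  ring

lemma continuous_powDiff {p : ℝ} (hp : 0 ≤ p) : Continuous (powDiff p) := by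
  unfold powDiff
  have := Real.continuous_rpow_const hp
  exact ((this.comp (continuous_id.add continuous_const)).sub (continuous_const.mul this)).add
    (this.comp (continuous_id.sub continuous_const))

section

variable {a : ℝ} (ha : a ∈ Ioo (0 : ℝ) 1)
include ha

lemma powDiff_nonneg {x : ℝ} (hx : 1 ≤ x) : 0 ≤ powDiff (1 + a) x :=
  midpoint_of_convexOn (convexOn_rpow (by linarith [ha.1])) (by simpa using hx)
    (by simp only [mem_Ici]; linarith)

/-- The derivative is 1 + a times the second difference of the concave function x^a. -/
lemma antitoneOn_powDiff : AntitoneOn (powDiff (1 + a)) (Ici 1) := by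
  refine antitoneOn_of_hasDerivWithinAt_nonpos (f' := fun x => (1 + a) * powDiff (1 + a - 1) x)
    (convex_Ici 1)
    (continuous_powDiff (by linarith [ha.1])).continuousOn ?_ ?_
  · intro x hx
    rw [interior_Ici] at hx
    exact (hasDerivAt_powDiff hx).hasDerivWithinAt
  · intro x hx
    rw [interior_Ici] at hx
    have hx' : 1 < x := hx
    have := midpoint_of_convexOn (Real.concaveOn_rpow (p := 1 + a - 1) (by linarith [ha.1])
      (by linarith [ha.2])).neg (x := x) (by simp; linarith) (by simp; linarith)
    simp only [Pi.neg_apply] at this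
    have h2 : powDiff (1 + a - 1) x ≤ 0 := by
      unfold powDiff
      linarith
    exact mul_nonpos_of_nonneg_of_nonpos (by linarith [ha.1]) h2

/-- The second derivative is a positive multiple of the second difference of the convex function
x^(a-1). -/
lemma convexOn_powDiff : ConvexOn ℝ (Ici 1) (powDiff (1 + a)) := by
  refine convexOn_of_hasDerivWithinAt2_nonneg (convex_Ici 1)
    (f' := fun x => (1 + a) * powDiff (1 + a - 1) x)
    (f'' := fun x => (1 + a) * ((1 + a - 1) * powDiff (1 + a - 1 - 1) x))
    (continuous_powDiff (by linarith [ha.1])).continuousOn ?_ ?_ ?_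
  · intro x hx
    rw [interior_Ici] at hx
    exact (hasDerivAt_powDiff hx).hasDerivWithinAt
  · intro x hx
    rw [interior_Ici] at hx
    exact ((hasDerivAt_powDiff hx).const_mul _).hasDerivWithinAt
  · intro x hx
    rw [interior_Ici] at hx
    have hx' : 1 < x := hx
    have : 0 ≤ powDiff (1 + a - 1 - 1) x :=
      midpoint_of_convexOn (convexOn_rpow_of_nonpos (r := 1 + a - 1 - 1) (by linarith [ha.2]))
        (by simp; linarith) (by simp; linarith)
    have := ha.1
    have : 0 ≤ 1 + a - 1 := by linarith
    positivity

/-- This is the convexity of `kerSeq` at index 0, which calculus on [1, ∞) does not reach. With y =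
2^(a-1) ≤ 1 and q = log 3 / log 2 the expression is 7 - 16 y + 9 y^q, and Bernoulli's inequality for
y^q bounds it below by (16 - 9q)(1 - y). -/
lemma three_rpow_two_rpow : 0 ≤ 7 - 4 * (2 : ℝ) ^ (1 + a) + 3 ^ (1 + a) := by
  set y : ℝ := 2 ^ (a - 1) with hy
  have hy1 : y ≤ 1 := Real.rpow_le_one_of_one_le_of_nonpos (by norm_num) (by linarith [ha.2])
  have hy0 : 0 < y := Real.rpow_pos_of_pos (by norm_num) _
  have h2 : (2 : ℝ) ^ (1 + a) = 4 * y := by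
    rw [hy, show 1 + a = (a - 1) + (2 : ℕ) by push_cast; ring, Real.rpow_add (by norm_num),
      Real.rpow_natCast]
    ring
  set q : ℝ := Real.log 3 / Real.log 2 with hq
  have hl2 : 0 < Real.log 2 := Real.log_pos (by norm_num)
  have hq1 : 1 ≤ q := by
    rw [hq, one_le_div hl2]
    exact Real.log_le_log (by norm_num) (by norm_num)
  -- The bound q ≤ 16/9 is just 3^9 ≤ 2^16.
  have hq2 : 9 * q ≤ 16 := by
    have : Real.log ((3 : ℝ) ^ 9) ≤ Real.log ((2 : ℝ) ^ 16) :=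
      Real.log_le_log (by norm_num) (by norm_num)
    rw [Real.log_pow, Real.log_pow] at this
    push_cast at this
    rw [hq, ← mul_div_assoc, div_le_iff₀ hl2]
    exact this
  have h3 : (3 : ℝ) ^ (1 + a) = 9 * y ^ q := by
    rw [hy, ← Real.rpow_mul (by norm_num), show 1 + a = (a - 1) + (2 : ℕ) by push_cast; ring,
      Real.rpow_add (by norm_num), Real.rpow_natCast, mul_comm (a - 1) q,
      Real.rpow_mul (by norm_num)]
    rw [show (2 : ℝ) ^ q = 3 by
      rw [Real.rpow_def_of_pos (by norm_num), hq, mul_div_cancel₀ _ hl2.ne',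
        Real.exp_log (by norm_num)]]
    ring
  have hb := one_add_mul_self_le_rpow_one_add (s := y - 1) (by linarith) hq1
  rw [show 1 + (y - 1) = y by ring] at hb
  rw [h2, h3]
  nlinarith [mul_nonneg (sub_nonneg.2 hq2) (sub_nonneg.2 hy1)]

end

/-- The symmetric Toeplitz kernel `|d+1|^(1+a) - 2|d|^(1+a) + |d-1|^(1+a)`. -/
noncomputable def kerSeq (a : ℝ) (d : ℕ) : ℝ := if d = 0 then 2 else powDiff (1 + a) d

section

variable {a : ℝ} (ha : a ∈ Ioo (0 : ℝ) 1)
include ha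

lemma kerSeq_nonneg (k : ℕ) : 0 ≤ kerSeq a k := by
  unfold kerSeq
  split_ifs with h
  · norm_num
  · exact powDiff_nonneg ha (by exact_mod_cast Nat.one_le_iff_ne_zero.2 h)

lemma kerSeq_succ_le (k : ℕ) (hk : 1 ≤ k) : kerSeq a (k + 1) ≤ kerSeq a k := by
  rw [kerSeq, kerSeq, if_neg (by omega), if_neg (by omega)]
  have : (1 : ℝ) ≤ k := by exact_mod_cast hk
  refine antitoneOn_powDiff ha this ?_ ?_
  · push_cast
    simp only [mem_Ici]
    linarith
  · push_cast
    linarith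

lemma kerSeq_convex (k : ℕ) : 0 ≤ kerSeq a k - 2 * kerSeq a (k + 1) + kerSeq a (k + 2) := by
  rcases Nat.eq_zero_or_pos k with rfl | hk
  · have h := three_rpow_two_rpow ha
    have h0 : (0 : ℝ) ^ (1 + a) = 0 := Real.zero_rpow (by linarith [ha.1])
    simp only [kerSeq, powDiff]
    norm_num [h0]
    linarith
  · rw [kerSeq, kerSeq, kerSeq, if_neg (by omega), if_neg (by omega), if_neg (by omega)]
    have hk1 : (1 : ℝ) ≤ k := by exact_mod_cast hk
    have := midpoint_of_convexOn (convexOn_powDiff ha) (x := (k : ℝ) + 1)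
      (by simp only [mem_Ici]; linarith) (by simp only [mem_Ici]; linarith)
    rw [add_sub_cancel_right, add_assoc] at this
    norm_num at this
    push_cast
    linarith

end

/-! ### The quadrature weights -/

lemma sum_Icc_one {M : Type*} [AddCommMonoid M] (f : ℕ → M) (k : ℕ) :
    ∑ j ∈ Finset.Icc 1 k, f j = ∑ j ∈ Finset.range k, f (j + 1) := by
  rw [Finset.range_eq_Ico, Finset.sum_Ico_add' f 0 k 1, zero_add]
  rfl

lemma integral_abel {a u v t : ℝ} (ha : 0 < a) :
    ∫ s in u..v, abel a (t - s) = ((t - u) ^ a - (t - v) ^ a) / Real.Gamma (a + 1) := by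
  unfold abel
  rw [intervalIntegral.integral_div, intervalIntegral.integral_comp_sub_left (fun x => x ^ (a - 1)),
    integral_rpow (Or.inl (by linarith)), Real.Gamma_add_one ha.ne', sub_add_cancel, div_div]

lemma integral_sub_rpow {a u v c : ℝ} (ha : 0 < a) :
    ∫ t in u..v, (t - c) ^ a = ((v - c) ^ (1 + a) - (u - c) ^ (1 + a)) / (1 + a) := by
  rw [intervalIntegral.integral_comp_sub_right (fun x => x ^ a),
    integral_rpow (Or.inl (by linarith)), add_comm a 1]

/-- Two integrations turn the Abel kernel into t^(1+a)/Γ(a+2), and integrating over a product of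
cells takes its second difference. On the diagonal the region is only a triangle, whence half of
`kerSeq a 0`. -/
lemma lam_eq {a τ : ℝ} (ha : 0 < a) (hτ : 0 < τ) (n j : ℕ) (hj : j ≤ n) :
    lam a τ (n + 1) (j + 1)
      = τ ^ a / Real.Gamma (a + 2) * (if j = n then kerSeq a 0 / 2 else kerSeq a (n - j)) := by
  have hG : Real.Gamma (a + 2) = (1 + a) * Real.Gamma (a + 1) := by
    rw [show a + 2 = (a + 1) + 1 by ring, Real.Gamma_add_one (by linarith), add_comm a 1]
  have hG1 : 0 < Real.Gamma (a + 1) := Real.Gamma_pos_of_pos (by linarith)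
  have h1a : (0 : ℝ) < 1 + a := by linarith
  have hτa : τ ^ (1 + a) = τ * τ ^ a := by rw [Real.rpow_add hτ, Real.rpow_one]
  have hint : ∀ c : ℝ, IntervalIntegrable (fun t : ℝ => (t - c) ^ a) MeasureTheory.volume
      (((n + 1 : ℕ) : ℝ) * τ - τ) (((n + 1 : ℕ) : ℝ) * τ) := fun c =>
    ((Real.continuous_rpow_const ha.le).comp (continuous_id.sub continuous_const)).intervalIntegrable
      _ _
  unfold lam
  simp_rw [integral_abel ha]
  rcases hj.eq_or_lt with rfl | hlt
  · rw [if_pos rfl, kerSeq, if_pos rfl, intervalIntegral.integral_congr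
      (g := fun t => (t - j * τ) ^ a / Real.Gamma (a + 1))]
    · rw [intervalIntegral.integral_div, integral_sub_rpow ha]
      push_cast
      rw [show ((j : ℝ) + 1) * τ - j * τ = τ by ring,
        show ((j : ℝ) + 1 - 1) * τ - j * τ = 0 by ring, Real.zero_rpow h1a.ne', hτa, hG]
      field_simp
      ring
    · intro t ht
      rw [uIcc_of_le (by push_cast; nlinarith)] at ht
      simp only
      rw [min_eq_left ht.2, sub_self, Real.zero_rpow ha.ne', sub_zero]
      push_cast
      rw [add_sub_cancel_right]
  · rw [if_neg hlt.ne, kerSeq, if_neg (by omega), intervalIntegral.integral_congr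
      (g := fun t => ((t - j * τ) ^ a - (t - (j + 1) * τ) ^ a) / Real.Gamma (a + 1))]
    · rw [show (((n + 1 : ℕ) : ℝ) - 1) * τ = ((n + 1 : ℕ) : ℝ) * τ - τ by ring,
        intervalIntegral.integral_div, intervalIntegral.integral_sub (hint _) (hint _),
        integral_sub_rpow ha, integral_sub_rpow ha, Nat.cast_sub hj, powDiff]
      have hjn : (j : ℝ) + 1 ≤ n := by exact_mod_cast hlt
      push_cast
      rw [show ((n : ℝ) + 1) * τ - j * τ = (n - j + 1) * τ by ring,
        show ((n : ℝ) + 1) * τ - τ - j * τ = (n - j) * τ by ring,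
        show ((n : ℝ) + 1) * τ - (j + 1) * τ = (n - j) * τ by ring,
        show ((n : ℝ) + 1) * τ - τ - (j + 1) * τ = (n - j - 1) * τ by ring,
        Real.mul_rpow (by linarith) hτ.le, Real.mul_rpow (by linarith) hτ.le,
        Real.mul_rpow (by linarith) hτ.le, hτa, hG]
      field_simp
      ring
    · intro t ht
      rw [uIcc_of_le (by push_cast; nlinarith)] at ht
      have hjn : (j : ℝ) + 1 ≤ n := by exact_mod_cast hlt
      have h1 : (((j + 1 : ℕ) : ℝ)) * τ ≤ t := by
        refine le_trans ?_ ht.1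
        push_cast
        nlinarith
      simp only
      rw [min_eq_right h1]
      push_cast
      rw [add_sub_cancel_right]

lemma lam_nonneg {a τ : ℝ} (ha : a ∈ Ioo (0 : ℝ) 1) (hτ : 0 < τ) (n j : ℕ) (hj : 1 ≤ j)
    (hjn : j ≤ n) : 0 ≤ lam a τ n j := by
  obtain ⟨j, rfl⟩ := Nat.exists_eq_add_of_le' hj
  obtain ⟨n, rfl⟩ := Nat.exists_eq_add_of_le' (hj.trans hjn)
  rw [lam_eq ha.1 hτ n j (by omega)]
  have := Real.Gamma_pos_of_pos (by linarith [ha.1] : 0 < a + 2)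
  refine mul_nonneg (by positivity) ?_
  split_ifs
  · exact div_nonneg (kerSeq_nonneg ha _) (by norm_num)
  · exact kerSeq_nonneg ha _

/-- Row sums of the quadrature weights. -/
lemma sum_lam_le {a τ T : ℝ} (ha : a ∈ Ioo (0 : ℝ) 1) (hτ : 0 < τ) (n : ℕ) (hn : n * τ ≤ T) :
    ∑ j ∈ Finset.Icc 1 n, lam a τ n j ≤ T ^ a / Real.Gamma (a + 1) := by
  have hG : Real.Gamma (a + 2) = (1 + a) * Real.Gamma (a + 1) := by
    rw [show a + 2 = (a + 1) + 1 by ring, Real.Gamma_add_one (by linarith [ha.1]), add_comm a 1]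
  have hG1 : 0 < Real.Gamma (a + 1) := Real.Gamma_pos_of_pos (by linarith [ha.1])
  have h1a : (0 : ℝ) < 1 + a := by linarith [ha.1]
  rcases n with _ | n
  · simp only [Nat.cast_zero, zero_mul] at hn
    simpa using div_nonneg (Real.rpow_nonneg hn a) hG1.le
  -- A row sum of second differences telescopes to a first difference.
  have hsum : ∀ m : ℕ, ∑ d ∈ Finset.range (m + 1), (if d = 0 then kerSeq a 0 / 2 else kerSeq a d)
      = ((m : ℝ) + 1) ^ (1 + a) - (m : ℝ) ^ (1 + a) := by
    intro m
    induction m with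
    | zero => simp [kerSeq, Real.zero_rpow h1a.ne']
    | succ m ih =>
      rw [Finset.sum_range_succ, ih, if_neg (by omega), kerSeq, if_neg (by omega), powDiff]
      push_cast
      rw [add_sub_cancel_right]
      ring
  have h1 : ∑ j ∈ Finset.Icc 1 (n + 1), lam a τ (n + 1) j
      = τ ^ a / Real.Gamma (a + 2) * (((n : ℝ) + 1) ^ (1 + a) - (n : ℝ) ^ (1 + a)) := by
    rw [← hsum, ← Finset.sum_range_reflect, Finset.mul_sum, sum_Icc_one]
    refine Finset.sum_congr rfl fun j hj => ?_
    rw [Finset.mem_range] at hj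
    rw [lam_eq ha.1 hτ n j (by omega)]
    congr 1
    rw [show n + 1 - 1 - j = n - j by omega]
    by_cases h : j = n
    · simp [h]
    · rw [if_neg h, if_neg (by omega)]
  -- Bernoulli's inequality at -1/(n+1) bounds this first difference.
  have h2 : ((n : ℝ) + 1) ^ (1 + a) - (n : ℝ) ^ (1 + a) ≤ (1 + a) * ((n : ℝ) + 1) ^ a := by
    have hn1 : (0 : ℝ) < (n : ℝ) + 1 := by positivity
    have hb := one_add_mul_self_le_rpow_one_add (s := -(1 / ((n : ℝ) + 1))) (p := 1 + a)
      (by rw [neg_le_neg_iff, div_le_one hn1]; linarith [n.cast_nonneg (α := ℝ)])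
      (by linarith [ha.1])
    rw [show 1 + -(1 / ((n : ℝ) + 1)) = n / (n + 1) by field_simp; ring,
      Real.div_rpow (by positivity) hn1.le, le_div_iff₀ (by positivity)] at hb
    have h3 : ((n : ℝ) + 1) ^ (1 + a) = (n + 1) * (n + 1) ^ a := by
      rw [Real.rpow_add hn1, Real.rpow_one]
    rw [h3] at hb ⊢
    have h4 : (1 + (1 + a) * -(1 / ((n : ℝ) + 1))) * ((n + 1) * (n + 1) ^ a)
        = (n + 1) * (n + 1) ^ a - (1 + a) * (n + 1) ^ a := by
      field_simp
      ring
    linarith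
  rw [h1, hG]
  push_cast at hn
  calc τ ^ a / ((1 + a) * Real.Gamma (a + 1)) * (((n : ℝ) + 1) ^ (1 + a) - (n : ℝ) ^ (1 + a))
      ≤ τ ^ a / ((1 + a) * Real.Gamma (a + 1)) * ((1 + a) * ((n : ℝ) + 1) ^ a) := by gcongr
    _ = (((n : ℝ) + 1) * τ) ^ a / Real.Gamma (a + 1) := by
      rw [Real.mul_rpow (by positivity) hτ.le]
      field_simp
    _ ≤ T ^ a / Real.Gamma (a + 1) := by
      gcongr
      exact ha.1.le

/-- The averaged product integration rule is positive: the quadratic form of the quadrature weights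
is nonnegative. -/
lemma lam_form_nonneg {V : Type*} [AddCommGroup V] [Module ℝ V] {a τ : ℝ}
    (ha : a ∈ Ioo (0 : ℝ) 1) (hτ : 0 < τ) (B : V →ₗ[ℝ] V →ₗ[ℝ] ℝ)
    (hs : ∀ x y, B x y = B y x) (hp : ∀ x, 0 ≤ B x x) (x : ℕ → V) (m : ℕ) :
    0 ≤ ∑ n ∈ Finset.Icc 1 m, ∑ j ∈ Finset.Icc 1 n, lam a τ n j * B (x j) (x n) := by
  rw [sum_Icc_one]
  have h := toeplitz_half_nonneg B hs hp (kerSeq a) (kerSeq_nonneg ha) (kerSeq_succ_le ha)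
    (kerSeq_convex ha) (fun n => x (n + 1)) m
  have hG := Real.Gamma_pos_of_pos (by linarith [ha.1] : 0 < a + 2)
  have h2 := mul_nonneg (by positivity : 0 ≤ τ ^ a / Real.Gamma (a + 2)) h
  refine h2.trans_eq ?_
  rw [Finset.mul_sum]
  refine Finset.sum_congr rfl fun n hn => ?_
  rw [sum_Icc_one, Finset.mul_sum]
  refine Finset.sum_congr rfl fun j hj => ?_
  rw [Finset.mem_range] at hj
  rw [lam_eq ha.1 hτ n j (by omega)]
  ring

/-! ### Variation of the memory weights -/

/-- An antiderivative of an upper bound of `|log t| + 1`. -/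
noncomputable def logPrim (t : ℝ) : ℝ := t ^ 2 / 2 + 4 * Real.sqrt t + t

lemma hasDerivAt_logPrim {t : ℝ} (ht : 0 < t) :
    HasDerivAt logPrim (t + 2 / Real.sqrt t + 1) t := by
  have h1 := (hasDerivAt_pow 2 t).div_const 2
  have h2 := (Real.hasDerivAt_sqrt ht.ne').const_mul 4
  have h3 := (h1.add h2).add (hasDerivAt_id t)
  refine h3.congr_deriv ?_
  have : Real.sqrt t ≠ 0 := (Real.sqrt_pos.2 ht).ne'
  field_simp
  ring

/-- Apply log x ≤ x - 1 at t for large t and at 1/√t for small t. The square root keeps the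
primitive finite at 0. -/
lemma abs_log_le_logPrim_deriv {t : ℝ} (ht : 0 < t) :
    |Real.log t| + 1 ≤ t + 2 / Real.sqrt t + 1 := by
  have hs := Real.sqrt_pos.2 ht
  have h2 : 0 < 2 / Real.sqrt t := by positivity
  have h3 := Real.log_le_sub_one_of_pos (inv_pos.2 hs)
  have h4 : Real.log t = 2 * Real.log (Real.sqrt t) := by
    rw [Real.log_sqrt ht.le]
    ring
  rw [Real.log_inv] at h3
  have h5 : 2 / Real.sqrt t = 2 * (Real.sqrt t)⁻¹ := by ring
  refine add_le_add_left (abs_le.2 ⟨?_, ?_⟩) 1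
  · linarith
  · linarith [Real.log_le_sub_one_of_pos ht]

lemma monotoneOn_logPrim : MonotoneOn logPrim (Ici 0) := by
  intro x hx y hy hxy
  have hx' : (0 : ℝ) ≤ x := hx
  unfold logPrim
  have := Real.sqrt_le_sqrt hxy
  nlinarith

lemma logPrim_nonneg {t : ℝ} (ht : 0 ≤ t) : 0 ≤ logPrim t := by
  unfold logPrim
  positivity

section

variable {α : ℝ → ℝ} {T Qg : ℝ}

/-- No integrability of g'' is needed: both Qg · `logPrim` - g' and Qg · `logPrim` + g' have a
nonnegative derivative. -/
lemma IsGenIdBound.abs_deriv_sub_le (h : IsGenIdBound α T Qg) {x y : ℝ}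
    (hx : 0 < x) (hxy : x ≤ y) (hy : y ≤ T) :
    |derivWithin (genId α) (Icc 0 T) y - derivWithin (genId α) (Icc 0 T) x|
      ≤ Qg * (logPrim y - logPrim x) := by
  set d := derivWithin (genId α) (Icc 0 T) with hd
  have hder : ∀ t ∈ Icc x y, HasDerivWithinAt d (derivWithin d (Icc 0 T) t) (Icc x y) t :=
    fun t ht => (h.diff_deriv t ⟨hx.trans_le ht.1, ht.2.trans hy⟩).hasDerivWithinAt.mono
      (Icc_subset_Icc hx.le hy)
  have hprim : ∀ t ∈ Icc x y, HasDerivWithinAt (fun t => Qg * logPrim t)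
      (Qg * (t + 2 / Real.sqrt t + 1)) (Icc x y) t := fun t ht =>
    ((hasDerivAt_logPrim (hx.trans_le ht.1)).const_mul Qg).hasDerivWithinAt
  have hQ : 0 ≤ Qg := le_trans (abs_nonneg _) (h.bound x ⟨hx.le, hxy.trans hy⟩)
  have hle : ∀ t ∈ Icc x y, |derivWithin d (Icc 0 T) t| ≤ Qg * (t + 2 / Real.sqrt t + 1) :=
    fun t ht => (h.bound_deriv_two t ⟨hx.trans_le ht.1, ht.2.trans hy⟩).trans
      (mul_le_mul_of_nonneg_left (abs_log_le_logPrim_deriv (hx.trans_le ht.1)) hQ)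
  have hm1 : MonotoneOn (fun t => Qg * logPrim t - d t) (Icc x y) := by
    refine monotoneOn_of_hasDerivWithinAt_nonneg (convex_Icc x y)
      (fun t ht => ((hprim t ht).sub (hder t ht)).continuousWithinAt)
      (fun t ht => ((hprim t (interior_subset ht)).sub (hder t (interior_subset ht))).mono
        interior_subset) fun t ht => ?_
    linarith [(abs_le.1 (hle t (interior_subset ht))).2]
  have hm2 : MonotoneOn (fun t => Qg * logPrim t + d t) (Icc x y) := by
    refine monotoneOn_of_hasDerivWithinAt_nonneg (convex_Icc x y)
      (fun t ht => ((hprim t ht).add (hder t ht)).continuousWithinAt)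
      (fun t ht => ((hprim t (interior_subset ht)).add (hder t (interior_subset ht))).mono
        interior_subset) fun t ht => ?_
    linarith [(abs_le.1 (hle t (interior_subset ht))).1]
  have h1 := hm1 (left_mem_Icc.2 hxy) (right_mem_Icc.2 hxy) hxy
  have h2 := hm2 (left_mem_Icc.2 hxy) (right_mem_Icc.2 hxy) hxy
  simp only at h1 h2
  rw [abs_le]
  constructor <;> linarith

variable {τ : ℝ} {N : ℕ}

lemma IsGenIdBound.exists_w_eq (h : IsGenIdBound α T Qg) (hτ : 0 < τ) (hN : N * τ = T) {k : ℕ}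
    (hk : k < N) : ∃ ξ ∈ Ioo ((k : ℝ) * τ) (((k : ℝ) + 1) * τ),
      w α τ k = τ * derivWithin (genId α) (Icc 0 T) ξ := by
  have hk1 : (k : ℝ) + 1 ≤ N := by exact_mod_cast hk
  have hT : ((k : ℝ) + 1) * τ ≤ T := hN ▸ mul_le_mul_of_nonneg_right hk1 hτ.le
  have h0 : 0 ≤ (k : ℝ) * τ := by positivity
  have hsub : Icc ((k : ℝ) * τ) (((k : ℝ) + 1) * τ) ⊆ Icc 0 T := Icc_subset_Icc h0 hT
  obtain ⟨ξ, hξ, he⟩ := exists_hasDerivAt_eq_slope (genId α) (derivWithin (genId α) (Icc 0 T))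
    (by nlinarith : (k : ℝ) * τ < ((k : ℝ) + 1) * τ) (h.diff.continuousOn.mono hsub)
    (fun x hx => (h.diff x (hsub (Ioo_subset_Icc_self hx))).hasDerivWithinAt.hasDerivAt
      (Icc_mem_nhds (h0.trans_lt hx.1) (hx.2.trans_le hT)))
  refine ⟨ξ, hξ, ?_⟩
  rw [he, w, show ((k : ℝ) + 1) * τ - k * τ = τ by ring]
  field_simp

lemma IsGenIdBound.abs_w_le (h : IsGenIdBound α T Qg) (hτ : 0 < τ) (hN : N * τ = T) {k : ℕ}
    (hk : k < N) : |w α τ k| ≤ Qg * τ := by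
  obtain ⟨ξ, hξ, he⟩ := h.exists_w_eq hτ hN hk
  have hk1 : (k : ℝ) + 1 ≤ N := by exact_mod_cast hk
  have hT : ((k : ℝ) + 1) * τ ≤ T := hN ▸ mul_le_mul_of_nonneg_right hk1 hτ.le
  have h0 : 0 ≤ (k : ℝ) * τ := by positivity
  rw [he, abs_mul, abs_of_pos hτ, mul_comm]
  exact mul_le_mul_of_nonneg_right (h.bound_deriv ξ ⟨h0.trans hξ.1.le, hξ.2.le.trans hT⟩) hτ.le

/-- Writing w_k = τ g'(ξ_k) with ordered intermediate points, the bounds for the increments of g'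
telescope, however close ξ_0 is to the logarithmic singularity. -/
lemma IsGenIdBound.sum_abs_w_sub_le (h : IsGenIdBound α T Qg) (hτ : 0 < τ) (hN : N * τ = T) {m : ℕ}
    (hm : m < N) : ∑ k ∈ Finset.range m, |w α τ (k + 1) - w α τ k| ≤ Qg * logPrim T * τ := by
  have hex : ∀ k : ℕ, ∃ ξ : ℝ, k < N → ξ ∈ Ioo ((k : ℝ) * τ) (((k : ℝ) + 1) * τ) ∧
      w α τ k = τ * derivWithin (genId α) (Icc 0 T) ξ := by
    intro k
    by_cases hk : k < N
    · obtain ⟨ξ, h1, h2⟩ := h.exists_w_eq hτ hN hk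
      exact ⟨ξ, fun _ => ⟨h1, h2⟩⟩
    · exact ⟨0, fun h => absurd h hk⟩
  choose ξ hξ using hex
  have hpos : ∀ k < N, 0 < ξ k ∧ ξ k ≤ T := by
    intro k hk
    have hk1 : (k : ℝ) + 1 ≤ N := by exact_mod_cast hk
    have hT : ((k : ℝ) + 1) * τ ≤ T := hN ▸ mul_le_mul_of_nonneg_right hk1 hτ.le
    have h0 : 0 ≤ (k : ℝ) * τ := by positivity
    exact ⟨h0.trans_lt (hξ k hk).1.1, (hξ k hk).1.2.le.trans hT⟩
  have hQ : 0 ≤ Qg := le_trans (abs_nonneg _)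
    (h.bound (ξ m) ⟨(hpos m hm).1.le, (hpos m hm).2⟩)
  have hT0 : 0 ≤ T := (hpos m hm).1.le.trans (hpos m hm).2
  calc ∑ k ∈ Finset.range m, |w α τ (k + 1) - w α τ k|
      ≤ ∑ k ∈ Finset.range m,
          (τ * (Qg * logPrim (ξ (k + 1))) - τ * (Qg * logPrim (ξ k))) := by
        refine Finset.sum_le_sum fun k hk => ?_
        rw [Finset.mem_range] at hk
        have hk1 : k < N := by omega
        have hk2 : k + 1 < N := by omega
        have hlt : ξ k ≤ ξ (k + 1) := by
          have h1 := (hξ k hk1).1.2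
          have h2 := (hξ (k + 1) hk2).1.1
          push_cast at h2
          linarith
        rw [(hξ k hk1).2, (hξ (k + 1) hk2).2, ← mul_sub, abs_mul, abs_of_pos hτ, ← mul_sub,
          ← mul_sub]
        exact mul_le_mul_of_nonneg_left
          (h.abs_deriv_sub_le (hpos k hk1).1 hlt (hpos (k + 1) hk2).2) hτ.le
    _ = τ * (Qg * logPrim (ξ m)) - τ * (Qg * logPrim (ξ 0)) :=
        Finset.sum_range_sub (fun k => τ * (Qg * logPrim (ξ k))) m
    _ ≤ τ * (Qg * logPrim T) := by
        have h1 := logPrim_nonneg (hpos 0 (by omega)).1.le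
        have h2 := monotoneOn_logPrim (mem_Ici.2 (hpos m hm).1.le) (mem_Ici.2 hT0) (hpos m hm).2
        have h3 : 0 ≤ τ * (Qg * logPrim (ξ 0)) := by positivity
        have h4 : τ * (Qg * logPrim (ξ m)) ≤ τ * (Qg * logPrim T) := by gcongr
        linarith
    _ = Qg * logPrim T * τ := by ring

lemma IsGenIdBound.variation_wTilde_le (h : IsGenIdBound α T Qg) (hτ : 0 < τ) (hN : N * τ = T)
    {n : ℕ} (hn : n < N) :
    |wTilde α τ 0| + |wTilde α τ n|
      + ∑ k ∈ Finset.range n, |wTilde α τ (k + 1) - wTilde α τ k|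
      ≤ Qg * (2 + logPrim T) * τ := by
  have hT0 : 0 ≤ T := hN ▸ by positivity
  have hQτ : 0 ≤ Qg * τ := (abs_nonneg _).trans (h.abs_w_le hτ hN hn)
  have hw0 : |wTilde α τ 0| ≤ Qg * τ / 2 := by
    rw [wTilde, if_pos rfl, abs_div, abs_two]
    linarith [h.abs_w_le hτ hN (by omega : 0 < N)]
  have hwn : |wTilde α τ n| ≤ Qg * τ := by
    rcases n with _ | n
    · linarith
    · rw [wTilde, if_neg (by omega), abs_div, abs_two, Nat.add_sub_cancel]
      have := abs_add_le (w α τ (n + 1)) (w α τ n)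
      linarith [h.abs_w_le hτ hN hn, h.abs_w_le hτ hN (by omega : n < N)]
  have hsum : ∑ k ∈ Finset.range n, |wTilde α τ (k + 1) - wTilde α τ k|
      ≤ Qg * τ / 2 + Qg * logPrim T * τ := by
    -- As w̃_0 is half of w_0 rather than an average, the first increment leaves an extra w_0/2. In
    -- the constant 2 of the result, 1/2 comes from w̃_0, 1 from w̃_n and 1/2 from this term.
    have hterm : ∀ k, wTilde α τ (k + 1) - wTilde α τ k = (w α τ (k + 1) - w α τ k) / 2
        + (if k = 0 then w α τ 0 / 2 else (w α τ k - w α τ (k - 1)) / 2) := by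
      intro k
      rcases k with _ | k
      · simp only [wTilde]
        norm_num
        ring
      · simp only [wTilde, Nat.add_sub_cancel]
        rw [if_neg (by omega), if_neg (by omega), if_neg (by omega)]
        ring
    have hs1 := h.sum_abs_w_sub_le hτ hN hn
    have hs2 : ∑ k ∈ Finset.range n,
        |if k = 0 then w α τ 0 / 2 else (w α τ k - w α τ (k - 1)) / 2|
        ≤ Qg * τ / 2 + Qg * logPrim T * τ / 2 := by
      have hp : 0 ≤ Qg * logPrim T * τ := le_trans (Finset.sum_nonneg fun _ _ => abs_nonneg _) hs1
      rcases n with _ | n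
      · simp only [Finset.range_zero, Finset.sum_empty]
        linarith
      · rw [Finset.sum_range_succ', if_pos rfl, abs_div, abs_two]
        have h0 := h.abs_w_le hτ hN (by omega : 0 < N)
        have h1 : ∑ k ∈ Finset.range n,
            |if k + 1 = 0 then w α τ 0 / 2 else (w α τ (k + 1) - w α τ (k + 1 - 1)) / 2|
            = (∑ k ∈ Finset.range n, |w α τ (k + 1) - w α τ k|) / 2 := by
          rw [Finset.sum_div]
          refine Finset.sum_congr rfl fun k _ => ?_
          rw [if_neg (by omega), abs_div, abs_two, Nat.add_sub_cancel]
        rw [h1]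
        linarith [h.sum_abs_w_sub_le hτ hN (by omega : n < N)]
    calc ∑ k ∈ Finset.range n, |wTilde α τ (k + 1) - wTilde α τ k|
        ≤ ∑ k ∈ Finset.range n, (|w α τ (k + 1) - w α τ k| / 2
          + |if k = 0 then w α τ 0 / 2 else (w α τ k - w α τ (k - 1)) / 2|) := by
          refine Finset.sum_le_sum fun k _ => ?_
          rw [hterm]
          refine (abs_add_le _ _).trans ?_
          rw [abs_div, abs_two]
      _ ≤ _ := by
          rw [Finset.sum_add_distrib, ← Finset.sum_div]
          linarith
  calc _ ≤ Qg * τ / 2 + Qg * τ + (Qg * τ / 2 + Qg * logPrim T * τ) := by gcongr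
    _ = _ := by ring

end

/-- Summation by parts for a convolution. -/
lemma sum_mul_sub_eq (W u : ℕ → ℝ) (n : ℕ) :
    ∑ i ∈ Finset.range (n + 1), W i * (u i - u (i + 1))
      = W 0 * u 0 - W n * u (n + 1) + ∑ i ∈ Finset.range n, (W (i + 1) - W i) * u (i + 1) := by
  induction n with
  | zero => simp; ring
  | succ n ih =>
    rw [Finset.sum_range_succ, ih, Finset.sum_range_succ]
    ring

lemma abs_sum_mul_sub_le (W u : ℕ → ℝ) (n : ℕ) {x : ℝ} (hu : ∀ i ≤ n + 1, |u i| ≤ x) :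
    |∑ i ∈ Finset.range (n + 1), W i * (u i - u (i + 1))|
      ≤ (|W 0| + |W n| + ∑ i ∈ Finset.range n, |W (i + 1) - W i|) * x := by
  rw [sum_mul_sub_eq]
  have h1 : |∑ i ∈ Finset.range n, (W (i + 1) - W i) * u (i + 1)|
      ≤ (∑ i ∈ Finset.range n, |W (i + 1) - W i|) * x := by
    refine (Finset.abs_sum_le_sum_abs _ _).trans ?_
    rw [Finset.sum_mul]
    refine Finset.sum_le_sum fun i hi => ?_
    rw [Finset.mem_range] at hi
    rw [abs_mul]
    exact mul_le_mul_of_nonneg_left (hu _ (by omega)) (abs_nonneg _)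
  have h2 : |W 0 * u 0| ≤ |W 0| * x := by
    rw [abs_mul]
    exact mul_le_mul_of_nonneg_left (hu _ (by omega)) (abs_nonneg _)
  have h3 : |W n * u (n + 1)| ≤ |W n| * x := by
    rw [abs_mul]
    exact mul_le_mul_of_nonneg_left (hu _ (by omega)) (abs_nonneg _)
  refine (abs_add_le _ _).trans ?_
  refine (add_le_add_left (abs_sub _ _) _).trans ?_
  linarith

/-! ### The discrete energy method -/

/-- A discrete Gronwall inequality. -/
lemma discrete_gronwall {x : ℕ → ℝ} {K y : ℝ} {N : ℕ} (hK : 0 ≤ K) (hy : 0 ≤ y) (hy2 : y ≤ 1 / 2)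
    (hx : ∀ n ≤ N, 0 ≤ x n) (h : ∀ m ≤ N, x m ≤ K + y * ∑ n ∈ Finset.Icc 1 m, x n) (m : ℕ)
    (hm : m ≤ N) : x m ≤ K * Real.exp (2 * y * m) := by
  -- The induction runs on the majorant S_m, which satisfies (1 - y) S_{m+1} ≤ S_m. For y ≤ 1/2,
  -- dividing by 1 - y costs at most the factor 1 + 2y ≤ exp(2y).
  have key : ∀ m ≤ N, K + y * ∑ n ∈ Finset.Icc 1 m, x n ≤ K * Real.exp (2 * y * m) := by
    intro m
    induction m with
    | zero => simp
    | succ m ih =>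
      intro hm
      have h1 := ih (by omega)
      have h2 := h (m + 1) hm
      set S := K + y * ∑ n ∈ Finset.Icc 1 (m + 1), x n with hS
      have hsum : S = (K + y * ∑ n ∈ Finset.Icc 1 m, x n) + y * x (m + 1) := by
        rw [hS, sum_Icc_one, sum_Icc_one, Finset.sum_range_succ]
        ring
      have hS0 : 0 ≤ S := (hx _ hm).trans h2
      have h3 : (1 - y) * S ≤ K * Real.exp (2 * y * m) := by
        nlinarith [mul_le_mul_of_nonneg_left h2 hy]
      have h4 : S ≤ (1 + 2 * y) * ((1 - y) * S) := by
        have : 0 ≤ y * (1 - 2 * y) * S := by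
          refine mul_nonneg (mul_nonneg hy (by linarith)) hS0
        nlinarith
      have h5 : 1 + 2 * y ≤ Real.exp (2 * y) := by linarith [Real.add_one_le_exp (2 * y)]
      calc S ≤ (1 + 2 * y) * ((1 - y) * S) := h4
        _ ≤ (1 + 2 * y) * (K * Real.exp (2 * y * m)) := by gcongr
        _ ≤ Real.exp (2 * y) * (K * Real.exp (2 * y * m)) := by gcongr
        _ = K * Real.exp (2 * y * (m + 1 : ℕ)) := by
          rw [show 2 * y * ((m + 1 : ℕ) : ℝ) = 2 * y + 2 * y * m by push_cast; ring, Real.exp_add]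
          ring
  exact (h m hm).trans (key m hm)

/-- The running maximum of a sequence. -/
def runMax (q : ℕ → ℝ) : ℕ → ℝ
  | 0 => q 0
  | n + 1 => max (runMax q n) (q (n + 1))

lemma le_runMax (q : ℕ → ℝ) {k n : ℕ} (h : k ≤ n) : q k ≤ runMax q n := by
  induction n with
  | zero =>
    rw [Nat.le_zero.1 h]
    exact le_rfl
  | succ n ih =>
    rcases h.lt_or_eq with h | rfl
    · exact (ih (by omega)).trans (le_max_left _ _)
    · exact le_max_right _ _

lemma runMax_le {q : ℕ → ℝ} {n : ℕ} {c : ℝ} (h : ∀ k ≤ n, q k ≤ c) : runMax q n ≤ c := by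
  induction n with
  | zero => exact h 0 le_rfl
  | succ n ih => exact max_le (ih fun k hk => h k (by omega)) (h _ le_rfl)

section

variable {V : Type*} [AddCommGroup V] [Module ℝ V]

/-- The intermediate values `ψ₁ = U₁` and `ψₙ = (Uₙ + Uₙ₋₁) / 2`. -/
noncomputable def halfStep (U : ℕ → V) (n : ℕ) : V :=
  if n = 1 then U 1 else (1 / 2 : ℝ) • (U n + U (n - 1))

lemma abs_form_le (A : V →ₗ[ℝ] V →ₗ[ℝ] ℝ) (hs : ∀ x y, A x y = A y x) (hp : ∀ x, 0 ≤ A x x)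
    (x y : V) : |A x y| ≤ (A x x + A y y) / 2 := by
  have h1 := hp (x - y)
  have h2 := hp (x + y)
  simp only [map_sub, map_add, LinearMap.sub_apply, LinearMap.add_apply] at h1 h2
  rw [hs y x] at h1 h2
  rw [abs_le]
  constructor <;> linarith

lemma form_halfStep_le (A : V →ₗ[ℝ] V →ₗ[ℝ] ℝ) (hs : ∀ x y, A x y = A y x) (hp : ∀ x, 0 ≤ A x x)
    (U : ℕ → V) {n : ℕ} {x : ℝ} (hx : ∀ k ≤ n, A (U k) (U k) ≤ x) (hn : 1 ≤ n) :
    A (halfStep U n) (halfStep U n) ≤ x := by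
  unfold halfStep
  split_ifs with h
  · exact hx 1 hn
  · simp only [map_smul, map_add, LinearMap.smul_apply, LinearMap.add_apply, smul_eq_mul]
    have h1 := (abs_le.1 (abs_form_le A hs hp (U n) (U (n - 1)))).2
    rw [hs (U (n - 1)) (U n)]
    linarith [hx n le_rfl, hx (n - 1) (by omega)]

/-- For n ≥ 2 this is an equality by polarization. For n = 1 the test function is U₁ itself, and the
mixed term is estimated by `abs_form_le`. -/
lemma energy_step (A : V →ₗ[ℝ] V →ₗ[ℝ] ℝ) (hs : ∀ x y, A x y = A y x) (hp : ∀ x, 0 ≤ A x x)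
    (U : ℕ → V) {n : ℕ} (hn : 1 ≤ n) :
    (A (U n) (U n) - A (U (n - 1)) (U (n - 1))) / 2
      ≤ A (U n) (halfStep U n) - A (U (n - 1)) (halfStep U n) := by
  unfold halfStep
  split_ifs with h
  · subst h
    have h1 := (abs_le.1 (abs_form_le A hs hp (U 0) (U 1))).2
    simp only [Nat.sub_self]
    linarith
  · simp only [map_smul, map_add, smul_eq_mul]
    rw [hs (U (n - 1)) (U n)]
    linarith

/-- The energy does not control time differences of U, so the difference is moved onto the weights W
by summation by parts. -/
lemma abs_memory_le (A : V →ₗ[ℝ] V →ₗ[ℝ] ℝ) (hs : ∀ x y, A x y = A y x) (hp : ∀ x, 0 ≤ A x x)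
    (U : ℕ → V) (W : ℕ → ℝ) {n : ℕ} {x c : ℝ} (hx : ∀ k ≤ n, A (U k) (U k) ≤ x) (hn : 1 ≤ n)
    (hW : |W 0| + |W (n - 1)| + ∑ k ∈ Finset.range (n - 1), |W (k + 1) - W k| ≤ c) :
    |∑ k ∈ Finset.Icc 1 n, W (n - k) * (A (U k) (halfStep U n) - A (U (k - 1)) (halfStep U n))|
      ≤ c * x := by
  have hψ := form_halfStep_le A hs hp U hx hn
  obtain ⟨m, rfl⟩ := Nat.exists_eq_add_of_le' hn
  rw [Nat.add_sub_cancel] at hW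
  have h1 : ∑ k ∈ Finset.Icc 1 (m + 1), W (m + 1 - k) *
        (A (U k) (halfStep U (m + 1)) - A (U (k - 1)) (halfStep U (m + 1)))
      = ∑ i ∈ Finset.range (m + 1), W i * (A (U (m + 1 - i)) (halfStep U (m + 1))
        - A (U (m + 1 - (i + 1))) (halfStep U (m + 1))) := by
    rw [sum_Icc_one, ← Finset.sum_range_reflect]
    refine Finset.sum_congr rfl fun i hi => ?_
    rw [Finset.mem_range] at hi
    rw [show m + 1 - (m + 1 - 1 - i + 1) = i by omega,
      show m + 1 - 1 - i + 1 = m + 1 - i by omega, show m + 1 - i - 1 = m + 1 - (i + 1) by omega]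
  rw [h1]
  refine (abs_sum_mul_sub_le W (fun i => A (U (m + 1 - i)) (halfStep U (m + 1))) m
    (x := x) fun i _ => ?_).trans ?_
  · refine (abs_form_le A hs hp _ _).trans ?_
    linarith [hx (m + 1 - i) (by omega)]
  · exact mul_le_mul_of_nonneg_right hW ((hp _).trans hψ)

/-- Stability of an abstract Volterra scheme, by the energy method. -/
theorem energy_estimate {T a τ Cw C D : ℝ} {N : ℕ} (ha : a ∈ Ioo (0 : ℝ) 1) (hτ : 0 < τ)
    (hN : N * τ = T) (A B : V →ₗ[ℝ] V →ₗ[ℝ] ℝ)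
    (hAs : ∀ x y, A x y = A y x) (hAp : ∀ x, 0 ≤ A x x)
    (hBs : ∀ x y, B x y = B y x) (hBp : ∀ x, 0 ≤ B x x) (U : ℕ → V) (W : ℕ → ℝ)
    (hCw : 0 ≤ Cw) (hC : 0 ≤ C) (hD : 0 ≤ D) (hsmall : 2 * (Cw + C) * τ ≤ 1 / 2)
    (hW : ∀ n < N, |W 0| + |W n| + ∑ k ∈ Finset.range n, |W (k + 1) - W k| ≤ Cw * τ)
    (hU : ∀ n, 1 ≤ n → n ≤ N →
      A (U n) (halfStep U n) - A (U (n - 1)) (halfStep U n)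
        + ∑ k ∈ Finset.Icc 1 n,
          W (n - k) * (A (U k) (halfStep U n) - A (U (k - 1)) (halfStep U n))
        + τ * ∑ j ∈ Finset.Icc 1 n, lam a τ n j * B (halfStep U j) (halfStep U n)
      ≤ τ * (C * (runMax (fun k => A (U k) (U k)) n + D))) (n : ℕ) (hn : n ≤ N) :
    A (U n) (U n) ≤ (A (U 0) (U 0) + 2 * C * T * D) * Real.exp (4 * (Cw + C) * T) := by
  set q : ℕ → ℝ := fun k => A (U k) (U k) with hq
  have hq0 : ∀ k, 0 ≤ q k := fun k => hAp _
  have hx0 : ∀ n, 0 ≤ runMax q n := fun n => (hq0 n).trans (le_runMax q le_rfl)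
  have hT : 0 ≤ T := hN ▸ by positivity
  have hstep : ∀ n, 1 ≤ n → n ≤ N →
      q n - q (n - 1)
        + 2 * τ * ∑ j ∈ Finset.Icc 1 n, lam a τ n j * B (halfStep U j) (halfStep U n)
      ≤ 2 * τ * C * D + 2 * (Cw + C) * τ * runMax q n := by
    intro n h1 hn
    have e1 := energy_step A hAs hAp U h1
    have e2 := (abs_le.1 (abs_memory_le A hAs hAp U W (x := runMax q n) (c := Cw * τ)
      (fun k hk => le_runMax q hk) h1 (hW (n - 1) (by omega)))).1
    have e3 := hU n h1 hn
    simp only [hq] at e1 e2 e3 ⊢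
    linarith
  have hsum : ∀ m ≤ N, q m - q 0
        + 2 * τ * ∑ n ∈ Finset.Icc 1 m,
          ∑ j ∈ Finset.Icc 1 n, lam a τ n j * B (halfStep U j) (halfStep U n)
      ≤ 2 * τ * C * D * m + 2 * (Cw + C) * τ * ∑ n ∈ Finset.Icc 1 m, runMax q n := by
    intro m
    induction m with
    | zero => simp
    | succ m ih =>
      intro hm
      have h1 := ih (by omega)
      have h2 := hstep (m + 1) (by omega) hm
      rw [Finset.sum_Icc_succ_top (by omega), Finset.sum_Icc_succ_top (by omega) (runMax q)]
      rw [Nat.add_sub_cancel] at h2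
      push_cast
      linarith
  -- The energy at level k is estimated by summing only up to k, where the diffusion form is
  -- nonnegative. The result is then enlarged to the sum up to m, uniformly in k ≤ m, which bounds
  -- the running maximum.
  have hbound : ∀ m ≤ N, runMax q m
      ≤ (q 0 + 2 * C * T * D) + 2 * (Cw + C) * τ * ∑ n ∈ Finset.Icc 1 m, runMax q n := by
    intro m hm
    refine runMax_le fun k hk => ?_
    have h1 := hsum k (by omega)
    have h2 := lam_form_nonneg ha hτ B hBs hBp (halfStep U) k
    have h3 : ∑ n ∈ Finset.Icc 1 k, runMax q n ≤ ∑ n ∈ Finset.Icc 1 m, runMax q n :=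
      Finset.sum_le_sum_of_subset_of_nonneg (Finset.Icc_subset_Icc_right hk) fun i _ _ => hx0 i
    have h4 : 2 * τ * C * D * k ≤ 2 * C * T * D := by
      have : (k : ℝ) * τ ≤ T := by
        rw [← hN]
        exact mul_le_mul_of_nonneg_right (by exact_mod_cast hk.trans hm) hτ.le
      calc 2 * τ * C * D * k = 2 * C * D * (k * τ) := by ring
        _ ≤ 2 * C * D * T := by gcongr
        _ = _ := by ring
    have h5 : 2 * (Cw + C) * τ * ∑ n ∈ Finset.Icc 1 k, runMax q n
        ≤ 2 * (Cw + C) * τ * ∑ n ∈ Finset.Icc 1 m, runMax q n := by gcongr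
    have h6 : 0 ≤ 2 * τ * ∑ n ∈ Finset.Icc 1 k,
        ∑ j ∈ Finset.Icc 1 n, lam a τ n j * B (halfStep U j) (halfStep U n) := by positivity
    linarith
  have hK : 0 ≤ q 0 + 2 * C * T * D := add_nonneg (hq0 0) (by positivity)
  have hg := discrete_gronwall hK (by positivity) hsmall (fun n _ => hx0 n) hbound n hn
  refine (le_runMax q le_rfl).trans (hg.trans ?_)
  refine mul_le_mul_of_nonneg_left (Real.exp_le_exp.2 ?_) hK
  have : (n : ℝ) * τ ≤ T := by
    rw [← hN]
    exact mul_le_mul_of_nonneg_right (by exact_mod_cast hn) hτ.le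
  calc 2 * (2 * (Cw + C) * τ) * n = 4 * (Cw + C) * (n * τ) := by ring
    _ ≤ _ := by gcongr

end

/-! ### Summation by parts on a line -/

section Line

/-- The stencil (1, 10, 1)/12 is 2/3 of the identity plus 1/12 of SᵀS, where S adds neighbouring
values. Only w has to vanish at the end points. -/
lemma sum_avg_mul (m : ℕ) (v w : ℕ → ℝ) (h0 : w 0 = 0) (h1 : w (m + 1) = 0) :
    ∑ i ∈ Finset.range m, (v i + 10 * v (i + 1) + v (i + 2)) / 12 * w (i + 1)
      = 2 / 3 * ∑ i ∈ Finset.range m, v (i + 1) * w (i + 1)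
        + 1 / 12 * ∑ i ∈ Finset.range (m + 1), (v i + v (i + 1)) * (w i + w (i + 1)) := by
  simp only [mul_add, Finset.sum_add_distrib]
  rw [Finset.sum_range_succ' (fun i => (v i + v (i + 1)) * w i),
    Finset.sum_range_succ (fun i => (v i + v (i + 1)) * w (i + 1)), h0, h1]
  simp only [mul_zero, add_zero, Finset.mul_sum, ← Finset.sum_add_distrib]
  refine Finset.sum_congr rfl fun i _ => ?_
  ring

lemma sum_diff_mul (m : ℕ) (v w : ℕ → ℝ) (h0 : w 0 = 0) (h1 : w (m + 1) = 0) :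
    ∑ i ∈ Finset.range m, (v (i + 2) - 2 * v (i + 1) + v i) * w (i + 1)
      = -∑ i ∈ Finset.range (m + 1), (v (i + 1) - v i) * (w (i + 1) - w i) := by
  simp only [mul_sub, Finset.sum_sub_distrib]
  rw [Finset.sum_range_succ' (fun i => (v (i + 1) - v i) * w i),
    Finset.sum_range_succ (fun i => (v (i + 1) - v i) * w (i + 1)), h0, h1]
  simp only [mul_zero, add_zero, ← Finset.sum_sub_distrib, ← Finset.sum_neg_distrib]
  refine Finset.sum_congr rfl fun i _ => ?_
  ring

/-- The rank one form `(v, w) ↦ f v * f w`. -/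
def sqForm {V : Type*} [AddCommGroup V] [Module ℝ V] (f : V →ₗ[ℝ] ℝ) : V →ₗ[ℝ] V →ₗ[ℝ] ℝ :=
  LinearMap.BilinForm.linMulLin f f

/-- Evaluation at an index. -/
def evalLine (i : ℕ) : (ℕ → ℝ) →ₗ[ℝ] ℝ := LinearMap.proj i

/-- The quadratic form of the averaging operator with stencil `(1, 10, 1) / 12` on a line with `M`
cells, for functions that vanish at the end points. -/
noncomputable def lineForm (M : ℕ) : (ℕ → ℝ) →ₗ[ℝ] (ℕ → ℝ) →ₗ[ℝ] ℝ :=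
  (2 / 3 : ℝ) • ∑ i ∈ Finset.range (M - 1), sqForm (evalLine (i + 1))
    + (1 / 12 : ℝ) • ∑ i ∈ Finset.range M, sqForm (evalLine i + evalLine (i + 1))

lemma lineForm_apply (M : ℕ) (v w : ℕ → ℝ) :
    lineForm M v w = 2 / 3 * ∑ i ∈ Finset.range (M - 1), v (i + 1) * w (i + 1)
        + 1 / 12 * ∑ i ∈ Finset.range M, (v i + v (i + 1)) * (w i + w (i + 1)) := by
  simp [lineForm, sqForm, evalLine, LinearMap.sum_apply]

lemma lineForm_comm (M : ℕ) (v w : ℕ → ℝ) : lineForm M v w = lineForm M w v := by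
  rw [lineForm_apply, lineForm_apply]
  simp only [mul_comm]

lemma le_lineForm (M : ℕ) (v : ℕ → ℝ) :
    2 / 3 * ∑ i ∈ Finset.range (M - 1), v (i + 1) ^ 2 ≤ lineForm M v v := by
  rw [lineForm_apply]
  simp only [← pow_two]
  exact le_add_of_nonneg_right (by positivity)

lemma lineForm_nonneg (M : ℕ) (v : ℕ → ℝ) : 0 ≤ lineForm M v v :=
  le_trans (by positivity) (le_lineForm M v)

lemma sum_add_sq_le (M : ℕ) (v : ℕ → ℝ) (h0 : v 0 = 0) (h1 : v M = 0) :
    ∑ i ∈ Finset.range M, (v i + v (i + 1)) ^ 2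
      ≤ 4 * ∑ i ∈ Finset.range (M - 1), v (i + 1) ^ 2 := by
  rcases M with _ | m
  · simp
  · calc ∑ i ∈ Finset.range (m + 1), (v i + v (i + 1)) ^ 2
        ≤ ∑ i ∈ Finset.range (m + 1), (2 * v i ^ 2 + 2 * v (i + 1) ^ 2) :=
          Finset.sum_le_sum fun i _ => by nlinarith [sq_nonneg (v i - v (i + 1))]
      _ = _ := by
          rw [Finset.sum_add_distrib, Finset.sum_range_succ' (fun i => 2 * v i ^ 2),
            Finset.sum_range_succ (fun i => 2 * v (i + 1) ^ 2), h0, h1, Nat.add_sub_cancel,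
            ← Finset.mul_sum]
          ring

/-- The constant is 2/3 + 4/12 = 1. -/
lemma lineForm_le (M : ℕ) (v : ℕ → ℝ) (h0 : v 0 = 0) (h1 : v M = 0) :
    lineForm M v v ≤ ∑ i ∈ Finset.range (M - 1), v (i + 1) ^ 2 := by
  rw [lineForm_apply]
  simp only [← pow_two]
  linarith [sum_add_sq_le M v h0 h1]

lemma sum_avg_eq_lineForm (M : ℕ) (hM : 1 ≤ M) (v w : ℕ → ℝ) (h0 : w 0 = 0) (h1 : w M = 0) :
    ∑ i ∈ Finset.range (M - 1), (v i + 10 * v (i + 1) + v (i + 2)) / 12 * w (i + 1)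
      = lineForm M v w := by
  obtain ⟨m, rfl⟩ := Nat.exists_eq_add_of_le' hM
  rw [lineForm_apply, Nat.add_sub_cancel, sum_avg_mul m v w h0 h1]

end Line

/-! ### Quadratic forms on a grid -/

namespace Grid

variable (G : Grid)

/-- Grid functions that vanish on the boundary. -/
def ZeroBdry (u : GridFn) : Prop := ∀ i j, G.Boundary i j → u i j = 0

variable {G}

lemma ZeroBdry.left {u : GridFn} (h : G.ZeroBdry u) {j : ℕ} (hj : j ≤ G.My) : u 0 j = 0 :=
  h 0 j ⟨⟨Nat.zero_le _, hj⟩, fun hi => by have := hi.1.1; omega⟩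

lemma ZeroBdry.right {u : GridFn} (h : G.ZeroBdry u) {j : ℕ} (hj : j ≤ G.My) : u G.Mx j = 0 :=
  h G.Mx j ⟨⟨le_rfl, hj⟩, fun hi => by have := hi.1.2; omega⟩

lemma ZeroBdry.bot {u : GridFn} (h : G.ZeroBdry u) {i : ℕ} (hi : i ≤ G.Mx) : u i 0 = 0 :=
  h i 0 ⟨⟨hi, Nat.zero_le _⟩, fun hi => by have := hi.2.1; omega⟩

lemma ZeroBdry.top {u : GridFn} (h : G.ZeroBdry u) {i : ℕ} (hi : i ≤ G.Mx) : u i G.My = 0 :=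
  h i G.My ⟨⟨hi, le_rfl⟩, fun hi => by have := hi.2.2; omega⟩

lemma ZeroBdry.halfStep {U : ℕ → GridFn} {n : ℕ} (h : ∀ k ≤ n, G.ZeroBdry (U k)) (hn : 1 ≤ n) :
    G.ZeroBdry (halfStep U n) := by
  intro i j hij
  unfold STG.halfStep
  split_ifs with h1
  · exact h 1 hn i j hij
  · simp [h n le_rfl i j hij, h (n - 1) (by omega) i j hij]

variable (G)

/-- Restriction to a row of a grid. -/
def row (i : ℕ) : GridFn →ₗ[ℝ] (ℕ → ℝ) := LinearMap.proj i

/-- Restriction to a column of a grid. -/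
def col (j : ℕ) : GridFn →ₗ[ℝ] (ℕ → ℝ) := LinearMap.pi fun i => (LinearMap.proj j).comp (row i)

/-- The quadratic form of `𝓐`. -/
noncomputable def massForm : GridFn →ₗ[ℝ] GridFn →ₗ[ℝ] ℝ :=
  (G.dx * G.dy) • ((2 / 3 : ℝ) • ∑ i ∈ Finset.range (G.Mx - 1),
      (lineForm G.My).compl₁₂ (row (i + 1)) (row (i + 1))
    + (1 / 12 : ℝ) • ∑ i ∈ Finset.range G.Mx,
      (lineForm G.My).compl₁₂ (row i + row (i + 1)) (row i + row (i + 1)))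

/-- The quadratic form of `-Λ`. -/
noncomputable def stiffForm : GridFn →ₗ[ℝ] GridFn →ₗ[ℝ] ℝ :=
  (G.dx * G.dy) • ((1 / G.dx ^ 2) • ∑ i ∈ Finset.range G.Mx,
      (lineForm G.My).compl₁₂ (row (i + 1) - row i) (row (i + 1) - row i)
    + (1 / G.dy ^ 2) • ∑ j ∈ Finset.range G.My,
      (lineForm G.Mx).compl₁₂ (col (j + 1) - col j) (col (j + 1) - col j))

lemma massForm_apply (v w : GridFn) : G.massForm v w = G.dx * G.dy *
    (2 / 3 * ∑ i ∈ Finset.range (G.Mx - 1), lineForm G.My (v (i + 1)) (w (i + 1))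
      + 1 / 12 * ∑ i ∈ Finset.range G.Mx, lineForm G.My (v i + v (i + 1)) (w i + w (i + 1))) := by
  simp only [massForm, LinearMap.smul_apply, LinearMap.add_apply, LinearMap.sum_apply,
    LinearMap.compl₁₂_apply, smul_eq_mul]
  rfl

lemma stiffForm_apply (v w : GridFn) : G.stiffForm v w = G.dx * G.dy *
    (1 / G.dx ^ 2 * ∑ i ∈ Finset.range G.Mx, lineForm G.My (v (i + 1) - v i) (w (i + 1) - w i)
      + 1 / G.dy ^ 2 * ∑ j ∈ Finset.range G.My, lineForm G.Mx
        ((fun i => v i (j + 1)) - fun i => v i j) ((fun i => w i (j + 1)) - fun i => w i j)) := by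
  simp only [stiffForm, LinearMap.smul_apply, LinearMap.add_apply, LinearMap.sum_apply,
    LinearMap.compl₁₂_apply, smul_eq_mul]
  rfl

lemma massForm_comm (v w : GridFn) : G.massForm v w = G.massForm w v := by
  rw [massForm_apply, massForm_apply]
  simp only [lineForm_comm _ (v _) (w _), lineForm_comm _ (v _ + v _)]

lemma stiffForm_comm (v w : GridFn) : G.stiffForm v w = G.stiffForm w v := by
  rw [stiffForm_apply, stiffForm_apply]
  simp only [lineForm_comm _ (v _ - v _), lineForm_comm _ ((fun i => v i _) - fun i => v i _)]

variable {G}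

lemma stiffForm_nonneg (h : 0 ≤ G.dx * G.dy) (v : GridFn) : 0 ≤ G.stiffForm v v := by
  rw [stiffForm_apply]
  have h1 := Finset.sum_nonneg fun i (_ : i ∈ Finset.range G.Mx) =>
    lineForm_nonneg G.My (v (i + 1) - v i)
  have h2 := Finset.sum_nonneg fun j (_ : j ∈ Finset.range G.My) =>
    lineForm_nonneg G.Mx ((fun i => v i (j + 1)) - fun i => v i j)
  positivity

variable (G)

lemma inner_eq (u v : GridFn) : G.inner u v = G.dx * G.dy * ∑ i ∈ Finset.range (G.Mx - 1),
    ∑ j ∈ Finset.range (G.My - 1), u (i + 1) (j + 1) * v (i + 1) (j + 1) := by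
  unfold inner
  simp only [sum_Icc_one]

variable {G}

/-- Each direction contributes a factor 2/3. -/
lemma le_massForm (h : 0 ≤ G.dx * G.dy) (v : GridFn) : 4 / 9 * G.inner v v ≤ G.massForm v v := by
  rw [massForm_apply, inner_eq]
  have h1 : ∑ i ∈ Finset.range (G.Mx - 1), ∑ j ∈ Finset.range (G.My - 1),
      v (i + 1) (j + 1) * v (i + 1) (j + 1)
      ≤ 3 / 2 * ∑ i ∈ Finset.range (G.Mx - 1), lineForm G.My (v (i + 1)) (v (i + 1)) := by
    rw [Finset.mul_sum]
    refine Finset.sum_le_sum fun i _ => ?_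
    have := le_lineForm G.My (v (i + 1))
    simp only [← pow_two]
    linarith
  have h2 := Finset.sum_nonneg fun i (_ : i ∈ Finset.range G.Mx) =>
    lineForm_nonneg G.My (v i + v (i + 1))
  rw [mul_left_comm]
  refine mul_le_mul_of_nonneg_left ?_ h
  linarith

lemma inner_self_nonneg (h : 0 ≤ G.dx * G.dy) (v : GridFn) : 0 ≤ G.inner v v :=
  mul_nonneg h (Finset.sum_nonneg fun _ _ => Finset.sum_nonneg fun _ _ => mul_self_nonneg _)

lemma massForm_nonneg (h : 0 ≤ G.dx * G.dy) (v : GridFn) : 0 ≤ G.massForm v v :=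
  le_trans (by have := inner_self_nonneg h v; positivity) (le_massForm h v)

lemma massForm_le (h : 0 ≤ G.dx * G.dy) {v : GridFn} (hv : G.ZeroBdry v) :
    G.massForm v v ≤ G.inner v v := by
  rw [massForm_apply, inner_eq]
  refine mul_le_mul_of_nonneg_left ?_ h
  simp only [← pow_two]
  have h1 : ∑ i ∈ Finset.range (G.Mx - 1), lineForm G.My (v (i + 1)) (v (i + 1))
      ≤ ∑ i ∈ Finset.range (G.Mx - 1), ∑ j ∈ Finset.range (G.My - 1), v (i + 1) (j + 1) ^ 2 := by
    refine Finset.sum_le_sum fun i hi => ?_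
    rw [Finset.mem_range] at hi
    exact lineForm_le _ _ (hv.bot (by omega)) (hv.top (by omega))
  have h2 : ∑ i ∈ Finset.range G.Mx, lineForm G.My (v i + v (i + 1)) (v i + v (i + 1))
      ≤ 4 * ∑ i ∈ Finset.range (G.Mx - 1), ∑ j ∈ Finset.range (G.My - 1),
        v (i + 1) (j + 1) ^ 2 := by
    calc _ ≤ ∑ i ∈ Finset.range G.Mx, ∑ j ∈ Finset.range (G.My - 1),
          (v i (j + 1) + v (i + 1) (j + 1)) ^ 2 := by
          refine Finset.sum_le_sum fun i hi => ?_
          rw [Finset.mem_range] at hi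
          refine lineForm_le _ _ ?_ ?_
          · simp [hv.bot (by omega : i ≤ G.Mx), hv.bot (by omega : i + 1 ≤ G.Mx)]
          · simp [hv.top (by omega : i ≤ G.Mx), hv.top (by omega : i + 1 ≤ G.Mx)]
      _ ≤ _ := by
          rw [Finset.sum_comm, Finset.sum_comm (s := Finset.range (G.Mx - 1)), Finset.mul_sum]
          refine Finset.sum_le_sum fun j hj => ?_
          rw [Finset.mem_range] at hj
          exact sum_add_sq_le G.Mx (fun i => v i (j + 1)) (hv.left (by omega))
            (hv.right (by omega))
  linarith

variable (G)

lemma avgX_interior (u : GridFn) {i : ℕ} (hi : i < G.Mx - 1) (j : ℕ) :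
    G.avgX u (i + 1) j = (u i j + 10 * u (i + 1) j + u (i + 2) j) / 12 := by
  rw [avgX, if_pos ⟨by omega, by omega⟩]
  rfl

lemma avgY_interior (u : GridFn) (i : ℕ) {j : ℕ} (hj : j < G.My - 1) :
    G.avgY u i (j + 1) = (u i j + 10 * u i (j + 1) + u i (j + 2)) / 12 := by
  rw [avgY, if_pos ⟨by omega, by omega⟩]
  rfl

variable {G}

/-- Summation by parts in x comes first, then in y on single rows and on sums of adjacent rows. -/
lemma inner_avg (hx : 1 ≤ G.Mx) (hy : 1 ≤ G.My) (v : GridFn) {w : GridFn} (hw : G.ZeroBdry w) :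
    G.inner (G.avg v) w = G.massForm v w := by
  rw [inner_eq, massForm_apply]
  congr 1
  rw [Finset.sum_comm]
  have h1 : ∀ j ∈ Finset.range (G.My - 1),
      ∑ i ∈ Finset.range (G.Mx - 1), G.avg v (i + 1) (j + 1) * w (i + 1) (j + 1)
      = 2 / 3 * ∑ i ∈ Finset.range (G.Mx - 1), G.avgY v (i + 1) (j + 1) * w (i + 1) (j + 1)
        + 1 / 12 * ∑ i ∈ Finset.range G.Mx, (G.avgY v i (j + 1) + G.avgY v (i + 1) (j + 1))
          * (w i (j + 1) + w (i + 1) (j + 1)) := by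
    intro j hj
    rw [Finset.mem_range] at hj
    rw [← lineForm_apply G.Mx (fun i => G.avgY v i (j + 1)) (fun i => w i (j + 1)),
      ← sum_avg_eq_lineForm G.Mx hx _ (fun i => w i (j + 1)) (hw.left (by omega)) (hw.right (by omega))]
    refine Finset.sum_congr rfl fun i hi => ?_
    rw [avg, avgX_interior G _ (Finset.mem_range.1 hi)]
  rw [Finset.sum_congr rfl h1, Finset.sum_add_distrib, ← Finset.mul_sum, ← Finset.mul_sum,
    Finset.sum_comm, Finset.sum_comm (t := Finset.range G.Mx)]
  congr 2
  · refine Finset.sum_congr rfl fun i hi => ?_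
    rw [Finset.mem_range] at hi
    rw [← sum_avg_eq_lineForm G.My hy _ _ (hw.bot (by omega)) (hw.top (by omega))]
    refine Finset.sum_congr rfl fun j hj => ?_
    rw [avgY_interior G _ _ (Finset.mem_range.1 hj)]
  · refine Finset.sum_congr rfl fun i hi => ?_
    rw [Finset.mem_range] at hi
    rw [← sum_avg_eq_lineForm G.My hy]
    · refine Finset.sum_congr rfl fun j hj => ?_
      rw [avgY_interior G _ _ (Finset.mem_range.1 hj), avgY_interior G _ _ (Finset.mem_range.1 hj)]
      simp only [Pi.add_apply]
      ring
    · simp [hw.bot (by omega : i ≤ G.Mx), hw.bot (by omega : i + 1 ≤ G.Mx)]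
    · simp [hw.top (by omega : i ≤ G.Mx), hw.top (by omega : i + 1 ≤ G.Mx)]

/-- In each half of Λ the difference is summed by parts in one direction, and the averaging in the
other direction is then applied to the differences. -/
lemma inner_lap (hx : 1 ≤ G.Mx) (hy : 1 ≤ G.My) (v : GridFn) {w : GridFn} (hw : G.ZeroBdry w) :
    G.inner (G.lap v) w = -G.stiffForm v w := by
  rw [inner_eq, stiffForm_apply, ← mul_neg]
  congr 1
  simp only [lap, add_mul, Finset.sum_add_distrib, neg_add]
  congr 1
  · have h1 : ∀ j ∈ Finset.range (G.My - 1),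
        ∑ i ∈ Finset.range (G.Mx - 1), G.avgY (G.diffX v) (i + 1) (j + 1) * w (i + 1) (j + 1)
        = -(1 / G.dx ^ 2 * ∑ i ∈ Finset.range G.Mx, (G.avgY v (i + 1) (j + 1) - G.avgY v i (j + 1))
          * (w (i + 1) (j + 1) - w i (j + 1))) := by
      intro j hj
      rw [Finset.mem_range] at hj
      obtain ⟨m, hm⟩ := Nat.exists_eq_add_of_le' hx
      have hr := hw.right (j := j + 1) (by omega)
      rw [hm] at hr ⊢
      rw [← mul_neg, ← sum_diff_mul m (fun i => G.avgY v i (j + 1)) (fun i => w i (j + 1))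
        (hw.left (by omega)) hr, Finset.mul_sum, Nat.add_sub_cancel]
      refine Finset.sum_congr rfl fun i hi => ?_
      rw [avgY_interior G _ _ hj, avgY_interior G _ _ hj, avgY_interior G _ _ hj,
        avgY_interior G _ _ hj]
      simp only [diffX, Nat.add_sub_cancel]
      ring
    rw [Finset.sum_comm, Finset.sum_congr rfl h1, Finset.sum_neg_distrib, ← Finset.mul_sum,
      Finset.sum_comm]
    congr 2
    refine Finset.sum_congr rfl fun i hi => ?_
    rw [Finset.mem_range] at hi
    rw [← sum_avg_eq_lineForm G.My hy]
    · refine Finset.sum_congr rfl fun j hj => ?_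
      rw [avgY_interior G _ _ (Finset.mem_range.1 hj), avgY_interior G _ _ (Finset.mem_range.1 hj)]
      simp only [Pi.sub_apply]
      ring
    · simp [hw.bot (by omega : i ≤ G.Mx), hw.bot (by omega : i + 1 ≤ G.Mx)]
    · simp [hw.top (by omega : i ≤ G.Mx), hw.top (by omega : i + 1 ≤ G.Mx)]
  · have h1 : ∀ i ∈ Finset.range (G.Mx - 1),
        ∑ j ∈ Finset.range (G.My - 1), G.avgX (G.diffY v) (i + 1) (j + 1) * w (i + 1) (j + 1)
        = -(1 / G.dy ^ 2 * ∑ j ∈ Finset.range G.My, (G.avgX v (i + 1) (j + 1) - G.avgX v (i + 1) j)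
          * (w (i + 1) (j + 1) - w (i + 1) j)) := by
      intro i hi
      rw [Finset.mem_range] at hi
      obtain ⟨m, hm⟩ := Nat.exists_eq_add_of_le' hy
      have hr := hw.top (i := i + 1) (by omega)
      rw [hm] at hr ⊢
      rw [← mul_neg, ← sum_diff_mul m (G.avgX v (i + 1)) (w (i + 1))
        (hw.bot (by omega)) hr, Finset.mul_sum, Nat.add_sub_cancel]
      refine Finset.sum_congr rfl fun j hj => ?_
      rw [avgX_interior G _ hi, avgX_interior G _ hi, avgX_interior G _ hi, avgX_interior G _ hi]
      simp only [diffY, Nat.add_sub_cancel]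
      ring
    rw [Finset.sum_congr rfl h1, Finset.sum_neg_distrib, ← Finset.mul_sum, Finset.sum_comm]
    congr 2
    refine Finset.sum_congr rfl fun j hj => ?_
    rw [Finset.mem_range] at hj
    rw [← sum_avg_eq_lineForm G.Mx hx]
    · refine Finset.sum_congr rfl fun i hi => ?_
      rw [avgX_interior G _ (Finset.mem_range.1 hi), avgX_interior G _ (Finset.mem_range.1 hi)]
      simp only [Pi.sub_apply]
      ring
    · simp [hw.left (by omega : j ≤ G.My), hw.left (by omega : j + 1 ≤ G.My)]
    · simp [hw.right (by omega : j ≤ G.My), hw.right (by omega : j + 1 ≤ G.My)]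

end Grid

namespace Grid

/-! ### Norms including the boundary, and bounds for averaged sources -/

variable (G : Grid)

/-- The discrete `L²` norm over all grid points, squared. -/
noncomputable def closedSq (u : GridFn) : ℝ :=
  G.dx * G.dy * ∑ i ∈ Finset.range (G.Mx + 1), ∑ j ∈ Finset.range (G.My + 1), u i j ^ 2

variable {G}

lemma dx_pos (h : G.lx < G.rx) (hM : 1 ≤ G.Mx) : 0 < G.dx :=
  div_pos (sub_pos.2 h) (by exact_mod_cast hM)

lemma dy_pos (h : G.ly < G.ry) (hM : 1 ≤ G.My) : 0 < G.dy :=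
  div_pos (sub_pos.2 h) (by exact_mod_cast hM)

lemma sum_stencil_le (m : ℕ) (p : ℕ → ℝ) (hp : ∀ i, 0 ≤ p i) :
    ∑ i ∈ Finset.range m, (p i + 10 * p (i + 1) + p (i + 2)) / 12
      ≤ ∑ i ∈ Finset.range (m + 2), p i := by
  have h0 : ∑ i ∈ Finset.range m, p i ≤ ∑ i ∈ Finset.range (m + 2), p i :=
    Finset.sum_le_sum_of_subset_of_nonneg (Finset.range_mono (by omega)) fun i _ _ => hp i
  have h1 : ∑ i ∈ Finset.range m, p (i + 1) ≤ ∑ i ∈ Finset.range (m + 2), p i := by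
    rw [Finset.sum_range_succ, Finset.sum_range_succ']
    linarith [hp 0, hp (m + 1)]
  have h2 : ∑ i ∈ Finset.range m, p (i + 2) ≤ ∑ i ∈ Finset.range (m + 2), p i := by
    rw [Finset.sum_range_succ', Finset.sum_range_succ']
    linarith [hp 0, hp (0 + 1)]
  rw [← Finset.sum_div, Finset.sum_add_distrib, Finset.sum_add_distrib, ← Finset.mul_sum]
  linarith

lemma stencil_sq_le (a b c : ℝ) :
    ((a + 10 * b + c) / 12) ^ 2 ≤ (a ^ 2 + 10 * b ^ 2 + c ^ 2) / 12 := by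
  nlinarith [sq_nonneg (a - b), sq_nonneg (b - c), sq_nonneg (a - c)]

/-- The stencil weights form a convex combination, so Jensen's inequality applies and every node is
counted with total weight at most 1. Boundary nodes enter, whence the closed norm on the right. -/
lemma inner_avg_self_le (h : 0 ≤ G.dx * G.dy) (hx : 1 ≤ G.Mx) (hy : 1 ≤ G.My) (F : GridFn) :
    G.inner (G.avg F) (G.avg F) ≤ G.closedSq F := by
  rw [inner_eq, closedSq]
  refine mul_le_mul_of_nonneg_left ?_ h
  have e1 : G.Mx + 1 = G.Mx - 1 + 2 := by omega
  have e2 : G.My + 1 = G.My - 1 + 2 := by omega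
  calc ∑ i ∈ Finset.range (G.Mx - 1), ∑ j ∈ Finset.range (G.My - 1),
        G.avg F (i + 1) (j + 1) * G.avg F (i + 1) (j + 1)
      ≤ ∑ j ∈ Finset.range (G.My - 1), ∑ i ∈ Finset.range (G.Mx - 1),
        (G.avgY F i (j + 1) ^ 2 + 10 * G.avgY F (i + 1) (j + 1) ^ 2
          + G.avgY F (i + 2) (j + 1) ^ 2) / 12 := by
        rw [Finset.sum_comm]
        refine Finset.sum_le_sum fun j _ => Finset.sum_le_sum fun i hi => ?_
        rw [← pow_two, avg, avgX_interior G _ (Finset.mem_range.1 hi)]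
        exact stencil_sq_le _ _ _
    _ ≤ ∑ j ∈ Finset.range (G.My - 1), ∑ i ∈ Finset.range (G.Mx + 1),
        G.avgY F i (j + 1) ^ 2 := by
        refine Finset.sum_le_sum fun j _ => ?_
        rw [e1]
        exact sum_stencil_le _ (fun i => G.avgY F i (j + 1) ^ 2) fun _ => sq_nonneg _
    _ ≤ ∑ i ∈ Finset.range (G.Mx + 1), ∑ j ∈ Finset.range (G.My - 1),
        (F i j ^ 2 + 10 * F i (j + 1) ^ 2 + F i (j + 2) ^ 2) / 12 := by
        rw [Finset.sum_comm]
        refine Finset.sum_le_sum fun i _ => Finset.sum_le_sum fun j hj => ?_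
        rw [avgY_interior G _ _ (Finset.mem_range.1 hj)]
        exact stencil_sq_le _ _ _
    _ ≤ _ := by
        refine Finset.sum_le_sum fun i _ => ?_
        rw [e2]
        exact sum_stencil_le _ (fun j => F i j ^ 2) fun _ => sq_nonneg _

lemma sum_range_eq_of_ends {M : ℕ} (hM : 1 ≤ M) (p : ℕ → ℝ) (h0 : p 0 = 0) (h1 : p M = 0) :
    ∑ i ∈ Finset.range (M + 1), p i = ∑ i ∈ Finset.range (M - 1), p (i + 1) := by
  obtain ⟨m, rfl⟩ := Nat.exists_eq_add_of_le' hM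
  rw [Finset.sum_range_succ, Finset.sum_range_succ', h0, h1, Nat.add_sub_cancel]
  ring

lemma ZeroBdry.closedSq_eq {u : GridFn} (h : G.ZeroBdry u) (hx : 1 ≤ G.Mx) (hy : 1 ≤ G.My) :
    G.closedSq u = G.inner u u := by
  rw [inner_eq, closedSq, sum_range_eq_of_ends hx]
  · congr 1
    refine Finset.sum_congr rfl fun i hi => ?_
    rw [Finset.mem_range] at hi
    rw [sum_range_eq_of_ends hy]
    · simp only [pow_two]
    · simp [h.bot (by omega : i + 1 ≤ G.Mx)]
    · simp [h.top (by omega : i + 1 ≤ G.Mx)]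
  · refine Finset.sum_eq_zero fun j hj => ?_
    rw [Finset.mem_range] at hj
    simp [h.left (by omega : j ≤ G.My)]
  · refine Finset.sum_eq_zero fun j hj => ?_
    rw [Finset.mem_range] at hj
    simp [h.right (by omega : j ≤ G.My)]

lemma closedSq_mono (h : 0 ≤ G.dx * G.dy) {u v : GridFn} {c : ℝ}
    (huv : ∀ i j, i ≤ G.Mx → j ≤ G.My → u i j ^ 2 ≤ c * v i j ^ 2) :
    G.closedSq u ≤ c * G.closedSq v := by
  unfold closedSq
  rw [mul_left_comm]
  refine mul_le_mul_of_nonneg_left ?_ h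
  simp only [Finset.mul_sum]
  refine Finset.sum_le_sum fun i hi => Finset.sum_le_sum fun j hj => ?_
  rw [Finset.mem_range] at hi hj
  exact huv i j (by omega) (by omega)

lemma closedSq_nonneg (h : 0 ≤ G.dx * G.dy) (u : GridFn) : 0 ≤ G.closedSq u :=
  mul_nonneg h (Finset.sum_nonneg fun _ _ => Finset.sum_nonneg fun _ _ => sq_nonneg _)

/-- A constant is controlled by the interior values of `f ∘ u` and `u`. -/
lemma closedSq_const_le (h : 0 ≤ G.dx * G.dy) (hx : 2 ≤ G.Mx) (hy : 2 ≤ G.My) {f : ℝ → ℝ} {Qf : ℝ}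
    (hf : ∀ x, |f x - f 0| ≤ Qf * |x|) (u : GridFn) :
    G.closedSq (fun _ _ => f 0)
      -- The factor 18 is 2 from splitting f(0) = f(x) - (f(x) - f(0)) and 9 from comparing the
      -- number of all nodes with that of the interior ones.
      ≤ 18 * (G.inner (fun i j => f (u i j)) (fun i j => f (u i j)) + Qf ^ 2 * G.inner u u) := by
  have hpt : ∀ x, f 0 ^ 2 ≤ 2 * (f x * f x) + 2 * Qf ^ 2 * (x * x) := by
    intro x
    have h1 : (f x - f 0) ^ 2 ≤ Qf ^ 2 * (x * x) := by
      rw [← sq_abs, ← pow_two, ← sq_abs x, ← mul_pow]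
      exact pow_le_pow_left₀ (abs_nonneg _) (hf x) 2
    nlinarith [sq_nonneg (f x + (f x - f 0))]
  have hcx : ((G.Mx + 1 : ℕ) : ℝ) ≤ 3 * ((G.Mx - 1 : ℕ) : ℝ) := by
    exact_mod_cast (by omega : G.Mx + 1 ≤ 3 * (G.Mx - 1))
  have hcy : ((G.My + 1 : ℕ) : ℝ) ≤ 3 * ((G.My - 1 : ℕ) : ℝ) := by
    exact_mod_cast (by omega : G.My + 1 ≤ 3 * (G.My - 1))
  have hsum : ((G.Mx - 1 : ℕ) : ℝ) * (((G.My - 1 : ℕ) : ℝ) * f 0 ^ 2)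
      ≤ 2 * ∑ i ∈ Finset.range (G.Mx - 1), ∑ j ∈ Finset.range (G.My - 1),
          f (u (i + 1) (j + 1)) * f (u (i + 1) (j + 1))
        + 2 * Qf ^ 2 * ∑ i ∈ Finset.range (G.Mx - 1), ∑ j ∈ Finset.range (G.My - 1),
          u (i + 1) (j + 1) * u (i + 1) (j + 1) := by
    simp only [Finset.mul_sum, ← Finset.sum_add_distrib]
    calc ((G.Mx - 1 : ℕ) : ℝ) * (((G.My - 1 : ℕ) : ℝ) * f 0 ^ 2)
        = ∑ i ∈ Finset.range (G.Mx - 1), ∑ j ∈ Finset.range (G.My - 1), f 0 ^ 2 := by simp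
      _ ≤ _ := Finset.sum_le_sum fun i _ => Finset.sum_le_sum fun j _ => hpt _
  rw [inner_eq, inner_eq, closedSq]
  simp only [Finset.sum_const, Finset.card_range, nsmul_eq_mul]
  have h9 : ((G.Mx + 1 : ℕ) : ℝ) * (((G.My + 1 : ℕ) : ℝ) * f 0 ^ 2)
      ≤ 9 * (((G.Mx - 1 : ℕ) : ℝ) * (((G.My - 1 : ℕ) : ℝ) * f 0 ^ 2)) := by
    calc ((G.Mx + 1 : ℕ) : ℝ) * (((G.My + 1 : ℕ) : ℝ) * f 0 ^ 2)
        ≤ (3 * ((G.Mx - 1 : ℕ) : ℝ)) * ((3 * ((G.My - 1 : ℕ) : ℝ)) * f 0 ^ 2) := by gcongr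
      _ = _ := by ring
  calc _ ≤ G.dx * G.dy * (18 * (∑ i ∈ Finset.range (G.Mx - 1), ∑ j ∈ Finset.range (G.My - 1),
          f (u (i + 1) (j + 1)) * f (u (i + 1) (j + 1))
        + Qf ^ 2 * ∑ i ∈ Finset.range (G.Mx - 1), ∑ j ∈ Finset.range (G.My - 1),
          u (i + 1) (j + 1) * u (i + 1) (j + 1))) :=
        mul_le_mul_of_nonneg_left (by linarith) h
    _ = _ := by ring

lemma inner_self_eq_zero (h : ¬(2 ≤ G.Mx ∧ 2 ≤ G.My)) (u v : GridFn) : G.inner u v = 0 := by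
  rw [inner_eq]
  by_cases hx : 2 ≤ G.Mx
  · rw [show G.My - 1 = 0 by omega]
    simp
  · rw [show G.Mx - 1 = 0 by omega]
    simp

/-- Bound for an averaged source that grows linearly. -/
lemma inner_avg_source_le (h : 0 ≤ G.dx * G.dy) (hx : 1 ≤ G.Mx) (hy : 1 ≤ G.My) {f : ℝ → ℝ} {Qf : ℝ}
    (hf : ∀ x, |f x - f 0| ≤ Qf * |x|) (u : GridFn) {F U P : GridFn} (hU : G.ZeroBdry U)
    (hF : ∀ i j, i ≤ G.Mx → j ≤ G.My → |F i j| ≤ |f 0| + Qf * |U i j| + 2 * Qf * |P i j|) :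
    G.inner (G.avg F) (G.avg F)
      ≤ 54 * (G.inner (fun i j => f (u i j)) (fun i j => f (u i j)) + Qf ^ 2 * G.inner u u)
        + 3 * Qf ^ 2 * G.inner U U + 12 * Qf ^ 2 * G.closedSq P := by
  -- Without interior nodes every inner product on the grid is an empty sum. Otherwise f(0) is
  -- controlled from the interior, and (x+y+z)² ≤ 3(x²+y²+z²) gives 54 = 3·18, 3 and 12 = 3·4.
  by_cases h2 : 2 ≤ G.Mx ∧ 2 ≤ G.My
  · refine (inner_avg_self_le h hx hy F).trans ?_
    rw [← hU.closedSq_eq hx hy]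
    have h3 := closedSq_const_le h h2.1 h2.2 hf u
    suffices G.closedSq F ≤ 3 * G.closedSq (fun _ _ => f 0) + 3 * Qf ^ 2 * G.closedSq U
        + 12 * Qf ^ 2 * G.closedSq P by linarith
    simp only [closedSq]
    rw [mul_left_comm 3, mul_left_comm (3 * Qf ^ 2), mul_left_comm (12 * Qf ^ 2), ← mul_add,
      ← mul_add]
    refine mul_le_mul_of_nonneg_left ?_ h
    simp only [Finset.mul_sum, ← Finset.sum_add_distrib]
    refine Finset.sum_le_sum fun i hi => Finset.sum_le_sum fun j hj => ?_
    rw [Finset.mem_range] at hi hj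
    have h4 := pow_le_pow_left₀ (abs_nonneg _) (hF i j (by omega) (by omega)) 2
    rw [sq_abs] at h4
    refine h4.trans ?_
    rw [← sq_abs (f 0), ← sq_abs (U i j), ← sq_abs (P i j)]
    nlinarith [sq_nonneg (|f 0| - Qf * |U i j|), sq_nonneg (|f 0| - 2 * Qf * |P i j|),
      sq_nonneg (Qf * |U i j| - 2 * Qf * |P i j|)]
  · simp only [inner_self_eq_zero h2]
    have := closedSq_nonneg h P
    simp only [mul_zero, add_zero, zero_add]
    positivity

lemma inner_le_half (h : 0 ≤ G.dx * G.dy) (u v : GridFn) :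
    G.inner u v ≤ (G.inner u u + G.inner v v) / 2 := by
  simp only [inner_eq]
  rw [← mul_add, mul_div_assoc]
  refine mul_le_mul_of_nonneg_left ?_ h
  rw [le_div_iff₀ two_pos, Finset.sum_mul, ← Finset.sum_add_distrib]
  refine Finset.sum_le_sum fun i _ => ?_
  rw [Finset.sum_mul, ← Finset.sum_add_distrib]
  exact Finset.sum_le_sum fun j _ => by
    nlinarith [sq_nonneg (u (i + 1) (j + 1) - v (i + 1) (j + 1))]

lemma inner_congr {u u' v v' : GridFn} (hu : ∀ i j, G.Interior i j → u i j = u' i j)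
    (hv : ∀ i j, G.Interior i j → v i j = v' i j) : G.inner u v = G.inner u' v' := by
  unfold inner
  congr 1
  refine Finset.sum_congr rfl fun i hi => Finset.sum_congr rfl fun j hj => ?_
  rw [Finset.mem_Icc] at hi hj
  have : G.Interior i j := ⟨⟨hi.1, by omega⟩, hj.1, by omega⟩
  rw [hu i j this, hv i j this]

lemma inner_add_left (u v w : GridFn) : G.inner (u + v) w = G.inner u w + G.inner v w := by
  simp only [inner, Pi.add_apply, add_mul, Finset.sum_add_distrib, mul_add]

lemma inner_smul_left (c : ℝ) (u w : GridFn) : G.inner (c • u) w = c * G.inner u w := by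
  simp only [inner, Pi.smul_apply, smul_eq_mul, mul_assoc, ← Finset.mul_sum]
  ring

variable (G) in
/-- The discrete inner product against a fixed grid function. -/
noncomputable def innerWith (w : GridFn) : GridFn →ₗ[ℝ] ℝ where
  toFun u := G.inner u w
  map_add' u v := inner_add_left u v w
  map_smul' c u := inner_smul_left c u w

lemma innerWith_apply (w u : GridFn) : G.innerWith w u = G.inner u w := rfl

lemma pt_mem_frontier (hx : G.lx < G.rx) (hy : G.ly < G.ry) (hMx : 1 ≤ G.Mx) (hMy : 1 ≤ G.My)
    {i j : ℕ} (h : G.Boundary i j) : G.pt i j ∈ frontier G.domain := by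
  have hx0 : (0 : ℝ) < G.Mx := by exact_mod_cast hMx
  have hy0 : (0 : ℝ) < G.My := by exact_mod_cast hMy
  have hdx := dx_pos hx hMx
  have hdy := dy_pos hy hMy
  have hxM : G.lx + G.Mx * G.dx = G.rx := by
    unfold dx
    field_simp
    ring
  have hyM : G.ly + G.My * G.dy = G.ry := by
    unfold dy
    field_simp
    ring
  obtain ⟨⟨hi, hj⟩, hb⟩ := h
  have hxi : G.lx + i * G.dx ∈ Icc G.lx G.rx := by
    rw [← hxM]
    have : (i : ℝ) ≤ G.Mx := by exact_mod_cast hi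
    exact ⟨le_add_of_nonneg_right (by positivity), by gcongr⟩
  have hyj : G.ly + j * G.dy ∈ Icc G.ly G.ry := by
    rw [← hyM]
    have : (j : ℝ) ≤ G.My := by exact_mod_cast hj
    exact ⟨le_add_of_nonneg_right (by positivity), by gcongr⟩
  rw [domain, frontier_prod_eq, closure_Ioo hx.ne, closure_Ioo hy.ne, frontier_Ioo hx,
    frontier_Ioo hy]
  by_cases h1 : 1 ≤ i ∧ i + 1 ≤ G.Mx
  · left
    refine ⟨hxi, ?_⟩
    have h2 : j = 0 ∨ j = G.My := by
      by_contra hne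
      exact hb ⟨h1, by omega, by omega⟩
    rcases h2 with rfl | rfl
    · left
      simp [pt]
    · right
      simpa [pt] using hyM
  · right
    refine ⟨?_, hyj⟩
    have h2 : i = 0 ∨ i = G.Mx := by omega
    rcases h2 with rfl | rfl
    · left
      simp [pt]
    · right
      simpa [pt] using hxM

end Grid

/-! ### Stability of the scheme on a single grid. -/

/-- The common form of the nonlinear and of the linearized scheme: `F n` is the source at the
current time level. -/
structure IsSchemeSolution (G : Grid) (α f : ℝ → ℝ) (u0 v0 : ℝ × ℝ → ℝ) (τ : ℝ) (N : ℕ)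
    (F U : ℕ → GridFn) : Prop where
  first : ∀ i j, G.Interior i j →
    c0 α τ * G.avg (dt τ U 1) i j - lam (abar α) τ 1 1 * G.lap (U 1) i j
      = lam (abar α) τ 1 1 * G.avg (F 1) i j + G.avg (bTerm G α τ v0 1) i j
  step : ∀ n, 2 ≤ n → n ≤ N → ∀ i j, G.Interior i j →
    c0 α τ * G.avg (dt τ U n) i j
        + ∑ k ∈ Finset.Icc 1 (n - 1), wTilde α τ (n - k) * G.avg (dt τ U k) i j
        - prodInt (abar α) τ n (fun m => G.lap (U m) i j)
      = lam (abar α) τ n n / 2 * G.avg (F n) i j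
        + ∑ k ∈ Finset.Icc 1 (n - 1),
            lamTilde (abar α) τ n k * G.avg (fun p q => f (U k p q)) i j
        + G.avg (bTerm G α τ v0 n) i j
  init : ∀ i j, G.Interior i j → U 0 i j = u0 (G.pt i j)
  bdry : ∀ n ≤ N, G.ZeroBdry (U n)

/-- The weight of the source at time level `k` in step `n`. -/
noncomputable def srcWeight (a τ : ℝ) (n k : ℕ) : ℝ :=
  if n = 1 then lam a τ 1 1 else if k = n then lam a τ n n / 2 else lamTilde a τ n k

/-- The source at time level `k` in step `n`. -/
def srcFn (f : ℝ → ℝ) (F U : ℕ → GridFn) (n k : ℕ) : GridFn :=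
  if k = n then F n else fun p q => f (U k p q)

/-- The quadrature rule acts on exactly the values that serve as test functions, so the tested
diffusion term is a quadratic form in them. -/
lemma prodInt_eq_sum_halfStep (a τ : ℝ) {n : ℕ} (hn : 1 ≤ n) (φ : ℕ → ℝ) :
    prodInt a τ n φ = ∑ j ∈ Finset.Icc 1 n, lam a τ n j * halfStep φ j := by
  rw [← Finset.add_sum_Ioc_eq_sum_Icc hn, prodInt, halfStep, if_pos rfl]
  congr 1
  refine Finset.sum_congr rfl fun j hj => ?_
  have : 2 ≤ j := (Finset.mem_Icc.1 hj).1
  rw [halfStep, if_neg (by omega), smul_eq_mul]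
  ring

lemma lap_halfStep (G : Grid) (U : ℕ → GridFn) (n i j : ℕ) :
    G.lap (halfStep U n) i j = halfStep (fun m => G.lap (U m) i j) n := by
  unfold halfStep
  split_ifs with h
  · rfl
  · simp only [Grid.lap, Grid.avgX, Grid.avgY, Grid.diffX, Grid.diffY, Pi.smul_apply, Pi.add_apply,
      smul_eq_mul]
    split_ifs <;> ring

lemma IsSchemeSolution.equation {G : Grid} {α f : ℝ → ℝ} {u0 v0 : ℝ × ℝ → ℝ} {τ : ℝ} {N : ℕ}
    {F U : ℕ → GridFn} (h : IsSchemeSolution G α f u0 v0 τ N F U) {n : ℕ} (h1 : 1 ≤ n) (hn : n ≤ N)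
    {i j : ℕ} (hij : G.Interior i j) :
    G.avg (dt τ U n) i j
        + ∑ k ∈ Finset.Icc 1 n, wTilde α τ (n - k) * G.avg (dt τ U k) i j
        - ∑ k ∈ Finset.Icc 1 n, lam (abar α) τ n k * G.lap (halfStep U k) i j
      = ∑ k ∈ Finset.Icc 1 n, srcWeight (abar α) τ n k * G.avg (srcFn f F U n k) i j
        + G.avg (bTerm G α τ v0 n) i j := by
  simp only [lap_halfStep]
  rw [← prodInt_eq_sum_halfStep _ _ h1]
  -- This identity absorbs the factor of the current difference into the memory sum, which then runs
  -- up to k = n.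
  have hc : c0 α τ = 1 + wTilde α τ 0 := by simp [c0, wTilde]
  rcases h1.eq_or_lt with rfl | h2
  · have := h.first i j hij
    rw [hc] at this
    simp [srcWeight, srcFn, prodInt]
    linarith
  · have := h.step n h2 hn i j hij
    obtain ⟨m, rfl⟩ := Nat.exists_eq_add_of_le' h1
    rw [Finset.sum_Icc_succ_top (by omega), Finset.sum_Icc_succ_top (by omega)]
    rw [Nat.add_sub_cancel, hc] at this
    have e : ∑ k ∈ Finset.Icc 1 m,
          srcWeight (abar α) τ (m + 1) k * G.avg (srcFn f F U (m + 1) k) i j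
        = ∑ k ∈ Finset.Icc 1 m,
            lamTilde (abar α) τ (m + 1) k * G.avg (fun p q => f (U k p q)) i j := by
      refine Finset.sum_congr rfl fun k hk => ?_
      have := (Finset.mem_Icc.1 hk).2
      rw [srcWeight, srcFn, if_neg (by omega), if_neg (by omega), if_neg (by omega)]
    rw [e, srcWeight, srcFn, if_neg (by omega), if_pos rfl, if_pos rfl, Nat.sub_self]
    linarith

lemma srcWeight_nonneg {a τ : ℝ} (ha : a ∈ Ioo (0 : ℝ) 1) (hτ : 0 < τ) {n k : ℕ} (hk : 1 ≤ k)
    (hkn : k ≤ n) : 0 ≤ srcWeight a τ n k := by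
  have h1 := lam_nonneg ha hτ
  unfold srcWeight lamTilde
  split_ifs with h2 h3 h4
  · exact h1 1 1 le_rfl le_rfl
  · exact div_nonneg (h1 n n (by omega) le_rfl) two_pos.le
  · have := h1 n 1 le_rfl (by omega)
    have := h1 n 2 (by omega) (by omega)
    positivity
  · have := h1 n k (by omega) (by omega)
    have := h1 n (k + 1) (by omega) (by omega)
    positivity

/-- Each weight λ is used for at most two neighbouring time levels, hence the factor 2 over the row
sum of λ. -/
lemma sum_srcWeight_le {a τ T : ℝ} (ha : a ∈ Ioo (0 : ℝ) 1) (hτ : 0 < τ) {n : ℕ} (h1 : 1 ≤ n)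
    (hn : n * τ ≤ T) :
    ∑ k ∈ Finset.Icc 1 n, srcWeight a τ n k ≤ 2 * (T ^ a / Real.Gamma (a + 1)) := by
  have hs := sum_lam_le ha hτ n hn
  have hl := lam_nonneg ha hτ n
  rcases h1.eq_or_lt with rfl | h2
  · simp only [Finset.Icc_self, Finset.sum_singleton] at hs ⊢
    rw [srcWeight, if_pos rfl]
    linarith [hl 1 le_rfl le_rfl]
  · obtain ⟨m, rfl⟩ := Nat.exists_eq_add_of_le' h1
    have e1 : ∑ k ∈ Finset.Icc 1 m, srcWeight a τ (m + 1) k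
        ≤ ∑ k ∈ Finset.Icc 1 m, (lam a τ (m + 1) k + lam a τ (m + 1) (k + 1)) := by
      refine Finset.sum_le_sum fun k hk => ?_
      rw [Finset.mem_Icc] at hk
      have := hl k hk.1 (by omega)
      have := hl (k + 1) (by omega) (by omega)
      rw [srcWeight, if_neg (by omega), if_neg (by omega), lamTilde]
      split_ifs with h
      · subst h
        linarith
      · linarith
    have e2 : ∑ k ∈ Finset.Icc 1 m, lam a τ (m + 1) (k + 1)
        ≤ ∑ k ∈ Finset.Icc 1 (m + 1), lam a τ (m + 1) k - lam a τ (m + 1) 1 := by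
      rw [sum_Icc_one, sum_Icc_one, Finset.sum_range_succ' _ m]
      simp
    rw [Finset.sum_Icc_succ_top (by omega), srcWeight, if_neg (by omega), if_pos rfl]
    rw [Finset.sum_add_distrib] at e1
    rw [Finset.sum_Icc_succ_top (by omega)] at hs e2
    have := hl (m + 1) (by omega) le_rfl
    have := hl 1 le_rfl (by omega)
    linarith

lemma abs_bTerm_le {G : Grid} {α : ℝ → ℝ} {T Qg τ : ℝ} {N n : ℕ} (hg : IsGenIdBound α T Qg)
    (hτ : 0 < τ) (hN : N * τ = T) (h1 : 1 ≤ n) (hn : n ≤ N) (v0 : ℝ × ℝ → ℝ) (i j : ℕ) :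
    |bTerm G α τ v0 n i j| ≤ Qg * |v0 (G.pt i j)| := by
  have hn1 : (1 : ℝ) ≤ n := by exact_mod_cast h1
  have hT : (n : ℝ) * τ ≤ T :=
    hN ▸ mul_le_mul_of_nonneg_right (by exact_mod_cast hn) hτ.le
  have h := intervalIntegral.norm_integral_le_of_norm_le_const (a := ((n : ℝ) - 1) * τ)
    (b := (n : ℝ) * τ) (C := Qg * |v0 (G.pt i j)|) (f := fun t => genId α t * v0 (G.pt i j)) ?_
  · rw [show (n : ℝ) * τ - ((n : ℝ) - 1) * τ = τ by ring, abs_of_pos hτ, Real.norm_eq_abs] at h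
    rw [bTerm, abs_mul, abs_of_pos (by positivity : 0 < 1 / τ), one_div, inv_mul_le_iff₀ hτ]
    linarith
  · intro t ht
    rw [uIoc_of_le (by nlinarith)] at ht
    rw [Real.norm_eq_abs, abs_mul]
    refine mul_le_mul_of_nonneg_right (hg.bound t ⟨?_, ht.2.trans hT⟩) (abs_nonneg _)
    exact le_trans (mul_nonneg (by linarith) hτ.le) ht.1.le

/-- The constant in the estimate of the sources. -/
noncomputable def srcConst (T a Qg Qf : ℝ) : ℝ :=
  T ^ a / Real.Gamma (a + 1) * (54 + 66 * Qf ^ 2 + 7 * Qf ^ 2 + 3) + Qg ^ 2 + 3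

/-- The constant in the stability estimate on one grid. -/
noncomputable def stabConst (T a Qg Qf : ℝ) : ℝ :=
  9 / 4 * ((1 + 2 * srcConst T a Qg Qf * T) *
    Real.exp (4 * (Qg * (2 + logPrim T) + srcConst T a Qg Qf) * T))

lemma srcConst_pos {T a Qg Qf : ℝ} (hT : 0 < T) (ha : 0 < a) : 0 < srcConst T a Qg Qf := by
  have := Real.Gamma_pos_of_pos (by linarith : 0 < a + 1)
  unfold srcConst
  positivity

/-- Stability on a single grid, given a bound for the grid functions `P` about which the source is
linearized. -/
theorem IsSchemeSolution.stability {T a Qg Qf τ Dp : ℝ} {N : ℕ} {α f : ℝ → ℝ} {G : Grid}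
    {u0 v0 : ℝ × ℝ → ℝ} {F U P : ℕ → GridFn} (hT : 0 < T) (ha : a ∈ Ioo (0 : ℝ) 1)
    (hQg : 0 < Qg) (hαa : α 0 - 1 = a) (hg : IsGenIdBound α T Qg)
    (hf : ∀ x, |f x - f 0| ≤ Qf * |x|)
    (hx : G.lx < G.rx) (hy : G.ly < G.ry) (hMx : 1 ≤ G.Mx) (hMy : 1 ≤ G.My)
    (hv0 : ∀ p ∈ frontier G.domain, v0 p = 0) (hτ : 0 < τ) (hN : N * τ = T)
    (hsmall : 2 * (Qg * (2 + logPrim T) + srcConst T a Qg Qf) * τ ≤ 1 / 2)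
    (hU : IsSchemeSolution G α f u0 v0 τ N F U)
    (hF : ∀ n, 1 ≤ n → n ≤ N → ∀ i j, i ≤ G.Mx → j ≤ G.My →
      |F n i j| ≤ |f 0| + Qf * |U n i j| + 2 * Qf * |P n i j|)
    (hDp : 0 ≤ Dp) (hP : ∀ n, 1 ≤ n → n ≤ N → G.closedSq (P n) ≤ Dp) (n : ℕ) (hn : n ≤ N) :
    G.inner (U n) (U n) ≤ stabConst T a Qg Qf *
      (G.inner (G.sample u0) (G.sample u0)
        + G.inner (G.sample fun p => f (u0 p)) (G.sample fun p => f (u0 p))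
        + G.inner (G.sample v0) (G.sample v0) + Dp) := by
  subst hαa
  have hdxy : 0 ≤ G.dx * G.dy := (mul_pos (Grid.dx_pos hx hMx) (Grid.dy_pos hy hMy)).le
  set D : ℝ := G.inner (G.sample u0) (G.sample u0)
        + G.inner (G.sample fun p => f (u0 p)) (G.sample fun p => f (u0 p))
        + G.inner (G.sample v0) (G.sample v0) + Dp with hD
  have hu := Grid.inner_self_nonneg hdxy (G.sample u0)
  have hfu := Grid.inner_self_nonneg hdxy (G.sample fun p => f (u0 p))
  have hv := Grid.inner_self_nonneg hdxy (G.sample v0)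
  have hD0 : 0 ≤ D := by positivity
  -- Since v₀ vanishes on ∂Ω, its closed norm in the bound for the b-term equals the interior norm.
  have hv0G : G.ZeroBdry (G.sample v0) := fun i j hij =>
    hv0 _ (Grid.pt_mem_frontier hx hy hMx hMy hij)
  have hlog := logPrim_nonneg hT.le
  have hC := srcConst_pos (Qg := Qg) (Qf := Qf) hT ha.1
  set Λ : ℝ := T ^ (α 0 - 1) / Real.Gamma (α 0 - 1 + 1) with hΛ
  have hΛ0 : 0 ≤ Λ := by
    have := Real.Gamma_pos_of_pos (by linarith [ha.1] : 0 < α 0 - 1 + 1)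
    positivity
  set q : ℕ → ℝ := fun k => G.massForm (U k) (U k) with hq
  have hinner : ∀ {v : GridFn} {x : ℝ}, G.massForm v v ≤ x → G.inner v v ≤ 9 / 4 * x := by
    intro v x h
    linarith [Grid.le_massForm hdxy v]
  have htested : ∀ n, 1 ≤ n → n ≤ N →
      G.massForm (U n) (halfStep U n) - G.massForm (U (n - 1)) (halfStep U n)
        + ∑ k ∈ Finset.Icc 1 n, wTilde α τ (n - k) *
          (G.massForm (U k) (halfStep U n) - G.massForm (U (k - 1)) (halfStep U n))
        + τ * ∑ j ∈ Finset.Icc 1 n, lam (α 0 - 1) τ n j *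
          G.stiffForm (halfStep U j) (halfStep U n)
      ≤ τ * (srcConst T (α 0 - 1) Qg Qf * (runMax q n + D)) := by
    intro n h1 hn
    set ψ := halfStep U n with hψ
    have hψ0 : G.ZeroBdry ψ := Grid.ZeroBdry.halfStep (fun k hk => hU.bdry k (hk.trans hn)) h1
    have hx0 : 0 ≤ runMax q n := (Grid.massForm_nonneg hdxy (U n)).trans (le_runMax q le_rfl)
    have hψx : G.inner ψ ψ ≤ 9 / 4 * runMax q n :=
      hinner (form_halfStep_le G.massForm G.massForm_comm (Grid.massForm_nonneg hdxy) U
        (fun k hk => le_runMax q hk) h1)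
    -- The scheme holds at interior nodes only, which is all that the inner product sees.
    have heq : G.inner (G.avg (dt τ U n)
          + ∑ k ∈ Finset.Icc 1 n, wTilde α τ (n - k) • G.avg (dt τ U k)
          - ∑ k ∈ Finset.Icc 1 n, lam (α 0 - 1) τ n k • G.lap (halfStep U k)) ψ
        = G.inner (∑ k ∈ Finset.Icc 1 n,
            srcWeight (α 0 - 1) τ n k • G.avg (srcFn f F U n k) + G.avg (bTerm G α τ v0 n)) ψ := by
      refine Grid.inner_congr (fun i j hij => ?_) fun _ _ _ => rfl
      have := hU.equation h1 hn hij
      simpa only [Pi.add_apply, Pi.sub_apply, Finset.sum_apply, Pi.smul_apply, smul_eq_mul,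
        abar] using this
    simp only [← Grid.innerWith_apply, map_add, map_sub, map_sum, map_smul, smul_eq_mul] at heq
    simp only [Grid.innerWith_apply, Grid.inner_lap hMx hMy _ hψ0] at heq
    have hdt : ∀ k, G.inner (G.avg (dt τ U k)) ψ
        = (G.massForm (U k) ψ - G.massForm (U (k - 1)) ψ) / τ := by
      intro k
      rw [Grid.inner_avg hMx hMy _ hψ0,
        show dt τ U k = (1 / τ) • (U k - U (k - 1)) by
          funext i j
          simp only [dt, Pi.smul_apply, Pi.sub_apply, smul_eq_mul]
          ring]
      simp only [map_smul, map_sub, LinearMap.smul_apply, LinearMap.sub_apply, smul_eq_mul]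
      ring
    -- Origin of the constants: 54 and 66 = 54 + 12 come from the data and Dp in
    -- `Grid.inner_avg_source_le`, 7 ≥ 3·9/4 from ‖U_k‖², and 3 ≥ 9/4 from ‖ψ‖². The factor 9/4
    -- converts the energy into the norm.
    have hsrc : ∀ k ∈ Finset.Icc 1 n, G.inner (G.avg (srcFn f F U n k)) ψ
        ≤ (54 + 66 * Qf ^ 2 + 7 * Qf ^ 2 + 3) / 2 * (runMax q n + D) := by
      intro k hk
      rw [Finset.mem_Icc] at hk
      have hUk : G.inner (U k) (U k) ≤ 9 / 4 * runMax q n := hinner (le_runMax q hk.2)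
      have hb := Grid.inner_avg_source_le (F := srcFn f F U n k) (P := P k) hdxy hMx hMy hf
        (G.sample u0) (hU.bdry k (hk.2.trans hn)) ?_
      · have hPk := hP k hk.1 (hk.2.trans hn)
        have hfu' : G.inner (fun i j => f (G.sample u0 i j)) (fun i j => f (G.sample u0 i j))
          = G.inner (G.sample fun p => f (u0 p)) (G.sample fun p => f (u0 p)) := rfl
        rw [hfu'] at hb
        have h3 := Grid.inner_le_half hdxy (G.avg (srcFn f F U n k)) ψ
        have h4 : 3 * Qf ^ 2 * G.inner (U k) (U k) ≤ 3 * Qf ^ 2 * (9 / 4 * runMax q n) := by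
          gcongr
        have h5 : 12 * Qf ^ 2 * G.closedSq (P k) ≤ 12 * Qf ^ 2 * Dp := by gcongr
        have h6 : 0 ≤ Qf ^ 2 * runMax q n := by positivity
        have h7 : 0 ≤ Qf ^ 2 * Dp := by positivity
        have h8 : 0 ≤ Qf ^ 2 * G.inner (G.sample fun p => f (u0 p))
          (G.sample fun p => f (u0 p)) := by positivity
        have h9 : 0 ≤ Qf ^ 2 * G.inner (G.sample v0) (G.sample v0) := by positivity
        have h10 : 0 ≤ Qf ^ 2 * G.inner (G.sample u0) (G.sample u0) := by positivity
        rw [hD]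
        linarith
      · intro i j hi hj
        unfold srcFn
        split_ifs with hkn
        · subst hkn
          exact hF k h1 hn i j hi hj
        · have h3 := hf (U k i j)
          have h4 := abs_sub_abs_le_abs_sub (f (U k i j)) (f 0)
          have h5 : 0 ≤ 2 * Qf * |P k i j| := by
            have : 0 ≤ Qf := by
              have := (abs_nonneg _).trans (hf 1)
              simpa using this
            positivity
          linarith
    have hsum : ∑ k ∈ Finset.Icc 1 n, srcWeight (α 0 - 1) τ n k * G.inner (G.avg (srcFn f F U n k)) ψ
        ≤ Λ * (54 + 66 * Qf ^ 2 + 7 * Qf ^ 2 + 3) * (runMax q n + D) := by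
      have hnT : (n : ℝ) * τ ≤ T :=
        hN ▸ mul_le_mul_of_nonneg_right (by exact_mod_cast hn) hτ.le
      calc _ ≤ ∑ k ∈ Finset.Icc 1 n, srcWeight (α 0 - 1) τ n k *
            ((54 + 66 * Qf ^ 2 + 7 * Qf ^ 2 + 3) / 2 * (runMax q n + D)) :=
            Finset.sum_le_sum fun k hk => mul_le_mul_of_nonneg_left (hsrc k hk)
              (srcWeight_nonneg ha hτ (Finset.mem_Icc.1 hk).1 (Finset.mem_Icc.1 hk).2)
        _ = (∑ k ∈ Finset.Icc 1 n, srcWeight (α 0 - 1) τ n k) *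
            ((54 + 66 * Qf ^ 2 + 7 * Qf ^ 2 + 3) / 2 * (runMax q n + D)) := by
            rw [Finset.sum_mul]
        _ ≤ 2 * Λ * ((54 + 66 * Qf ^ 2 + 7 * Qf ^ 2 + 3) / 2 * (runMax q n + D)) :=
            mul_le_mul_of_nonneg_right (sum_srcWeight_le ha hτ h1 hnT) (by positivity)
        _ = _ := by ring
    have hbt : G.inner (G.avg (bTerm G α τ v0 n)) ψ ≤ (Qg ^ 2 + 3) * (runMax q n + D) := by
      have h3 := Grid.inner_le_half hdxy (G.avg (bTerm G α τ v0 n)) ψ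
      have h4 := Grid.inner_avg_self_le hdxy hMx hMy (bTerm G α τ v0 n)
      have h5 : G.closedSq (bTerm G α τ v0 n) ≤ Qg ^ 2 * G.closedSq (G.sample v0) := by
        refine Grid.closedSq_mono hdxy fun i j _ _ => ?_
        rw [← sq_abs, ← sq_abs (G.sample v0 i j), ← mul_pow]
        exact pow_le_pow_left₀ (abs_nonneg _) (abs_bTerm_le hg hτ hN h1 hn v0 i j) 2
      rw [hv0G.closedSq_eq hMx hMy] at h5
      have h6 : 0 ≤ Qg ^ 2 * runMax q n := by positivity
      have h7 : 0 ≤ Qg ^ 2 * Dp := by positivity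
      have h8 : 0 ≤ Qg ^ 2 * G.inner (G.sample fun p => f (u0 p))
        (G.sample fun p => f (u0 p)) := by positivity
      have h9 : 0 ≤ Qg ^ 2 * G.inner (G.sample v0) (G.sample v0) := by positivity
      have h10 : 0 ≤ Qg ^ 2 * G.inner (G.sample u0) (G.sample u0) := by positivity
      rw [hD]
      linarith
    simp only [hdt] at heq
    have hmul : G.massForm (U n) ψ - G.massForm (U (n - 1)) ψ
        + ∑ k ∈ Finset.Icc 1 n, wTilde α τ (n - k) *
          (G.massForm (U k) ψ - G.massForm (U (k - 1)) ψ)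
        + τ * ∑ j ∈ Finset.Icc 1 n, lam (α 0 - 1) τ n j * G.stiffForm (halfStep U j) ψ
        = τ * (∑ k ∈ Finset.Icc 1 n,
            srcWeight (α 0 - 1) τ n k * G.inner (G.avg (srcFn f F U n k)) ψ
          + G.inner (G.avg (bTerm G α τ v0 n)) ψ) := by
      have e1 : τ * ∑ k ∈ Finset.Icc 1 n, wTilde α τ (n - k) *
            ((G.massForm (U k) ψ - G.massForm (U (k - 1)) ψ) / τ)
          = ∑ k ∈ Finset.Icc 1 n, wTilde α τ (n - k) *
            (G.massForm (U k) ψ - G.massForm (U (k - 1)) ψ) := by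
        rw [Finset.mul_sum]
        refine Finset.sum_congr rfl fun k _ => ?_
        field_simp
      rw [← heq, mul_sub, mul_add, mul_div_cancel₀ _ hτ.ne', e1]
      simp only [mul_neg, Finset.sum_neg_distrib, sub_neg_eq_add]
    rw [hmul]
    refine mul_le_mul_of_nonneg_left ?_ hτ.le
    rw [srcConst, ← hΛ]
    linarith
  have hen := energy_estimate ha hτ hN G.massForm G.stiffForm G.massForm_comm
    (Grid.massForm_nonneg hdxy) G.stiffForm_comm (Grid.stiffForm_nonneg hdxy) U (wTilde α τ)
    (by positivity : 0 ≤ Qg * (2 + logPrim T)) hC.le hD0 hsmall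
    (fun n hn => hg.variation_wTilde_le hτ hN hn) htested n hn
  refine (hinner hen).trans ?_
  -- The initial trace u₀ may be nonzero on ∂Ω. The grid function U⁰ vanishes there and agrees with
  -- u₀ at the interior nodes, which suffices.
  have hq0 : G.massForm (U 0) (U 0) ≤ D := by
    refine (Grid.massForm_le hdxy (hU.bdry 0 (Nat.zero_le _))).trans ?_
    rw [Grid.inner_congr (u' := G.sample u0) (v' := G.sample u0) hU.init hU.init, hD]
    linarith
  rw [stabConst, mul_assoc (9 / 4 : ℝ)]
  refine mul_le_mul_of_nonneg_left ?_ (by norm_num : (0 : ℝ) ≤ 9 / 4)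
  rw [mul_right_comm _ (Real.exp _) D]
  refine mul_le_mul_of_nonneg_right ?_ (Real.exp_pos _).le
  linarith

/-! ### Stability of cubic spline interpolation -/

/-- The tridiagonal system in terms of a sequence that vanishes at both ends. -/
lemma splineMatrix_mulVec (m : ℕ) (y : ℕ → ℝ) (h0 : y 0 = 0) (h1 : y (m + 1) = 0) (k : Fin m) :
    (splineMatrix m).mulVec (fun j => y (j + 1)) k = (y k + 4 * y (k + 1) + y (k + 2)) / 2 := by
  have hk := k.isLt
  -- The matrix row acts through at most three nonzero entries. Those at the indices 0 and m + 1,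
  -- which the matrix omits, vanish together with y.
  set φ : ℕ → ℝ := fun i => (if i = k + 1 then 2 * y (k + 1) else 0)
    + (if i = k + 2 then 1 / 2 * y (k + 2) else 0) + (if i = k then 1 / 2 * y k else 0) with hφ
  have hφ0 : φ 0 = 0 := by
    simp only [hφ]
    rw [if_neg (by omega), if_neg (by omega)]
    split_ifs with h
    · rw [← h, h0]
      simp
    · simp
  have hφ1 : φ (m + 1) = 0 := by
    simp only [hφ]
    rw [if_neg (by omega), if_neg (by omega : m + 1 ≠ k)]
    split_ifs with h
    · rw [← h, h1]
      simp
    · simp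
  calc (splineMatrix m).mulVec (fun j => y (j + 1)) k
      = ∑ j : Fin m, φ (j + 1) := by
        rw [Matrix.mulVec, dotProduct]
        refine Finset.sum_congr rfl fun j _ => ?_
        simp only [splineMatrix, Matrix.of_apply, hφ, Fin.ext_iff]
        by_cases e1 : (k : ℕ) = j
        · rw [if_pos e1, if_pos (by omega), if_neg (by omega), if_neg (by omega), e1]
          ring
        · rw [if_neg e1, if_neg (by omega : ¬((j : ℕ) + 1 = k + 1))]
          by_cases e2 : (k : ℕ) + 1 = j
          · rw [if_pos (Or.inl e2), if_pos (by omega), if_neg (by omega), ← e2]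
            ring
          · rw [if_neg (by omega : ¬((j : ℕ) + 1 = k + 2))]
            by_cases e3 : (j : ℕ) + 1 = k
            · rw [if_pos (Or.inr e3), if_pos e3, e3]
              ring
            · rw [if_neg (by omega), if_neg e3]
              ring
    _ = ∑ i ∈ Finset.range (m + 1 + 1), φ i := by
        rw [Fin.sum_univ_eq_sum_range (fun j => φ (j + 1)) m,
          Grid.sum_range_eq_of_ends (by omega) φ hφ0 hφ1, Nat.add_sub_cancel]
    _ = _ := by
        simp only [hφ, Finset.sum_add_distrib, Finset.sum_ite_eq', Finset.mem_range]
        rw [if_pos (by omega), if_pos (by omega), if_pos (by omega)]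
        ring

lemma sum_shift_le (m : ℕ) (p : ℕ → ℝ) (h0 : p 0 = 0) (h1 : p (m + 1) = 0) (hp : ∀ i, 0 ≤ p i) :
    ∑ i ∈ Finset.range m, p i ≤ ∑ i ∈ Finset.range m, p (i + 1) ∧
      ∑ i ∈ Finset.range m, p (i + 2) ≤ ∑ i ∈ Finset.range m, p (i + 1) := by
  have e1 := Finset.sum_range_succ p m
  have e2 := Finset.sum_range_succ' p m
  have e3 := Finset.sum_range_succ (fun i => p (i + 1)) m
  have e4 := Finset.sum_range_succ' (fun i => p (i + 1)) m
  have := hp m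
  have := hp 1
  simp only [zero_add] at e4
  constructor
  · linarith
  · have : ∑ i ∈ Finset.range m, p (i + 1 + 1) = ∑ i ∈ Finset.range m, p (i + 2) := rfl
    linarith

/-- The tridiagonal system is stable in the discrete `L²` norm. -/
lemma sum_sq_le_of_tridiag (m : ℕ) (y b : ℕ → ℝ) (h0 : y 0 = 0) (h1 : y (m + 1) = 0)
    (h : ∀ k < m, (y k + 4 * y (k + 1) + y (k + 2)) / 2 = b k) :
    ∑ k ∈ Finset.range m, y (k + 1) ^ 2 ≤ ∑ k ∈ Finset.range m, b k ^ 2 := by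
  have hs := sum_shift_le m (fun i => y i ^ 2) (by simp [h0]) (by simp [h1]) fun _ => sq_nonneg _
  -- Here y_{k+1} = b_k/2 - y_k/4 - y_{k+2}/4, so convexity of the square applies. After summation
  -- the neighbours cost half of the left side, which is absorbed.
  have hpt : ∀ k ∈ Finset.range m, y (k + 1) ^ 2 ≤ b k ^ 2 / 2
      + (y k ^ 2 + y (k + 2) ^ 2) / 4 := by
    intro k hk
    rw [← h k (Finset.mem_range.1 hk)]
    nlinarith [sq_nonneg ((y k + 4 * y (k + 1) + y (k + 2)) / 2 - y (k + 1)),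
      sq_nonneg (y k + y (k + 1)), sq_nonneg (y (k + 2) + y (k + 1))]
  have := Finset.sum_le_sum hpt
  rw [Finset.sum_add_distrib, ← Finset.sum_div, ← Finset.sum_div, Finset.sum_add_distrib] at this
  linarith

/-- The L² stability of the tridiagonal system with zero right side gives injectivity. -/
lemma isUnit_splineMatrix (m : ℕ) : IsUnit (splineMatrix m) := by
  rw [← Matrix.mulVec_injective_iff_isUnit]
  refine (injective_iff_map_eq_zero (splineMatrix m).mulVecLin).2 fun x hx => ?_
  set y : ℕ → ℝ := fun i => if h : 1 ≤ i ∧ i ≤ m then x ⟨i - 1, by omega⟩ else 0 with hy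
  have hyx : (fun j : Fin m => y (j + 1)) = x := by
    funext j
    have : 1 ≤ (j : ℕ) + 1 ∧ (j : ℕ) + 1 ≤ m := ⟨by omega, j.isLt⟩
    simp only [hy, dif_pos this]
    rfl
  have h0 : y 0 = 0 := dif_neg (by omega)
  have h1 : y (m + 1) = 0 := dif_neg (by omega)
  have hle := sum_sq_le_of_tridiag m y 0 h0 h1 fun k hk => by
    rw [← splineMatrix_mulVec m y h0 h1 ⟨k, hk⟩, hyx]
    exact congrFun hx _
  have hz : ∑ k ∈ Finset.range m, y (k + 1) ^ 2 = 0 := by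
    refine le_antisymm (hle.trans_eq (by simp)) (by positivity)
  rw [Finset.sum_eq_zero_iff_of_nonneg fun _ _ => sq_nonneg _] at hz
  rw [← hyx]
  funext j
  exact pow_eq_zero_iff two_ne_zero |>.1 (hz j (Finset.mem_range.2 j.isLt))

section

variable {M : ℕ} (hM : 1 ≤ M) (H : ℝ) (v : ℕ → ℝ)

lemma splineCoeff_zero : splineCoeff M H v 0 = 0 := dif_neg (by omega)

include hM in
lemma splineCoeff_last : splineCoeff M H v M = 0 := dif_neg (by omega)

include hM in
lemma splineCoeff_system {k : ℕ} (hk : k < M - 1) :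
    (splineCoeff M H v k + 4 * splineCoeff M H v (k + 1) + splineCoeff M H v (k + 2)) / 2
      = 3 * ((v (k + 2) - 2 * v (k + 1) + v k) / H ^ 2) := by
  rw [← splineMatrix_mulVec (M - 1) (splineCoeff M H v) (splineCoeff_zero H v)
    (by rw [Nat.sub_add_cancel hM]; exact splineCoeff_last hM H v) ⟨k, hk⟩]
  have : (fun j : Fin (M - 1) => splineCoeff M H v (j + 1))
      = (splineMatrix (M - 1))⁻¹.mulVec fun k : Fin (M - 1) =>
        3 * ((v (k + 2) - 2 * v (k + 1) + v k) / H ^ 2) := by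
    funext j
    have hj : 1 ≤ (j : ℕ) + 1 ∧ (j : ℕ) + 1 ≤ M - 1 := ⟨by omega, j.isLt⟩
    rw [splineCoeff, dif_pos hj]
    rfl
  rw [this, Matrix.mulVec_mulVec, Matrix.mul_nonsing_inv _
    ((Matrix.isUnit_iff_isUnit_det _).1 (isUnit_splineMatrix _)), Matrix.one_mulVec]

-- The scaling by H² makes the bound independent of the mesh. By a weighted Cauchy–Schwarz
-- inequality 9 (x - 2y + z)² ≤ 21.6 (x² + 10y² + z²), and 260 exceeds 12 · 21.6.
include hM in
lemma sum_splineCoeff_sq_le (hH : H ≠ 0) :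
    ∑ i ∈ Finset.range (M + 1), (H ^ 2 * splineCoeff M H v i) ^ 2
      ≤ 260 * ∑ i ∈ Finset.range (M + 1), v i ^ 2 := by
  set y : ℕ → ℝ := fun i => H ^ 2 * splineCoeff M H v i with hy
  have h0 : y 0 = 0 := by simp [hy, splineCoeff_zero]
  have h1 : y M = 0 := by simp [hy, splineCoeff_last hM]
  have h1' : y (M - 1 + 1) = 0 := by rwa [Nat.sub_add_cancel hM]
  have hle := sum_sq_le_of_tridiag (M - 1) y (fun k => 3 * (v (k + 2) - 2 * v (k + 1) + v k)) h0 h1'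
    fun k hk => by
      have := splineCoeff_system hM H v hk
      simp only [hy]
      field_simp at this ⊢
      linarith
  rw [Grid.sum_range_eq_of_ends hM (fun i => y i ^ 2) (by simp [h0]) (by simp [h1])]
  refine hle.trans ?_
  have hst := Grid.sum_stencil_le (M - 1) (fun i => v i ^ 2) fun _ => sq_nonneg _
  rw [show M - 1 + 2 = M + 1 by omega] at hst
  refine le_trans ?_ (mul_le_mul_of_nonneg_left hst (by norm_num))
  rw [Finset.mul_sum]
  refine Finset.sum_le_sum fun k _ => ?_
  nlinarith [sq_nonneg (v k + 5 * v (k + 1)), sq_nonneg (v (k + 2) + 5 * v (k + 1)),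
    sq_nonneg (v k - v (k + 2)), sq_nonneg (v k), sq_nonneg (v (k + 2)), sq_nonneg (v (k + 1))]

end

/-- The polynomial pieces are controlled by the nodal values and the coefficients. -/
lemma splinePiece_sq_le (M : ℕ) {H : ℝ} (hH : 0 < H) (l : ℝ) (v : ℕ → ℝ) (c : ℕ)
    {x θ : ℝ} (h0 : 0 ≤ θ) (h1 : θ ≤ 1) (hx : x = l + (c - θ) * H) :
    splinePiece M H l v c x ^ 2 ≤ 4 * (v (c - 1) ^ 2 + v c ^ 2
      + (H ^ 2 * splineCoeff M H v (c - 1)) ^ 2 + (H ^ 2 * splineCoeff M H v c) ^ 2) := by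
  set p := H ^ 2 * splineCoeff M H v (c - 1) with hp
  set q := H ^ 2 * splineCoeff M H v c with hq
  -- In the local coordinate θ, the distance to the right node in units of H, all coefficients of
  -- the nodal values and scaled moments are bounded by 1.
  have e : splinePiece M H l v c x = θ * v (c - 1) + (1 - θ) * v c
      + (θ ^ 3 - θ) / 6 * p + ((1 - θ) ^ 3 - (1 - θ)) / 6 * q := by
    rw [splinePiece, hx, hp, hq]
    field_simp
    ring
  have hcoef : ∀ {s : ℝ}, 0 ≤ s → s ≤ 1 → |(s ^ 3 - s) / 6| ≤ 1 := by
    intro s hs0 hs1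
    have : s ^ 3 ≤ 1 := pow_le_one₀ hs0 hs1
    have : 0 ≤ s ^ 3 := by positivity
    rw [abs_le]
    constructor <;> linarith
  have hsq : ∀ {s y : ℝ}, |s| ≤ 1 → (s * y) ^ 2 ≤ y ^ 2 := by
    intro s y hs
    rw [mul_pow]
    have : s ^ 2 ≤ 1 := by rwa [sq_le_one_iff_abs_le_one]
    nlinarith [sq_nonneg y]
  have i1 := hsq (y := v (c - 1)) (by rwa [abs_of_nonneg h0] : |θ| ≤ 1)
  have i2 := hsq (y := v c) (by rw [abs_of_nonneg] <;> linarith : |1 - θ| ≤ 1)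
  have i3 := hsq (y := p) (hcoef h0 h1)
  have i4 := hsq (y := q) (hcoef (by linarith : 0 ≤ 1 - θ) (by linarith))
  rw [e]
  generalize θ * v (c - 1) = a1 at i1 ⊢
  generalize (1 - θ) * v c = a2 at i2 ⊢
  generalize (θ ^ 3 - θ) / 6 * p = a3 at i3 ⊢
  generalize ((1 - θ) ^ 3 - (1 - θ)) / 6 * q = a4 at i4 ⊢
  nlinarith [sq_nonneg (a1 - a2), sq_nonneg (a1 - a3), sq_nonneg (a1 - a4), sq_nonneg (a2 - a3),
    sq_nonneg (a2 - a4), sq_nonneg (a3 - a4)]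

/-- The fine node k + 1 lies in the coarse cell k / J + 1, where cells are closed on the right. Each
cell thus owns J fine nodes. -/
lemma ceil_succ_div (J k : ℕ) (hJ : 1 ≤ J) : ⌈((k + 1 : ℕ) : ℝ) / J⌉₊ = k / J + 1 := by
  have hJ0 : (0 : ℝ) < J := by exact_mod_cast hJ
  rw [Nat.ceil_eq_iff (Nat.add_one_ne_zero _), Nat.add_sub_cancel, lt_div_iff₀ hJ0, div_le_iff₀ hJ0]
  constructor
  · exact_mod_cast Nat.lt_succ_of_le (Nat.div_mul_le_self k J)
  · have h : k < (k / J + 1) * J :=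
      Nat.lt_mul_of_div_lt (Nat.lt_succ_self (k / J)) (by omega)
    exact_mod_cast h

lemma sum_range_mul_div (J M : ℕ) (hJ : 1 ≤ J) (p : ℕ → ℝ) :
    ∑ k ∈ Finset.range (J * M), p (k / J) = J * ∑ c ∈ Finset.range M, p c := by
  induction M with
  | zero => simp
  | succ M ih =>
    rw [Nat.mul_succ, Finset.sum_range_add, ih, Finset.sum_range_succ, mul_add]
    congr 1
    rw [Finset.sum_congr rfl (fun k hk => ?_ : ∀ k ∈ Finset.range J, p ((J * M + k) / J) = p M)]
    · simp
    · rw [Nat.mul_add_div (by omega), Nat.div_eq_of_lt (Finset.mem_range.1 hk), add_zero]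

/-- Stability of cubic spline interpolation from a grid to a refined grid. -/
lemma sum_spline_sq_le {M J : ℕ} (hM : 1 ≤ M) (hJ : 1 ≤ J) {H h : ℝ} (hh : 0 < h)
    (hH : H = J * h) (l : ℝ) (v : ℕ → ℝ) :
    ∑ i ∈ Finset.range (J * M + 1), spline M H l v (l + i * h) ^ 2
      ≤ 4176 * J * ∑ i ∈ Finset.range (M + 1), v i ^ 2 := by
  have hJ0 : (0 : ℝ) < J := by exact_mod_cast hJ
  have hJ1 : (1 : ℝ) ≤ J := by exact_mod_cast hJ
  have hH0 : 0 < H := by rw [hH]; positivity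
  set y : ℕ → ℝ := fun i => H ^ 2 * splineCoeff M H v i with hy
  set φ : ℕ → ℝ := fun c => 4 * (v c ^ 2 + v (c + 1) ^ 2 + y c ^ 2 + y (c + 1) ^ 2) with hφ
  have hφ0 : ∀ c, 0 ≤ φ c := fun c => by simp only [hφ]; positivity
  -- Node 0 belongs to no right-closed cell; the `max 1` in `spline` assigns it to the first one.
  have hfirst : spline M H l v (l + (0 : ℕ) * h) ^ 2 ≤ φ 0 := by
    have : max 1 ⌈(l + ((0 : ℕ) : ℝ) * h - l) / H⌉₊ = 1 := by simp
    rw [spline, this]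
    exact splinePiece_sq_le M hH0 l v 1 zero_le_one le_rfl (by simp)
  have hnext : ∀ k : ℕ, spline M H l v (l + (k + 1 : ℕ) * h) ^ 2 ≤ φ (k / J) := by
    intro k
    have e : (l + ((k + 1 : ℕ) : ℝ) * h - l) / H = ((k + 1 : ℕ) : ℝ) / J := by
      rw [hH]
      field_simp
      ring
    have hc := ceil_succ_div J k hJ
    rw [spline, e, hc, max_eq_right (Nat.le_add_left 1 _)]
    have hup := Nat.le_ceil (((k + 1 : ℕ) : ℝ) / J)
    have hlo := Nat.ceil_lt_add_one (by positivity : 0 ≤ ((k + 1 : ℕ) : ℝ) / J)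
    rw [hc] at hup hlo
    refine splinePiece_sq_le M hH0 l v (k / J + 1)
      (θ := ((k / J + 1 : ℕ) : ℝ) - ((k + 1 : ℕ) : ℝ) / J) (by linarith) (by linarith) ?_
    rw [hH, sub_sub_cancel]
    field_simp
  have hs0 : ∀ p : ℕ → ℝ, (∀ i, 0 ≤ p i) →
      ∑ c ∈ Finset.range M, p c ≤ ∑ c ∈ Finset.range (M + 1), p c ∧
      ∑ c ∈ Finset.range M, p (c + 1) ≤ ∑ c ∈ Finset.range (M + 1), p c := by
    intro p hp
    constructor
    · rw [Finset.sum_range_succ]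
      linarith [hp M]
    · rw [Finset.sum_range_succ']
      linarith [hp 0]
  -- 2088 = 4 · 2 · (1 + 260): the factor of the piecewise bound, the two ends of each cell, and the
  -- values together with the scaled coefficients.
  have hφsum : ∑ c ∈ Finset.range M, φ c ≤ 2088 * ∑ i ∈ Finset.range (M + 1), v i ^ 2 := by
    have hv := hs0 (fun i => v i ^ 2) fun _ => sq_nonneg _
    have hyy := hs0 (fun i => y i ^ 2) fun _ => sq_nonneg _
    have hc := sum_splineCoeff_sq_le hM H v hH0.ne'
    simp only [hφ, ← Finset.mul_sum, Finset.sum_add_distrib]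
    linarith [hv.1, hv.2, hyy.1, hyy.2]
  have hφfirst : φ 0 ≤ ∑ c ∈ Finset.range M, φ c :=
    Finset.single_le_sum (fun c _ => hφ0 c) (Finset.mem_range.2 (by omega))
  rw [Finset.sum_range_succ']
  have hrest : ∑ k ∈ Finset.range (J * M), spline M H l v (l + (k + 1 : ℕ) * h) ^ 2
      ≤ J * ∑ c ∈ Finset.range M, φ c := by
    rw [← sum_range_mul_div J M hJ]
    exact Finset.sum_le_sum fun k _ => hnext k
  have hS : 0 ≤ ∑ c ∈ Finset.range M, φ c := Finset.sum_nonneg fun c _ => hφ0 c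
  -- Node 0 costs one further copy of the sum, at most J copies, so that 2088 becomes 4176.
  calc _ ≤ J * ∑ c ∈ Finset.range M, φ c + 1 * ∑ c ∈ Finset.range M, φ c := by linarith
    _ ≤ J * ∑ c ∈ Finset.range M, φ c + J * ∑ c ∈ Finset.range M, φ c := by gcongr
    _ = 2 * J * ∑ c ∈ Finset.range M, φ c := by ring
    _ ≤ 2 * J * (2088 * ∑ i ∈ Finset.range (M + 1), v i ^ 2) := by gcongr
    _ = _ := by ring

/-- Stability of bicubic spline interpolation from a grid to a refined grid. -/
lemma Grid.closedSq_bicubic_le (G : Grid) (J : ℕ) (hx : G.lx < G.rx) (hy : G.ly < G.ry)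
    (hMx : 1 ≤ G.Mx) (hMy : 1 ≤ G.My) (hJ : 1 ≤ J) (u : GridFn) :
    (G.refine J).closedSq ((G.refine J).sample (G.bicubic u)) ≤ 4176 ^ 2 * G.closedSq u := by
  have hJ0 : (0 : ℝ) < J := by exact_mod_cast hJ
  have hx0 : (0 : ℝ) < G.Mx := by exact_mod_cast hMx
  have hy0 : (0 : ℝ) < G.My := by exact_mod_cast hMy
  have hdx : G.dx = J * (G.refine J).dx := by
    simp only [Grid.dx, Grid.refine]
    push_cast
    field_simp
  have hdy : G.dy = J * (G.refine J).dy := by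
    simp only [Grid.dy, Grid.refine]
    push_cast
    field_simp
  have hdx0 : 0 < (G.refine J).dx := Grid.dx_pos hx (Nat.mul_pos hJ hMx)
  have hdy0 : 0 < (G.refine J).dy := Grid.dy_pos hy (Nat.mul_pos hJ hMy)
  set dx' := (G.refine J).dx with hdx'
  set dy' := (G.refine J).dy with hdy'
  rw [Grid.closedSq, Grid.closedSq, ← hdx', ← hdy', hdx, hdy]
  -- The two one-dimensional bounds produce J², which is exactly the ratio of the coarse cell area
  -- to the fine one.
  have key : ∑ i ∈ Finset.range (J * G.Mx + 1), ∑ j ∈ Finset.range (J * G.My + 1),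
      (G.refine J).sample (G.bicubic u) i j ^ 2
      ≤ 4176 ^ 2 * J ^ 2 * ∑ i ∈ Finset.range (G.Mx + 1), ∑ j ∈ Finset.range (G.My + 1),
        u i j ^ 2 := by
    calc _ ≤ ∑ i ∈ Finset.range (J * G.Mx + 1), 4176 * J * ∑ j ∈ Finset.range (G.My + 1),
          spline G.Mx G.dx G.lx (fun i => u i j) (G.lx + i * dx') ^ 2 :=
          Finset.sum_le_sum fun i _ => sum_spline_sq_le hMy hJ hdy0 hdy G.ly
            fun j => spline G.Mx G.dx G.lx (fun i => u i j) (G.lx + i * dx')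
      _ = 4176 * J * ∑ j ∈ Finset.range (G.My + 1), ∑ i ∈ Finset.range (J * G.Mx + 1),
          spline G.Mx G.dx G.lx (fun i => u i j) (G.lx + i * dx') ^ 2 := by
          rw [← Finset.mul_sum, Finset.sum_comm]
      _ ≤ 4176 * J * ∑ j ∈ Finset.range (G.My + 1),
          (4176 * J * ∑ i ∈ Finset.range (G.Mx + 1), u i j ^ 2) := by
          refine mul_le_mul_of_nonneg_left (Finset.sum_le_sum fun j _ => ?_) (by positivity)
          exact sum_spline_sq_le hMx hJ hdx0 hdx G.lx fun i => u i j
      _ = _ := by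
          rw [← Finset.mul_sum, Finset.sum_comm]
          ring
  calc dx' * dy' * _ ≤ dx' * dy' * (4176 ^ 2 * J ^ 2 * ∑ i ∈ Finset.range (G.Mx + 1),
        ∑ j ∈ Finset.range (G.My + 1), u i j ^ 2) := mul_le_mul_of_nonneg_left key (by positivity)
    _ = _ := by ring

open MeasureTheory Filter Topology

/-! ### Regularity of the generalized identity function -/

/-- 1/Γ extends to an entire function, so it and its derivatives are bounded on the closed range
[0,1] of 2 - α, including the pole of Γ at 0. -/
lemma contDiff_inv_Gamma {n : WithTop ℕ∞} : ContDiff ℝ n fun x : ℝ => (Real.Gamma x)⁻¹ := by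
  have h := (Complex.differentiable_one_div_Gamma.contDiff (n := n)).real_of_complex
  have e : (fun x : ℝ => (Real.Gamma x)⁻¹) = fun x : ℝ => ((Complex.Gamma x)⁻¹).re := by
    funext x
    rw [Complex.Gamma_ofReal, ← Complex.ofReal_inv, Complex.ofReal_re]
  rw [e]
  exact h

/-- The mean value inequality on the convex set S bounds the difference quotients by C, and
dominated convergence applies. Derivatives relative to S cover the end points. -/
lemma hasDerivWithinAt_integral_of_bounded {ν : Measure ℝ} [IsFiniteMeasure ν] {S : Set ℝ}
    (hS : Convex ℝ S) {t₀ : ℝ} (ht₀ : t₀ ∈ S) {F F' : ℝ → ℝ → ℝ} {C : ℝ}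
    (hmeas : ∀ t ∈ S, AEStronglyMeasurable (F t) ν) (hbdd : ∀ t ∈ S, ∀ᵐ z ∂ν, |F t z| ≤ C)
    (hder : ∀ᵐ z ∂ν, ∀ t ∈ S, HasDerivWithinAt (fun t => F t z) (F' t z) S t ∧ |F' t z| ≤ C) :
    HasDerivWithinAt (fun t => ∫ z, F t z ∂ν) (∫ z, F' t₀ z ∂ν) S t₀ := by
  have hint : ∀ t ∈ S, Integrable (F t) ν := fun t ht =>
    Integrable.of_bound (hmeas t ht) C (hbdd t ht)
  rw [hasDerivWithinAt_iff_tendsto_slope]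
  have hmem : ∀ᶠ t in 𝓝[S \ {t₀}] t₀, t ∈ S \ {t₀} := self_mem_nhdsWithin
  have hlim : Tendsto (fun t => ∫ z, slope (fun t => F t z) t₀ t ∂ν) (𝓝[S \ {t₀}] t₀)
      (𝓝 (∫ z, F' t₀ z ∂ν)) := by
    refine tendsto_integral_filter_of_dominated_convergence (fun _ => C) ?_ ?_
      (integrable_const C) ?_
    · filter_upwards [hmem] with t ht
      simp only [slope_def_field, div_eq_mul_inv]
      exact AEStronglyMeasurable.mul_const ((hmeas t ht.1).sub (hmeas t₀ ht₀)) _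
    · filter_upwards [hmem] with t ht
      filter_upwards [hder] with z hz
      have hb := hS.norm_image_sub_le_of_norm_hasDerivWithin_le (fun x hx => (hz x hx).1)
        (fun x hx => (hz x hx).2) ht₀ ht.1
      have hne : 0 < ‖t - t₀‖ := norm_pos_iff.2 (sub_ne_zero.2 ht.2)
      rw [slope_def_field, norm_div, div_le_iff₀ hne]
      exact hb
    · filter_upwards [hder] with z hz
      exact hasDerivWithinAt_iff_tendsto_slope.1 (hz t₀ ht₀).1
  refine hlim.congr' ?_
  filter_upwards [hmem] with t ht
  simp only [slope_def_field]
  rw [integral_div, integral_sub (hint t ht.1) (hint t₀ ht₀)]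

section Kernel

/-- The exponent of the regular part `s^(1+a-α(s))` of the kernel. -/
noncomputable def regExp (α : ℝ → ℝ) (a s : ℝ) : ℝ := (1 + a - α s) * Real.log s

/-- The regular part of the kernel, normalized to the value `1` at the origin. -/
noncomputable def regKernel (α : ℝ → ℝ) (a s : ℝ) : ℝ :=
  Real.exp (regExp α a s) * (Real.Gamma (1 - a) * (Real.Gamma (2 - α s))⁻¹)

lemma mul_abs_log_le {t T : ℝ} (h0 : 0 ≤ t) (hT : t ≤ T) : t * |Real.log t| ≤ 1 + T ^ 2 := by
  rcases h0.eq_or_lt with rfl | h0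
  · simp only [zero_mul]
    positivity
  rcases le_total t 1 with h1 | h1
  · have := Real.abs_log_mul_self_lt t h0 h1
    rw [abs_mul, abs_of_pos h0] at this
    nlinarith [sq_nonneg T]
  · rw [abs_of_nonneg (Real.log_nonneg h1)]
    have := Real.log_le_sub_one_of_pos h0
    nlinarith

variable {α α₁ α₂ : ℝ → ℝ} {a T Q : ℝ}

/-- The regular part of the kernel is continuously differentiable on `[0,T]`, with a second
derivative of logarithmic growth. -/
lemma exists_regKernel_deriv (hT : 0 < T) (hQ : 0 ≤ Q)
    (hα : ∀ t ∈ Icc 0 T, α t ∈ Ioo (1 : ℝ) 2) (h0 : α 0 = 1 + a) (h10 : α₁ 0 = 0)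
    (h1 : ∀ t ∈ Icc 0 T, HasDerivWithinAt α (α₁ t) (Icc 0 T) t)
    (h2 : ∀ t ∈ Icc 0 T, HasDerivWithinAt α₁ (α₂ t) (Icc 0 T) t)
    (hb1 : ∀ t ∈ Icc 0 T, |α₁ t| ≤ Q) (hb2 : ∀ t ∈ Icc 0 T, |α₂ t| ≤ Q) :
    ∃ (K₁ K₂ : ℝ → ℝ) (C : ℝ), 0 ≤ C ∧
      (∀ t ∈ Icc 0 T, HasDerivWithinAt (regKernel α a) (K₁ t) (Icc 0 T) t) ∧
      (∀ t ∈ Ioc 0 T, HasDerivWithinAt K₁ (K₂ t) (Icc 0 T) t) ∧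
      (∀ t ∈ Icc 0 T, |regKernel α a t| ≤ C) ∧ (∀ t ∈ Icc 0 T, |K₁ t| ≤ C) ∧
      (∀ t ∈ Ioc 0 T, |K₂ t| ≤ C * (1 + |Real.log t|)) := by
  have hsub : ∀ t ∈ Icc 0 T, Icc 0 t ⊆ Icc 0 T := fun t ht => Icc_subset_Icc_right ht.2
  -- Integrating from 0 with α'(0) = 0 gives |α'(t)| ≤ Qt and then |1 + a - α(t)| ≤ Qt². These
  -- powers of t compensate the logarithm and its derivatives.
  have hα₁ : ∀ t ∈ Icc 0 T, |α₁ t| ≤ Q * t := by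
    intro t ht
    have := (convex_Icc 0 t).norm_image_sub_le_of_norm_hasDerivWithin_le
      (fun x hx => (h2 x (hsub t ht hx)).mono (hsub t ht)) (fun x hx => hb2 x (hsub t ht hx))
      (left_mem_Icc.2 ht.1) (right_mem_Icc.2 ht.1)
    simpa [h10, abs_of_nonneg ht.1] using this
  have hα₀ : ∀ t ∈ Icc 0 T, |1 + a - α t| ≤ Q * t * t := by
    intro t ht
    have := (convex_Icc 0 t).norm_image_sub_le_of_norm_hasDerivWithin_le (C := Q * t)
      (fun x hx => (h1 x (hsub t ht hx)).mono (hsub t ht))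
      (fun x hx => (hα₁ x (hsub t ht hx)).trans (mul_le_mul_of_nonneg_left hx.2 hQ))
      (left_mem_Icc.2 ht.1) (right_mem_Icc.2 ht.1)
    rw [abs_sub_comm]
    simpa [h0, abs_of_nonneg ht.1] using this
  set e : ℝ → ℝ := regExp α a with he
  set e₁ : ℝ → ℝ := fun t => -α₁ t * Real.log t + (1 + a - α t) / t with he₁
  set e₂ : ℝ → ℝ := fun t =>
    -α₂ t * Real.log t - α₁ t / t + (-α₁ t * t - (1 + a - α t)) / t ^ 2 with he₂
  have he_deriv : ∀ t ∈ Icc 0 T, HasDerivWithinAt e (e₁ t) (Icc 0 T) t := by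
    intro t ht
    rcases ht.1.eq_or_lt with rfl | htpos
    · have e10 : e₁ 0 = 0 := by simp [he₁]
      rw [e10, hasDerivWithinAt_iff_tendsto_slope]
      have hlog : Tendsto (fun t : ℝ => Q * |t * Real.log t|) (𝓝[Icc 0 T \ {0}] 0) (𝓝 0) := by
        have hc : Continuous fun t : ℝ => Q * |t * Real.log t| :=
          continuous_const.mul Real.continuous_mul_log.abs
        have := hc.tendsto 0
        rw [zero_mul, abs_zero, mul_zero] at this
        exact this.mono_left nhdsWithin_le_nhds
      refine squeeze_zero_norm' ?_ hlog
      filter_upwards [self_mem_nhdsWithin] with s hs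
      have hs0 : 0 < s := lt_of_le_of_ne hs.1.1 (Ne.symm hs.2)
      rw [slope_def_field, he, regExp, regExp, Real.log_zero, mul_zero, sub_zero, sub_zero,
        norm_div, Real.norm_eq_abs, Real.norm_eq_abs, abs_of_pos hs0, div_le_iff₀ hs0, abs_mul,
        abs_mul, abs_of_pos hs0]
      calc |1 + a - α s| * |Real.log s| ≤ Q * s * s * |Real.log s| :=
            mul_le_mul_of_nonneg_right (hα₀ s hs.1) (abs_nonneg _)
        _ = _ := by ring
    · have := ((h1 t ht).const_sub (1 + a)).mul
        (Real.hasDerivAt_log htpos.ne').hasDerivWithinAt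
      refine this.congr_deriv ?_
      simp only [he₁]
      ring
  have he₁_deriv : ∀ t ∈ Ioc 0 T, HasDerivWithinAt e₁ (e₂ t) (Icc 0 T) t := by
    intro t ht
    have ht' := Ioc_subset_Icc_self ht
    have i1 := (h2 t ht').neg.mul (Real.hasDerivAt_log ht.1.ne').hasDerivWithinAt
    have i2 := ((h1 t ht').const_sub (1 + a)).div (hasDerivWithinAt_id t _) ht.1.ne'
    refine (i1.add i2).congr_deriv ?_
    simp only [he₂, id, Pi.neg_apply]
    ring
  have he₁_bound : ∀ t ∈ Icc 0 T, |e₁ t| ≤ Q * (1 + T ^ 2) + Q * T := by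
    intro t ht
    refine (abs_add_le _ _).trans (add_le_add ?_ ?_)
    · rw [abs_mul, abs_neg]
      calc |α₁ t| * |Real.log t| ≤ Q * t * |Real.log t| :=
            mul_le_mul_of_nonneg_right (hα₁ t ht) (abs_nonneg _)
        _ = Q * (t * |Real.log t|) := by ring
        _ ≤ _ := mul_le_mul_of_nonneg_left (mul_abs_log_le ht.1 ht.2) hQ
    · rcases ht.1.eq_or_lt with rfl | htpos
      · simp only [div_zero, abs_zero]
        positivity
      · rw [abs_div, abs_of_pos htpos, div_le_iff₀ htpos]
        refine (hα₀ t ht).trans ?_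
        gcongr
        exact ht.2
  have he₂_bound : ∀ t ∈ Ioc 0 T, |e₂ t| ≤ 3 * Q * (1 + |Real.log t|) := by
    intro t ht
    have ht' := Ioc_subset_Icc_self ht
    have i1 : |-α₂ t * Real.log t| ≤ Q * |Real.log t| := by
      rw [abs_mul, abs_neg]
      exact mul_le_mul_of_nonneg_right (hb2 t ht') (abs_nonneg _)
    have i2 : |α₁ t / t| ≤ Q := by
      rw [abs_div, abs_of_pos ht.1, div_le_iff₀ ht.1]
      exact hα₁ t ht'
    have i3 : |(-α₁ t * t - (1 + a - α t)) / t ^ 2| ≤ 2 * Q := by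
      rw [abs_div, abs_of_pos (by have := ht.1; positivity : 0 < t ^ 2),
        div_le_iff₀ (by have := ht.1; positivity)]
      refine (abs_sub _ _).trans ?_
      rw [abs_mul, abs_neg, abs_of_pos ht.1]
      nlinarith [hα₀ t ht', mul_le_mul_of_nonneg_right (hα₁ t ht') ht.1.le]
    have i4 := abs_add_le (-α₂ t * Real.log t - α₁ t / t)
      ((-α₁ t * t - (1 + a - α t)) / t ^ 2)
    have i5 := abs_sub (-α₂ t * Real.log t) (α₁ t / t)
    have i6 : 0 ≤ Q * |Real.log t| := by positivity
    calc |e₂ t| ≤ Q * |Real.log t| + Q + 2 * Q := by linarith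
      _ ≤ _ := by linarith
  have he_bound : ∀ t ∈ Icc 0 T, |e t| ≤ Q * T * (1 + T ^ 2) := by
    intro t ht
    rw [he, regExp, abs_mul]
    calc |1 + a - α t| * |Real.log t| ≤ Q * t * t * |Real.log t| :=
          mul_le_mul_of_nonneg_right (hα₀ t ht) (abs_nonneg _)
      _ = Q * t * (t * |Real.log t|) := by ring
      _ ≤ Q * T * (1 + T ^ 2) := by
          have := mul_abs_log_le ht.1 ht.2
          have := ht.1
          have := ht.2
          gcongr
  set r : ℝ → ℝ := fun x => Real.Gamma (1 - a) * (Real.Gamma x)⁻¹ with hr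
  have hr2 : ContDiff ℝ 2 r := contDiff_const.mul contDiff_inv_Gamma
  have hr1 : ContDiff ℝ 1 (deriv r) := by
    have := (contDiff_succ_iff_deriv (n := 1) (f := r)).1 (by simpa [one_add_one_eq_two] using hr2)
    exact this.2.2
  have hrd : ∀ x, HasDerivAt r (deriv r x) x := fun x =>
    (hr2.differentiable (by norm_num) x).hasDerivAt
  have hrd' : ∀ x, HasDerivAt (deriv r) (deriv (deriv r) x) x := fun x =>
    (hr1.differentiable (by norm_num) x).hasDerivAt
  obtain ⟨c0, hc0⟩ := isCompact_Icc.exists_bound_of_continuousOn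
    (hr2.continuous.continuousOn (s := Icc (0 : ℝ) 1))
  obtain ⟨c1, hc1⟩ := isCompact_Icc.exists_bound_of_continuousOn
    (hr1.continuous.continuousOn (s := Icc (0 : ℝ) 1))
  obtain ⟨c2, hc2⟩ := isCompact_Icc.exists_bound_of_continuousOn
    ((hr1.continuous_deriv le_rfl).continuousOn (s := Icc (0 : ℝ) 1))
  have hc0' : 0 ≤ c0 := (norm_nonneg _).trans (hc0 0 (by simp))
  have hc1' : 0 ≤ c1 := (norm_nonneg _).trans (hc1 0 (by simp))
  have hc2' : 0 ≤ c2 := (norm_nonneg _).trans (hc2 0 (by simp))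
  have hmem : ∀ t ∈ Icc 0 T, 2 - α t ∈ Icc (0 : ℝ) 1 := fun t ht => by
    have := hα t ht
    constructor <;> linarith [this.1, this.2]
  set R : ℝ → ℝ := fun t => r (2 - α t) with hR
  set R₁ : ℝ → ℝ := fun t => deriv r (2 - α t) * -α₁ t with hR₁
  set R₂ : ℝ → ℝ := fun t =>
    deriv (deriv r) (2 - α t) * -α₁ t * -α₁ t + deriv r (2 - α t) * -α₂ t with hR₂
  have hR_deriv : ∀ t ∈ Icc 0 T, HasDerivWithinAt R (R₁ t) (Icc 0 T) t := fun t ht =>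
    (hrd _).comp_hasDerivWithinAt t ((h1 t ht).const_sub 2)
  have hR₁_deriv : ∀ t ∈ Icc 0 T, HasDerivWithinAt R₁ (R₂ t) (Icc 0 T) t := fun t ht =>
    ((hrd' _).comp_hasDerivWithinAt t ((h1 t ht).const_sub 2)).mul (h2 t ht).neg
  have hR_bound : ∀ t ∈ Icc 0 T, |R t| ≤ c0 := fun t ht => hc0 _ (hmem t ht)
  have hR₁_bound : ∀ t ∈ Icc 0 T, |R₁ t| ≤ c1 * Q := fun t ht => by
    rw [hR₁, abs_mul, abs_neg]
    exact mul_le_mul (hc1 _ (hmem t ht)) (hb1 t ht) (abs_nonneg _) hc1'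
  have hR₂_bound : ∀ t ∈ Icc 0 T, |R₂ t| ≤ c2 * Q * Q + c1 * Q := fun t ht => by
    refine (abs_add_le _ _).trans ?_
    rw [abs_mul, abs_mul, abs_mul, abs_neg, abs_neg]
    exact add_le_add (mul_le_mul (mul_le_mul (hc2 _ (hmem t ht)) (hb1 t ht) (abs_nonneg _) hc2')
      (hb1 t ht) (abs_nonneg _) (by positivity))
      (mul_le_mul (hc1 _ (hmem t ht)) (hb2 t ht) (abs_nonneg _) hc1')
  set E := Real.exp (Q * T * (1 + T ^ 2)) with hE
  have hexp : ∀ t ∈ Icc 0 T, |Real.exp (e t)| ≤ E := fun t ht => by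
    rw [Real.abs_exp]
    exact Real.exp_le_exp.2 ((le_abs_self _).trans (he_bound t ht))
  set b1 := Q * (1 + T ^ 2) + Q * T with hb1'
  have hb1n : 0 ≤ b1 := by positivity
  set D1 := b1 * c0 + c1 * Q with hD1
  set D2 := b1 * D1 + (3 * Q * c0 + (b1 * (c1 * Q) + (c2 * Q * Q + c1 * Q))) with hD2
  have hM_bound : ∀ t ∈ Icc 0 T, |e₁ t * R t + R₁ t| ≤ D1 := fun t ht => by
    refine (abs_add_le _ _).trans (add_le_add ?_ (hR₁_bound t ht))
    rw [abs_mul]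
    exact mul_le_mul (he₁_bound t ht) (hR_bound t ht) (abs_nonneg _) hb1n
  have hD1n : 0 ≤ D1 := by positivity
  have hEn : 0 ≤ E := (Real.exp_pos _).le
  refine ⟨fun t => Real.exp (e t) * (e₁ t * R t + R₁ t),
    fun t => Real.exp (e t) * (e₁ t * (e₁ t * R t + R₁ t) + (e₂ t * R t + (e₁ t * R₁ t + R₂ t))),
    E * c0 + E * D1 + E * D2, by positivity, ?_, ?_, ?_, ?_, ?_⟩
  · intro t ht
    refine ((he_deriv t ht).exp.mul (hR_deriv t ht)).congr_deriv ?_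
    ring
  · intro t ht
    have ht' := Ioc_subset_Icc_self ht
    refine ((he_deriv t ht').exp.mul (((he₁_deriv t ht).mul (hR_deriv t ht')).add
      (hR₁_deriv t ht'))).congr_deriv ?_
    simp only [Pi.mul_apply, Pi.add_apply]
    ring
  · intro t ht
    have : |regKernel α a t| ≤ E * c0 := by
      rw [regKernel, abs_mul]
      exact mul_le_mul (hexp t ht) (hR_bound t ht) (abs_nonneg _) hEn
    have : 0 ≤ E * D1 + E * D2 := by positivity
    linarith
  · intro t ht
    have : |Real.exp (e t) * (e₁ t * R t + R₁ t)| ≤ E * D1 := by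
      rw [abs_mul]
      exact mul_le_mul (hexp t ht) (hM_bound t ht) (abs_nonneg _) hEn
    have : 0 ≤ E * c0 + E * D2 := by positivity
    simp only
    linarith
  · intro t ht
    have ht' := Ioc_subset_Icc_self ht
    have hl : 0 ≤ |Real.log t| := abs_nonneg _
    have i1 : |e₁ t * (e₁ t * R t + R₁ t)| ≤ b1 * D1 := by
      rw [abs_mul]
      exact mul_le_mul (he₁_bound t ht') (hM_bound t ht') (abs_nonneg _) hb1n
    have i2 : |e₂ t * R t| ≤ 3 * Q * (1 + |Real.log t|) * c0 := by
      rw [abs_mul]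
      exact mul_le_mul (he₂_bound t ht) (hR_bound t ht') (abs_nonneg _) (by positivity)
    have i3 : |e₁ t * R₁ t| ≤ b1 * (c1 * Q) := by
      rw [abs_mul]
      exact mul_le_mul (he₁_bound t ht') (hR₁_bound t ht') (abs_nonneg _) hb1n
    have i4 := hR₂_bound t ht'
    have i5 : |e₁ t * (e₁ t * R t + R₁ t) + (e₂ t * R t + (e₁ t * R₁ t + R₂ t))|
        ≤ D2 * (1 + |Real.log t|) := by
      refine (abs_add_le _ _).trans ?_
      have j1 := abs_add_le (e₂ t * R t) (e₁ t * R₁ t + R₂ t)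
      have j2 := abs_add_le (e₁ t * R₁ t) (R₂ t)
      have j3 : 0 ≤ b1 * D1 * |Real.log t| := by positivity
      have j4 : 0 ≤ (b1 * (c1 * Q) + (c2 * Q * Q + c1 * Q)) * |Real.log t| := by positivity
      rw [hD2]
      linarith
    simp only
    rw [abs_mul]
    calc _ ≤ E * (D2 * (1 + |Real.log t|)) :=
          mul_le_mul (hexp t ht') i5 (abs_nonneg _) hEn
      _ = E * D2 * (1 + |Real.log t|) := by ring
      _ ≤ _ := by
          refine mul_le_mul_of_nonneg_right ?_ (by positivity)
          have : 0 ≤ E * c0 + E * D1 := by positivity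
          linarith

end Kernel

/-! ### The generalized identity function as an average over a Beta law. -/

lemma ae_betaMeasure_mem_Ioo (p q : ℝ) : ∀ᵐ z ∂ProbabilityTheory.betaMeasure p q, z ∈ Ioo (0 : ℝ) 1 := by
  have hm : Measurable (ProbabilityTheory.betaPDF p q) :=
    (ProbabilityTheory.measurable_betaPDFReal p q).ennreal_ofReal
  rw [ProbabilityTheory.betaMeasure, ae_withDensity_iff hm]
  refine ae_of_all _ fun z hz => ?_
  by_contra h
  refine hz ?_
  rw [ProbabilityTheory.betaPDF_eq, if_neg fun h' => h ⟨h'.1, h'.2⟩, ENNReal.ofReal_zero]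

lemma integral_betaMeasure {p q : ℝ} (hp : 0 < p) (hq : 0 < q) (φ : ℝ → ℝ) :
    ∫ z, φ z ∂ProbabilityTheory.betaMeasure p q
      = ∫ z in Ioo (0 : ℝ) 1,
        1 / ProbabilityTheory.beta p q * z ^ (p - 1) * (1 - z) ^ (q - 1) * φ z := by
  have hm : Measurable (ProbabilityTheory.betaPDF p q) :=
    (ProbabilityTheory.measurable_betaPDFReal p q).ennreal_ofReal
  rw [ProbabilityTheory.betaMeasure, integral_withDensity_eq_integral_toReal_smul hm
    (ae_of_all _ fun z => ENNReal.ofReal_lt_top),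
    ← setIntegral_eq_integral_of_forall_compl_eq_zero (s := Ioo (0 : ℝ) 1)]
  · refine setIntegral_congr_fun measurableSet_Ioo fun z hz => ?_
    have h := (ProbabilityTheory.betaPDFReal_pos hz.1 hz.2 hp hq).le
    simp only [ProbabilityTheory.betaPDFReal, if_pos (show 0 < z ∧ z < 1 from hz)] at h
    simp only [ProbabilityTheory.betaPDF_of_pos_lt_one hz.1 hz.2, ENNReal.toReal_ofReal h,
      smul_eq_mul]
  · intro z hz
    rw [ProbabilityTheory.betaPDF_eq, if_neg fun h' => hz ⟨h'.1, h'.2⟩, ENNReal.ofReal_zero,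
      ENNReal.toReal_zero, zero_smul]

/-- The generalized identity function is an average of the regular part of the kernel. -/
lemma genId_eq_integral {α : ℝ → ℝ} {a T : ℝ} (ha : a ∈ Ioo (0 : ℝ) 1) (hα0 : α 0 = 1 + a)
    {t : ℝ} (ht : t ∈ Icc 0 T) :
    genId α t = ∫ z, regKernel α a (t * z) ∂ProbabilityTheory.betaMeasure (1 - a) a := by
  have hp : 0 < 1 - a := by linarith [ha.2]
  have := ProbabilityTheory.isProbabilityMeasureBeta hp ha.1
  have hΓ1 := Real.Gamma_pos_of_pos hp
  have hΓ2 := Real.Gamma_pos_of_pos ha.1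
  rcases ht.1.eq_or_lt with rfl | htpos
  -- The assigned value g(0) = 1 is the average of the constant `regKernel α a 0` against a
  -- probability measure.
  · have h0 : regKernel α a 0 = 1 := by
      rw [regKernel, regExp, hα0, sub_self, zero_mul, Real.exp_zero, one_mul,
        show 2 - (1 + a) = 1 - a by ring, mul_inv_cancel₀ hΓ1.ne']
    simp [genId, h0]
  · have hab : abar α = a := by rw [abar, hα0]; ring
    rw [genId, if_neg htpos.ne', hab, integral_betaMeasure hp ha.1]
    have hsub := intervalIntegral.integral_comp_mul_left (a := 0) (b := 1)
      (fun s => abel a (t - s) * varKernel α s) htpos.ne'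
    rw [mul_zero, mul_one, smul_eq_mul] at hsub
    have hsub' : ∫ s in (0 : ℝ)..t, abel a (t - s) * varKernel α s
        = t * ∫ z in (0 : ℝ)..1, abel a (t - t * z) * varKernel α (t * z) := by
      rw [hsub, mul_inv_cancel_left₀ htpos.ne']
    rw [hsub', intervalIntegral.integral_of_le zero_le_one, integral_Ioc_eq_integral_Ioo,
      ← integral_const_mul]
    refine setIntegral_congr_fun measurableSet_Ioo fun z hz => ?_
    have hz0 : 0 < z := hz.1
    have hz1 : 0 < 1 - z := by linarith [hz.2]
    have htz : 0 < t * z := mul_pos htpos hz0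
    have e1 : (t * z) ^ (1 - α (t * z))
        = t ^ (-a) * z ^ (-a) * Real.exp (regExp α a (t * z)) := by
      rw [regExp, mul_comm (1 + a - α (t * z)), ← Real.rpow_def_of_pos htz,
        ← Real.mul_rpow htpos.le hz0.le, ← Real.rpow_add htz]
      congr 1
      ring
    have e2 : (t - t * z) ^ (a - 1) = t ^ (a - 1) * (1 - z) ^ (a - 1) := by
      rw [← Real.mul_rpow htpos.le hz1.le]
      congr 1
      ring
    -- All singular powers of t cancel here; what remains is the Beta density in z times the regular
    -- kernel.
    have e3 : t * (t ^ (a - 1) * t ^ (-a)) = 1 := by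
      rw [← Real.rpow_add htpos, show a - 1 + -a = -1 by ring, Real.rpow_neg_one,
        mul_inv_cancel₀ htpos.ne']
    have e4 : ProbabilityTheory.beta (1 - a) a = Real.Gamma (1 - a) * Real.Gamma a := by
      rw [ProbabilityTheory.beta, show 1 - a + a = 1 by ring, Real.Gamma_one, div_one]
    simp only [abel, varKernel, regKernel]
    rw [e1, e2, e4, show 1 - a - 1 = -a by ring]
    calc t * (t ^ (a - 1) * (1 - z) ^ (a - 1) / Real.Gamma a *
          (t ^ (-a) * z ^ (-a) * Real.exp (regExp α a (t * z)) / Real.Gamma (2 - α (t * z))))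
        = (t * (t ^ (a - 1) * t ^ (-a))) * ((1 - z) ^ (a - 1) * (Real.Gamma a)⁻¹ *
          (z ^ (-a) * Real.exp (regExp α a (t * z)) * (Real.Gamma (2 - α (t * z)))⁻¹)) := by ring
      _ = _ := by
        rw [e3]
        field_simp

/-- Averages of `Φ(t z)` inherit the regularity of `Φ`. -/
lemma hasDerivWithinAt_average {ν : Measure ℝ} [IsProbabilityMeasure ν]
    (hν : ∀ᵐ z ∂ν, z ∈ Ioo (0 : ℝ) 1) {T C : ℝ} (hC : 0 ≤ C)
    {Φ Φ₁ Φ₂ : ℝ → ℝ}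
    (h1 : ∀ t ∈ Icc 0 T, HasDerivWithinAt Φ (Φ₁ t) (Icc 0 T) t)
    (h2 : ∀ t ∈ Ioc 0 T, HasDerivWithinAt Φ₁ (Φ₂ t) (Icc 0 T) t)
    (b0 : ∀ t ∈ Icc 0 T, |Φ t| ≤ C) (b1 : ∀ t ∈ Icc 0 T, |Φ₁ t| ≤ C)
    (b2 : ∀ t ∈ Ioc 0 T, |Φ₂ t| ≤ C * (1 + |Real.log t|)) :
    (∀ t ∈ Icc 0 T, HasDerivWithinAt (fun t => ∫ z, Φ (t * z) ∂ν) (∫ z, z * Φ₁ (t * z) ∂ν)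
      (Icc 0 T) t) ∧
    (∀ t ∈ Ioc 0 T, HasDerivWithinAt (fun t => ∫ z, z * Φ₁ (t * z) ∂ν)
      (∫ z, z * (z * Φ₂ (t * z)) ∂ν) (Icc 0 T) t) ∧
    (∀ t ∈ Icc 0 T, |∫ z, Φ (t * z) ∂ν| ≤ C) ∧ (∀ t ∈ Icc 0 T, |∫ z, z * Φ₁ (t * z) ∂ν| ≤ C) ∧
    (∀ t ∈ Ioc 0 T, |∫ z, z * (z * Φ₂ (t * z)) ∂ν| ≤ 2 * C * (|Real.log t| + 1)) := by
  have hmaps : ∀ {z : ℝ}, z ∈ Ioo (0 : ℝ) 1 → ∀ t ∈ Icc 0 T, t * z ∈ Icc 0 T := fun hz t ht =>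
    ⟨mul_nonneg ht.1 hz.1.le, (mul_le_of_le_one_right ht.1 hz.2.le).trans ht.2⟩
  have hmaps' : ∀ {z : ℝ}, z ∈ Ioo (0 : ℝ) 1 → ∀ t ∈ Ioc 0 T, t * z ∈ Ioc 0 T := fun hz t ht =>
    ⟨mul_pos ht.1 hz.1, (hmaps hz t (Ioc_subset_Icc_self ht)).2⟩
  have hcont : ∀ {f : ℝ → ℝ}, ContinuousOn f (Ioo 0 1) → AEStronglyMeasurable f ν := by
    intro f hf
    have h := hf.aestronglyMeasurable (μ := ν) measurableSet_Ioo
    rwa [Measure.restrict_eq_self_of_ae_mem hν] at h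
  have hlin : ∀ (z t : ℝ) (S : Set ℝ), HasDerivWithinAt (fun t => t * z) z S t := fun z t S => by
    simpa using (hasDerivWithinAt_id t S).mul_const z
  have hcomp : ∀ t, Continuous fun z : ℝ => t * z := fun t => continuous_const.mul continuous_id
  have hB1 : ∀ {z : ℝ}, z ∈ Ioo (0 : ℝ) 1 → ∀ t ∈ Icc 0 T, |z * Φ₁ (t * z)| ≤ C := by
    intro z hz t ht
    rw [abs_mul, abs_of_pos hz.1]
    calc z * |Φ₁ (t * z)| ≤ 1 * C :=
          mul_le_mul hz.2.le (b1 _ (hmaps hz t ht)) (abs_nonneg _) zero_le_one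
      _ = C := one_mul C
  -- One factor z, produced by the chain rule, absorbs the logarithm of z, since z |log z| < 1 on
  -- (0,1).
  have hB2 : ∀ {z : ℝ}, z ∈ Ioo (0 : ℝ) 1 → ∀ t ∈ Ioc 0 T,
      |z * (z * Φ₂ (t * z))| ≤ C * (2 + |Real.log t|) := by
    intro z hz t ht
    have hl := Real.abs_log_mul_self_lt z hz.1 hz.2.le
    rw [abs_mul, abs_of_pos hz.1] at hl
    have h3 := b2 _ (hmaps' hz t ht)
    rw [Real.log_mul ht.1.ne' hz.1.ne'] at h3
    have h4 := abs_add_le (Real.log t) (Real.log z)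
    have h5 : |z * Φ₂ (t * z)| ≤ C * (2 + |Real.log t|) := by
      rw [abs_mul, abs_of_pos hz.1]
      calc z * |Φ₂ (t * z)| ≤ z * (C * (1 + (|Real.log t| + |Real.log z|))) := by
            refine mul_le_mul_of_nonneg_left (h3.trans ?_) hz.1.le
            gcongr
        _ = C * (z * (1 + |Real.log t|) + |Real.log z| * z) := by ring
        _ ≤ C * (1 * (1 + |Real.log t|) + 1) := by
            have := hz.2.le
            gcongr
        _ = _ := by ring
    rw [abs_mul, abs_of_pos hz.1]
    exact (mul_le_of_le_one_left (abs_nonneg _) hz.2.le).trans h5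
  have habs : ∀ {f : ℝ → ℝ} {c : ℝ}, (∀ z ∈ Ioo (0 : ℝ) 1, |f z| ≤ c) → |∫ z, f z ∂ν| ≤ c := by
    intro f c hf
    have := norm_integral_le_of_norm_le_const (μ := ν) (f := f) (C := c) (hν.mono hf)
    simpa using this
  refine ⟨fun t ht => ?_, fun t ht => ?_, fun t ht => habs fun z hz => b0 _ (hmaps hz t ht),
    fun t ht => habs fun z hz => hB1 hz t ht, fun t ht => ?_⟩
  · refine hasDerivWithinAt_integral_of_bounded (C := C) (convex_Icc 0 T) ht
      (F := fun t z => Φ (t * z)) (F' := fun t z => z * Φ₁ (t * z)) ?_ ?_ ?_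
    · intro s hs
      have hΦ : ContinuousOn Φ (Icc 0 T) := fun x hx => (h1 x hx).continuousWithinAt
      exact hcont (hΦ.comp (hcomp s).continuousOn fun z hz => hmaps hz s hs)
    · exact fun s hs => hν.mono fun z hz => b0 _ (hmaps hz s hs)
    · refine hν.mono fun z hz s hs => ⟨?_, hB1 hz s hs⟩
      rw [mul_comm z]
      exact (h1 _ (hmaps hz s hs)).comp s (hlin z s _) (hmaps hz)
  -- The bound for the second derivative blows up as t → 0, so the differentiation is localized to
  -- [t/2, T], a neighbourhood of t within [0, T].
  · have ht2 : 0 < t / 2 := half_pos ht.1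
    have hsub : Icc (t / 2) T ⊆ Ioc 0 T := fun x hx => ⟨ht2.trans_le hx.1, hx.2⟩
    have htm : t ∈ Icc (t / 2) T := ⟨by linarith [ht.1], ht.2⟩
    have hlog : ∀ s ∈ Icc (t / 2) T, |Real.log s| ≤ |Real.log (t / 2)| + |Real.log T| := by
      intro s hs
      have i1 := Real.log_le_log ht2 hs.1
      have i2 := Real.log_le_log (hsub hs).1 hs.2
      have i3 := neg_abs_le (Real.log (t / 2))
      have i4 := le_abs_self (Real.log T)
      have i5 := abs_nonneg (Real.log T)
      have i6 := abs_nonneg (Real.log (t / 2))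
      rw [abs_le]
      constructor <;> linarith
    have key : HasDerivWithinAt (fun t => ∫ z, z * Φ₁ (t * z) ∂ν)
        (∫ z, z * (z * Φ₂ (t * z)) ∂ν) (Icc (t / 2) T) t := by
      refine hasDerivWithinAt_integral_of_bounded
        (C := C + C * (2 + (|Real.log (t / 2)| + |Real.log T|)))
        (convex_Icc _ _) htm (F := fun t z => z * Φ₁ (t * z))
        (F' := fun t z => z * (z * Φ₂ (t * z))) ?_ ?_ ?_
      · intro s hs
        have hΦ : ContinuousOn Φ₁ (Ioc 0 T) := fun x hx =>
          (h2 x hx).continuousWithinAt.mono Ioc_subset_Icc_self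
        exact hcont (continuousOn_id.mul
          (hΦ.comp (hcomp s).continuousOn fun z hz => hmaps' hz s (hsub hs)))
      · refine fun s hs => hν.mono fun z hz => (hB1 hz s (Ioc_subset_Icc_self (hsub hs))).trans ?_
        exact le_add_of_nonneg_right (by positivity)
      · refine hν.mono fun z hz s hs => ⟨?_, ?_⟩
        · have hd := (h2 _ (hmaps' hz s (hsub hs))).comp s (hlin z s (Icc (t / 2) T))
            fun x hx => hmaps hz x (Ioc_subset_Icc_self (hsub hx))
          refine (hd.const_mul z).congr_deriv ?_
          ring
        · refine (hB2 hz s (hsub hs)).trans ?_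
          have : C * (2 + |Real.log s|) ≤ C * (2 + (|Real.log (t / 2)| + |Real.log T|)) := by
            have := hlog s hs
            gcongr
          linarith
    refine key.mono_of_mem_nhdsWithin ?_
    rw [mem_nhdsWithin]
    exact ⟨Ioi (t / 2), isOpen_Ioi, by simp only [mem_Ioi]; linarith [ht.1],
      fun x hx => ⟨le_of_lt hx.1, hx.2.2⟩⟩
  · refine (habs fun z hz => hB2 hz t ht).trans ?_
    have : 0 ≤ C * |Real.log t| := by positivity
    linarith

/-- Every admissible exponent has a bound for its generalized identity function. -/
theorem exists_isGenIdBound {T a : ℝ} (hT : 0 < T) (ha : a ∈ Ioo (0 : ℝ) 1) {α : ℝ → ℝ} {Qα : ℝ}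
    (h : IsAdmissible α T Qα) (hαa : α 0 - 1 = a) : ∃ Qg : ℝ, 0 < Qg ∧ IsGenIdBound α T Qg := by
  have hα0 : α 0 = 1 + a := by linarith
  have hS : UniqueDiffOn ℝ (Icc 0 T) := uniqueDiffOn_Icc hT
  have h0T : (0 : ℝ) ∈ Icc 0 T := ⟨le_rfl, hT.le⟩
  set α₁ := derivWithin α (Icc 0 T) with hα₁
  set α₂ := derivWithin α₁ (Icc 0 T) with hα₂
  have e1 : iteratedDerivWithin 1 α (Icc 0 T) = α₁ := by
    funext t
    rw [iteratedDerivWithin_one]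
  have e2 : iteratedDerivWithin 2 α (Icc 0 T) = α₂ := by
    funext t
    rw [iteratedDerivWithin_succ, e1]
  have hd1 : ∀ t ∈ Icc 0 T, HasDerivWithinAt α (α₁ t) (Icc 0 T) t := fun t ht => by
    have := h.diff 0 (by norm_num)
    rw [iteratedDerivWithin_zero] at this
    exact (this t ht).hasDerivWithinAt
  have hd2 : ∀ t ∈ Icc 0 T, HasDerivWithinAt α₁ (α₂ t) (Icc 0 T) t := fun t ht => by
    have := h.diff 1 (by norm_num)
    rw [e1] at this
    exact (this t ht).hasDerivWithinAt
  have hb : ∀ t ∈ Icc 0 T, |α₁ t| ≤ Qα ∧ |α₂ t| ≤ Qα := fun t ht => by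
    have := h.bound t ht
    rw [e1, e2] at this
    have i1 := abs_nonneg (α₁ t)
    have i2 := abs_nonneg (α₂ t)
    have i3 := abs_nonneg (iteratedDerivWithin 3 α (Icc 0 T) t)
    constructor <;> linarith
  have hQ : 0 ≤ Qα := (abs_nonneg _).trans (hb 0 h0T).1
  obtain ⟨K₁, K₂, C, hC, hK1, hK2, hb0, hb1, hb2⟩ := exists_regKernel_deriv hT hQ h.mem_Ioo hα0
    h.deriv_zero hd1 hd2 (fun t ht => (hb t ht).1) (fun t ht => (hb t ht).2)
  have := ProbabilityTheory.isProbabilityMeasureBeta (by linarith [ha.2] : 0 < 1 - a) ha.1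
  obtain ⟨d1, d2, c0, c1, c2⟩ := hasDerivWithinAt_average (ae_betaMeasure_mem_Ioo (1 - a) a)
    hC hK1 hK2 hb0 hb1 hb2
  have hg : ∀ t ∈ Icc 0 T, genId α t
      = ∫ z, regKernel α a (t * z) ∂ProbabilityTheory.betaMeasure (1 - a) a :=
    fun t ht => genId_eq_integral ha hα0 ht
  have hgd : ∀ t ∈ Icc 0 T, HasDerivWithinAt (genId α)
      (∫ z, z * K₁ (t * z) ∂ProbabilityTheory.betaMeasure (1 - a) a) (Icc 0 T) t :=
    fun t ht => (d1 t ht).congr hg (hg t ht)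
  have hg1 : ∀ t ∈ Icc 0 T, derivWithin (genId α) (Icc 0 T) t
      = ∫ z, z * K₁ (t * z) ∂ProbabilityTheory.betaMeasure (1 - a) a :=
    fun t ht => (hgd t ht).derivWithin (hS t ht)
  have hgd2 : ∀ t ∈ Ioc 0 T, HasDerivWithinAt (derivWithin (genId α) (Icc 0 T))
      (∫ z, z * (z * K₂ (t * z)) ∂ProbabilityTheory.betaMeasure (1 - a) a) (Icc 0 T) t :=
    fun t ht => (d2 t ht).congr hg1 (hg1 t (Ioc_subset_Icc_self ht))
  -- The factor 2 is that of the averaged second derivative; the summand 1 makes the constant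
  -- positive when C = 0.
  refine ⟨2 * C + 1, by linarith, ⟨fun t ht => ?_, fun t ht => (hgd t ht).differentiableWithinAt,
    fun t ht => ?_, fun t ht => (hgd2 t ht).differentiableWithinAt, fun t ht => ?_⟩⟩
  · rw [hg t ht]
    linarith [c0 t ht]
  · rw [hg1 t ht]
    linarith [c1 t ht]
  · rw [(hgd2 t ht).derivWithin (hS t (Ioc_subset_Icc_self ht))]
    refine (c2 t ht).trans ?_
    gcongr
    linarith

/-! ### The two-grid estimate. -/

lemma stabConst_pos {T a Qg Qf : ℝ} (hT : 0 < T) (ha : 0 < a) : 0 < stabConst T a Qg Qf := by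
  have := srcConst_pos (Qg := Qg) (Qf := Qf) hT ha
  unfold stabConst
  positivity

/-- P enters once through f(P) and once through the Newton correction, hence 2 Qf. The second
derivative of f plays no role, as stability only needs linear growth of the source. -/
lemma abs_newton_le {f : ℝ → ℝ} {Qf : ℝ} (hf : ∀ x, |f x - f 0| ≤ Qf * |x|)
    (hf' : ∀ x, |deriv f x| ≤ Qf) (P U : GridFn) (i j : ℕ) :
    |newton f P U i j| ≤ |f 0| + Qf * |U i j| + 2 * Qf * |P i j| := by
  have h1 := abs_add_le (f (P i j)) (deriv f (P i j) * (U i j - P i j))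
  have h2 := abs_sub_abs_le_abs_sub (f (P i j)) (f 0)
  have h3 := hf (P i j)
  have h4 : |deriv f (P i j) * (U i j - P i j)| ≤ Qf * (|U i j| + |P i j|) := by
    rw [abs_mul]
    exact mul_le_mul (hf' _) (abs_sub _ _) (abs_nonneg _) ((abs_nonneg _).trans (hf' 0))
  unfold newton
  linarith

lemma Grid.sq_norm {G : Grid} (h : 0 ≤ G.dx * G.dy) (u : GridFn) : G.norm u ^ 2 = G.inner u u :=
  Real.sq_sqrt (Grid.inner_self_nonneg h u)

lemma sum_sq_le_sq_sum {a b c d e f : ℝ} (ha : 0 ≤ a) (hb : 0 ≤ b) (hc : 0 ≤ c) (hd : 0 ≤ d)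
    (he : 0 ≤ e) (hf : 0 ≤ f) :
    a ^ 2 + b ^ 2 + c ^ 2 + (d ^ 2 + e ^ 2 + f ^ 2) ≤ (a + b + c + d + e + f) ^ 2 := by
  have h : ∀ {x y : ℝ}, 0 ≤ x → 0 ≤ y → x ^ 2 + y ^ 2 ≤ (x + y) ^ 2 := fun {x y} hx hy => by
    nlinarith [mul_nonneg hx hy]
  linarith [h ha hb, h (add_nonneg ha hb) hc, h (add_nonneg (add_nonneg ha hb) hc) hd,
    h (add_nonneg (add_nonneg (add_nonneg ha hb) hc) hd) he,
    h (add_nonneg (add_nonneg (add_nonneg (add_nonneg ha hb) hc) hd) he) hf]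

/-- Stability of the linearized scheme on the fine grid. -/
theorem two_grid_stability {T a Qg Qf τ : ℝ} (hT : 0 < T) (ha : a ∈ Ioo (0 : ℝ) 1) (hQg : 0 < Qg)
    {α f : ℝ → ℝ} (hαa : α 0 - 1 = a) (hg : IsGenIdBound α T Qg)
    (hf : Differentiable ℝ f) (hf' : ∀ x, |deriv f x| ≤ Qf) {G : Grid} {J : ℕ}
    (hx : G.lx < G.rx) (hy : G.ly < G.ry) (hMx : 1 ≤ G.Mx) (hMy : 1 ≤ G.My) (hJ : 1 ≤ J)
    {u0 v0 : ℝ × ℝ → ℝ} (hv0 : ∀ p ∈ frontier G.domain, v0 p = 0) {N : ℕ} (hτ : 0 < τ)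
    (hN : N * τ = T)
    (hsmall : 2 * (Qg * (2 + logPrim T) + srcConst T a Qg Qf) * τ ≤ 1 / 2)
    {UH Uh : ℕ → GridFn} (hUH : IsNonlinearSolution G α f u0 v0 τ N UH)
    (hUh : IsLinearizedSolution (G.refine J) α f u0 v0 τ N
      (fun n => (G.refine J).sample (G.bicubic (UH n))) Uh) {n : ℕ} (hn : n ≤ N) :
    (G.refine J).norm (Uh n)
      ≤ Real.sqrt (stabConst T a Qg Qf * (1 + 4176 ^ 2 * stabConst T a Qg Qf)) *
        ((G.refine J).norm ((G.refine J).sample u0)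
          + (G.refine J).norm ((G.refine J).sample (fun p => f (u0 p)))
          + (G.refine J).norm ((G.refine J).sample v0)
          + G.norm (G.sample u0) + G.norm (G.sample (fun p => f (u0 p)))
          + G.norm (G.sample v0)) := by
  have hx' : (G.refine J).lx < (G.refine J).rx := hx
  have hy' : (G.refine J).ly < (G.refine J).ry := hy
  have hv0' : ∀ p ∈ frontier (G.refine J).domain, v0 p = 0 := hv0
  have hMx' : 1 ≤ (G.refine J).Mx := Nat.mul_pos hJ hMx
  have hMy' : 1 ≤ (G.refine J).My := Nat.mul_pos hJ hMy
  have hxy : 0 ≤ G.dx * G.dy := (mul_pos (Grid.dx_pos hx hMx) (Grid.dy_pos hy hMy)).le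
  have hxy' : 0 ≤ (G.refine J).dx * (G.refine J).dy :=
    (mul_pos (Grid.dx_pos hx' hMx') (Grid.dy_pos hy' hMy')).le
  have hlip : ∀ x, |f x - f 0| ≤ Qf * |x| := fun x => by
    have := convex_univ.norm_image_sub_le_of_norm_deriv_le (fun y _ => hf y) (fun y _ => hf' y)
      (mem_univ 0) (mem_univ x)
    simpa using this
  have hS := stabConst_pos (Qg := Qg) (Qf := Qf) hT ha.1
  set S := stabConst T a Qg Qf with hSdef
  have hcoarse : ∀ n ≤ N, G.inner (UH n) (UH n) ≤ S *
      (G.norm (G.sample u0) ^ 2 + G.norm (G.sample fun p => f (u0 p)) ^ 2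
        + G.norm (G.sample v0) ^ 2) := by
    intro n hn
    have hs : IsSchemeSolution G α f u0 v0 τ N (fun n p q => f (UH n p q)) UH :=
      ⟨hUH.first, hUH.step, hUH.init, hUH.bdry⟩
    -- The coarse scheme is not linearized, so P = 0 and Dp = 0.
    have h := hs.stability (P := fun _ _ _ => 0) (Dp := 0) hT ha hQg hαa hg hlip hx hy hMx hMy hv0
      hτ hN hsmall ?_ le_rfl (fun _ _ _ => by simp [Grid.closedSq]) n hn
    · rw [Grid.sq_norm hxy, Grid.sq_norm hxy, Grid.sq_norm hxy]
      simpa using h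
    · intro n _ _ i j _ _
      have h1 := abs_sub_abs_le_abs_sub (f (UH n i j)) (f 0)
      have h2 := hlip (UH n i j)
      simp only [abs_zero, mul_zero, add_zero]
      linarith
  have hs : IsSchemeSolution (G.refine J) α f u0 v0 τ N
      (fun n => newton f ((G.refine J).sample (G.bicubic (UH n))) (Uh n)) Uh :=
    ⟨hUh.first, hUh.step, hUh.init, hUh.bdry⟩
  -- The coarse estimate multiplied by the interpolation constant 4176² serves as the bound Dp for
  -- the interpolants.
  have hfine := hs.stability (P := fun n => (G.refine J).sample (G.bicubic (UH n)))
    (Dp := 4176 ^ 2 * (S * (G.norm (G.sample u0) ^ 2 + G.norm (G.sample fun p => f (u0 p)) ^ 2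
        + G.norm (G.sample v0) ^ 2))) hT ha hQg hαa hg hlip hx' hy' hMx' hMy' hv0'
      hτ hN hsmall (fun n _ _ i j _ _ => abs_newton_le hlip hf' _ _ i j) (by positivity)
      (fun n _ hn => ?_) n hn
  · rw [← hSdef, ← Grid.sq_norm hxy', ← Grid.sq_norm hxy', ← Grid.sq_norm hxy',
      ← Grid.sq_norm hxy'] at hfine
    have hnn : ∀ (G : Grid) (u : GridFn), 0 ≤ G.norm u := fun _ _ => Real.sqrt_nonneg _
    have hsum := sum_sq_le_sq_sum (hnn (G.refine J) ((G.refine J).sample u0))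
      (hnn (G.refine J) ((G.refine J).sample fun p => f (u0 p)))
      (hnn (G.refine J) ((G.refine J).sample v0)) (hnn G (G.sample u0))
      (hnn G (G.sample fun p => f (u0 p))) (hnn G (G.sample v0))
    set A := (G.refine J).norm ((G.refine J).sample u0) ^ 2
      + (G.refine J).norm ((G.refine J).sample fun p => f (u0 p)) ^ 2
      + (G.refine J).norm ((G.refine J).sample v0) ^ 2 with hA
    set B := G.norm (G.sample u0) ^ 2 + G.norm (G.sample fun p => f (u0 p)) ^ 2
      + G.norm (G.sample v0) ^ 2 with hB
    have hA0 : 0 ≤ A := by positivity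
    have hB0 : 0 ≤ B := by positivity
    refine le_of_sq_le_sq ?_ (mul_nonneg (Real.sqrt_nonneg _) ?_)
    · rw [mul_pow, Real.sq_sqrt (by positivity)]
      calc _ ≤ S * (A + 4176 ^ 2 * (S * B)) := hfine
        _ ≤ S * (1 + 4176 ^ 2 * S) * (A + B) := by
          have : 0 ≤ S * (4176 ^ 2 * S * A) := by positivity
          have : 0 ≤ S * B := by positivity
          linarith
        _ ≤ _ := by gcongr
    · have h1 := hnn (G.refine J) ((G.refine J).sample u0)
      have h2 := hnn (G.refine J) ((G.refine J).sample fun p => f (u0 p))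
      have h3 := hnn (G.refine J) ((G.refine J).sample v0)
      have h4 := hnn G (G.sample u0)
      have h5 := hnn G (G.sample fun p => f (u0 p))
      have h6 := hnn G (G.sample v0)
      linarith
  · refine (Grid.closedSq_bicubic_le G J hx hy hMx hMy hJ (UH n)).trans ?_
    -- The interpolation bound uses all coarse nodes; U_H vanishes on the boundary, so the interior
    -- norm suffices.
    rw [Grid.ZeroBdry.closedSq_eq (hUH.bdry n hn) hMx hMy]
    exact mul_le_mul_of_nonneg_left (hcoarse n hn) (by norm_num)

end STG

theorem theorem4p2 (T a : ℝ) (hT : 0 < T) (ha : a ∈ Set.Ioo (0 : ℝ) 1) :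
    -- every admissible exponent has a bound `Qg` for its generalized identity function
    (∀ (α : ℝ → ℝ) (Qα : ℝ), STG.IsAdmissible α T Qα → α 0 - 1 = a →
      ∃ Qg : ℝ, 0 < Qg ∧ STG.IsGenIdBound α T Qg) ∧
    -- stability, with constants that depend only on `T`, `a`, `Qg`, `Qf`
    (∀ Qg Qf : ℝ, 0 < Qg → 0 < Qf → ∃ Q τ₀ : ℝ, 0 < Q ∧ 0 < τ₀ ∧
      ∀ (α : ℝ → ℝ) (Qα : ℝ), STG.IsAdmissible α T Qα → α 0 - 1 = a →
        STG.IsGenIdBound α T Qg →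
      ∀ f : ℝ → ℝ, ContDiff ℝ 2 f → (∀ v, |deriv f v| ≤ Qf) →
      -- `G` is the coarse grid and `G.refine J` the fine grid
      ∀ (G : STG.Grid) (J : ℕ), G.lx < G.rx → G.ly < G.ry → 1 ≤ G.Mx → 1 ≤ G.My → 2 ≤ J →
      ∀ u0 v0 : ℝ × ℝ → ℝ, (∀ p ∈ frontier G.domain, v0 p = 0) →
      ∀ (N : ℕ) (τ : ℝ), 1 ≤ N → τ = T / N → τ ≤ τ₀ →
      ∀ UH Uh : ℕ → STG.GridFn,
        STG.IsNonlinearSolution G α f u0 v0 τ N UH →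
        STG.IsLinearizedSolution (G.refine J) α f u0 v0 τ N
          (fun n => (G.refine J).sample (G.bicubic (UH n))) Uh →
      ∀ n, 1 ≤ n → n ≤ N →
        (G.refine J).norm (Uh n) ≤ Q *
          ((G.refine J).norm ((G.refine J).sample u0)
            + (G.refine J).norm ((G.refine J).sample (fun p => f (u0 p)))
            + (G.refine J).norm ((G.refine J).sample v0)
            + G.norm (G.sample u0)
            + G.norm (G.sample (fun p => f (u0 p)))
            + G.norm (G.sample v0))) := by
  refine ⟨fun α Qα h hαa => STG.exists_isGenIdBound hT ha h hαa, fun Qg Qf hQg hQf => ?_⟩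
  have hS := STG.stabConst_pos (Qg := Qg) (Qf := Qf) hT ha.1
  have hC := STG.srcConst_pos (Qg := Qg) (Qf := Qf) hT ha.1
  have hlog := STG.logPrim_nonneg hT.le
  -- The threshold for τ is the smallness condition of the Gronwall step, solved for τ.
  refine ⟨Real.sqrt (STG.stabConst T a Qg Qf * (1 + 4176 ^ 2 * STG.stabConst T a Qg Qf)),
    1 / (4 * (Qg * (2 + STG.logPrim T) + STG.srcConst T a Qg Qf)),
    Real.sqrt_pos.2 (by positivity), by positivity, ?_⟩
  intro α Qα _ hαa hg f hf hf' G J hx hy hMx hMy hJ u0 v0 hv0 N τ hN hτ hτ₀ UH Uh hUH hUh n _ hn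
  have hN0 : (0 : ℝ) < N := by exact_mod_cast hN
  have hτ0 : 0 < τ := by rw [hτ]; positivity
  refine STG.two_grid_stability hT ha hQg hαa hg (hf.differentiable (by norm_num)) hf' hx hy hMx hMy
    (by omega) hv0 hτ0 (by rw [hτ]; field_simp) ?_ hUH hUh hn
  rw [le_div_iff₀ (by positivity)] at hτ₀
  linarith
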